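/- **Setting.** Let $1\le p\le q<n$, and let $\mathcal A$ be a probability distribution on $\mathbb R^{n\times n}$ with (finite) mean $A=\mathbf E[\tilde A]$ symmetric, with eigenvalues $\lambda_1\ge\dots\ge\lambda_n$ and corresponding orthonormal eigenvectors $u_1,\dots,u_n$. Let $U=\sum_{i\le q}u_iu_i^T$, assume $\Delta=\lambda_q-\lambda_{q+1}>0$, and let $0<\epsilon\le1$, $\eta>0$. **Algorithm (Alecton).** Angular phase: $Y_0$ is uniformly distributed on $\{Y\in\mathbb R^{n\times p}: Y^TY=I\}$ and $Y_{k+1}=Y_k+\eta\tilde A_kY_k$, where $\tilde A_0,\tilde A_1,\dots$ are drawn from $\mathcal A$, independently of each other and of $Y_0$. After $K$ steps put $\hat Y=Y_K(Y_K^TY_K)^{-1/2}$ (and $\hat Y=0$ if $Y_K^TY_K$ is singular). Radial phase: $\bar R=\frac1L\sum_{l=0}^{L-1}\hat Y^T\tilde A_{K+l}\hat Y$, using the next $L\ge 1$ samples. Success occurs at timestep $k$ if for every $z\in\mathbb R^p$, $z\neq0$, one has $Y_kz\ne0$ and $\|UY_kz\|^2/\|Y_kz\|^2\ge1-\epsilon$.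 Let $F_t$ be the event that success occurs at no timestep $k<t$. **Conditions.** (Variance, AVC) With parameters $(\sigma_a,\sigma_r)$: for all $y\in\mathbb R^n$ and all symmetric $W\succeq0$ commuting with $A$, $\mathbf E[y^T\tilde A^TW\tilde Ay]\le\sigma_a^2\operatorname{tr}(W)\|y\|^2$ and $\mathbf E[(y^T\tilde Ay)^2]\le\sigma_r^2\|y\|^4$. (Rank) Either $p=1$, or $\tilde A\sim\mathcal A$ has rank at most one almost surely. (Step size) $\gamma:=\frac{2n\sigma_a^2p^2(p+\epsilon)}{\Delta\epsilon}\eta\le1$. Let $Z_p(\gamma)=2\bigl(1-\mathbf E[\det(I+\gamma p^{-1}(R^TR)^{-1})^{-1}]\bigr)$, where $R\in\mathbb R^{p\times p}$ has independent standard normal entries. **Theorem.** Under the variance, rank and step-size conditions, for every integer $t\ge1$, $$\mathbf P(F_t)\le Z_p(\gamma)+\frac{4n\sigma_a^2p^2(p+\epsilon)}{\Delta^2\gamma\epsilon t}\log\!\left(\frac{np^2}{\gamma q\epsilon}\right).$$ Moreover, if the samples $\tilde A$ are almost surely symmetric or $p=1$, then for all integers $K\ge0$, $L\ge1$ and every $\psi>0$,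 $$\mathbf P\bigl(\|\bar R-\hat Y^TA\hat Y\|_F^2\ge\psi\bigr)\le\frac{p^2\sigma_r^2}{L\psi}.$$ -/

import Mathlib

open MeasureTheory ProbabilityTheory Matrix

/-- The product (equivalently, Borel) sigma-algebra on real matrices. -/
instance matrixMeasurableSpace (m n : ℕ) : MeasurableSpace (Matrix (Fin m) (Fin n) ℝ) :=
  inferInstanceAs (MeasurableSpace (Fin m → Fin n → ℝ))

noncomputable section

namespace Alecton

/-- The squared Euclidean norm `‖v‖²` of a vector. -/
def sqNorm {n : ℕ} (v : Fin n → ℝ) : ℝ := ∑ i, v i ^ 2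

/-- The squared Frobenius norm of a matrix. -/
def frobSq {m n : ℕ} (M : Matrix (Fin m) (Fin n) ℝ) : ℝ := ∑ i, ∑ j, M i j ^ 2

/-! ### The sampling distribution and its mean -/

/-- `A` is the expected value of the sampling distribution `𝒜`. -/
def HasMean {n : ℕ} (𝒜 : Measure (Matrix (Fin n) (Fin n) ℝ))
    (A : Matrix (Fin n) (Fin n) ℝ) : Prop :=
  ∀ i j, Integrable (fun M : Matrix (Fin n) (Fin n) ℝ => M i j) 𝒜 ∧ ∫ M, M i j ∂𝒜 = A i j

/-- `lam 0 ≥ lam 1 ≥ ⋯ ≥ lam (n-1)` are the eigenvalues of `A`, with multiplicity, and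
`u 0, …, u (n-1)` are corresponding orthonormal eigenvectors (so that `A` is symmetric). -/
structure IsEigendecomposition {n : ℕ} (A : Matrix (Fin n) (Fin n) ℝ)
    (lam : Fin n → ℝ) (u : Fin n → Fin n → ℝ) : Prop where
  antitone : Antitone lam
  orthonormal : ∀ i j, u i ⬝ᵥ u j = if i = j then 1 else 0
  eigen : ∀ i, A *ᵥ u i = lam i • u i

/-- The projection matrix onto the span of the first `q` of the vectors `u i`. -/
def topProj {n : ℕ} (u : Fin n → Fin n → ℝ) (q : ℕ) : Matrix (Fin n) (Fin n) ℝ :=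
  ∑ i : Fin n, if (i : ℕ) < q then vecMulVec (u i) (u i) else 0

/-- The eigengap `λ_q - λ_{q+1}` (in one-based indexing). -/
def eigengap {n : ℕ} (lam : Fin n → ℝ) (q : ℕ) (hq : q < n) : ℝ :=
  lam ⟨q - 1, lt_of_le_of_lt (Nat.sub_le q 1) hq⟩ - lam ⟨q, hq⟩

/-! ### The conditions -/

/-- The Alecton variance condition with parameters `(σa, σr)`. -/
structure VarianceCondition {n : ℕ} (𝒜 : Measure (Matrix (Fin n) (Fin n) ℝ))
    (A : Matrix (Fin n) (Fin n) ℝ) (σa σr : ℝ) : Prop where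
  angular : ∀ (y : Fin n → ℝ) (W : Matrix (Fin n) (Fin n) ℝ), W.PosSemidef → Commute W A →
    Integrable (fun M : Matrix (Fin n) (Fin n) ℝ => y ⬝ᵥ ((Mᵀ * W * M) *ᵥ y)) 𝒜 ∧
    ∫ M, y ⬝ᵥ ((Mᵀ * W * M) *ᵥ y) ∂𝒜 ≤ σa ^ 2 * W.trace * sqNorm y
  radial : ∀ y : Fin n → ℝ,
    Integrable (fun M : Matrix (Fin n) (Fin n) ℝ => (y ⬝ᵥ (M *ᵥ y)) ^ 2) 𝒜 ∧
    ∫ M, (y ⬝ᵥ (M *ᵥ y)) ^ 2 ∂𝒜 ≤ σr ^ 2 * sqNorm y ^ 2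

/-- The Alecton rank condition: rank-one recovery, or samples of rank (at most) one. -/
def RankCondition {n : ℕ} (𝒜 : Measure (Matrix (Fin n) (Fin n) ℝ)) (p : ℕ) : Prop :=
  p = 1 ∨ ∀ᵐ M ∂𝒜, M.rank ≤ 1

/-- The normalized step size `γ = 2 n σa² p² (p + ε) η / (Δ ε)`. -/
def stepParam (n p : ℕ) (σa Δ ε η : ℝ) : ℝ :=
  2 * n * σa ^ 2 * p ^ 2 * (p + ε) / (Δ * ε) * η

/-! ### The algorithm -/

/-- The uniform distribution on `{Y | Yᵀ Y = I}`: the (unique) probability measure carried by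
this set that is invariant under left multiplication by orthogonal matrices. -/
structure IsUniformStiefel {n p : ℕ} (ν : Measure (Matrix (Fin n) (Fin p) ℝ)) : Prop where
  prob : IsProbabilityMeasure ν
  orthonormal : ∀ᵐ Y ∂ν, Yᵀ * Y = 1
  invariant : ∀ Q ∈ Matrix.orthogonalGroup (Fin n) ℝ, ν.map (fun Y => Q * Y) = ν

/-- The randomness used by a run of Alecton: an initial matrix `Y₀` that is uniform on
`{Y | Yᵀ Y = I}`, and samples `S 0, S 1, …` drawn independently of each other and of `Y₀`
from the sampling distribution `𝒜`. -/
structure IsRun {Ω : Type*} [MeasurableSpace Ω] (μ : Measure Ω) {n p : ℕ}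
    (𝒜 : Measure (Matrix (Fin n) (Fin n) ℝ))
    (Y₀ : Ω → Matrix (Fin n) (Fin p) ℝ) (S : ℕ → Ω → Matrix (Fin n) (Fin n) ℝ) : Prop where
  measurable_init : Measurable Y₀
  measurable_sample : ∀ k, Measurable (S k)
  law_init : IsUniformStiefel (μ.map Y₀)
  law_sample : ∀ k, μ.map (S k) = 𝒜
  indep_samples : iIndepFun S μ
  indep_init : IndepFun Y₀ (fun ω k => S k ω) μ

variable {Ω : Type*} {n p : ℕ}

/-- The angular phase: `Y_{k+1} = Y_k + η S_k Y_k`. -/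
def iter (η : ℝ) (Y₀ : Ω → Matrix (Fin n) (Fin p) ℝ)
    (S : ℕ → Ω → Matrix (Fin n) (Fin n) ℝ) : ℕ → Ω → Matrix (Fin n) (Fin p) ℝ
  | 0, ω => Y₀ ω
  | k + 1, ω => iter η Y₀ S k ω + η • (S k ω * iter η Y₀ S k ω)

/-- Success of the iterate `Y`: for all `z ≠ 0` the ratio `‖U Y z‖² / ‖Y z‖²` is defined and is
at least `1 - ε`. -/
def Success (U : Matrix (Fin n) (Fin n) ℝ) (ε : ℝ) (Y : Matrix (Fin n) (Fin p) ℝ) : Prop :=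
  ∀ z : Fin p → ℝ, z ≠ 0 →
    Y *ᵥ z ≠ 0 ∧ 1 - ε ≤ sqNorm (U *ᵥ (Y *ᵥ z)) / sqNorm (Y *ᵥ z)

/-- The failure event `F_t`: success has not occurred at any timestep `k < t`. -/
def failureEvent (U : Matrix (Fin n) (Fin n) ℝ) (ε η : ℝ) (Y₀ : Ω → Matrix (Fin n) (Fin p) ℝ)
    (S : ℕ → Ω → Matrix (Fin n) (Fin n) ℝ) (t : ℕ) : Set Ω :=
  {ω | ∀ k < t, ¬ Success U ε (iter η Y₀ S k ω)}

/-- `Ŷ = Y (Yᵀ Y)^{-1/2}` (equal to `0` by convention if `Yᵀ Y` is singular). -/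
def orthonormalize (Y : Matrix (Fin n) (Fin p) ℝ) : Matrix (Fin n) (Fin p) ℝ :=
  Y * cfc Real.sqrt (Yᵀ * Y)⁻¹

/-- The output `Ŷ` of an angular phase of `K` steps. -/
def angularOutput (η : ℝ) (Y₀ : Ω → Matrix (Fin n) (Fin p) ℝ)
    (S : ℕ → Ω → Matrix (Fin n) (Fin n) ℝ) (K : ℕ) (ω : Ω) : Matrix (Fin n) (Fin p) ℝ :=
  orthonormalize (iter η Y₀ S K ω)

/-- The radial phase after `K` angular steps: `R̄ = (1/L) ∑_{l < L} Ŷᵀ S_{K+l} Ŷ`, the average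
over the `L` fresh samples that follow the `K` samples of the angular phase. -/
def radialMean (η : ℝ) (Y₀ : Ω → Matrix (Fin n) (Fin p) ℝ)
    (S : ℕ → Ω → Matrix (Fin n) (Fin n) ℝ) (K L : ℕ) (ω : Ω) : Matrix (Fin p) (Fin p) ℝ :=
  (L : ℝ)⁻¹ • ∑ l ∈ Finset.range L,
    (angularOutput η Y₀ S K ω)ᵀ * S (K + l) ω * angularOutput η Y₀ S K ω

/-! ### The function `Z_p` -/

/-- The law of a `p × p` matrix with independent standard normal entries. -/
def gaussianMatrix (p : ℕ) : Measure (Matrix (Fin p) (Fin p) ℝ) :=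
  (Measure.pi fun _ : Fin p => Measure.pi fun _ : Fin p => gaussianReal 0 1).map
    (Matrix.of : (Fin p → Fin p → ℝ) → Matrix (Fin p) (Fin p) ℝ)

/-- `Z_p(γ) = 2 (1 - 𝔼[det(I + γ p⁻¹ (Rᵀ R)⁻¹)⁻¹])` for a standard Gaussian matrix `R`. -/
def Z (p : ℕ) (γ : ℝ) : ℝ :=
  2 * (1 - ∫ R : Matrix (Fin p) (Fin p) ℝ,
    (det (1 + (γ * (p : ℝ)⁻¹) • (Rᵀ * R)⁻¹))⁻¹ ∂(gaussianMatrix p))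

end Alecton

end

noncomputable section

namespace Alecton

section

/-! ### Linear algebra -/

/-! Angular phase. Put `W = U + a(1 - U)` with a small `a`, and follow the potential `ratio =
det(YᵀUY) / det(YᵀWY)`, which lies in `[0, 1]` and depends only on the column space of a full-rank
`Y`. Up to a right factor, `YᵀWY = 1` and `YᵀUY = diagonal t` with all `t i` in `[0, 1]`; then
`ratio = ∏ t i`. An unsuccessful iterate with `YᵀUY` invertible has some `1 - t i ≥ aε`
(`bounds_of_not_success`).

By the rank condition a step adds a rank-one matrix to `Y`, so the new determinants are explicit,
and `ratio_add_vecMulVec_ge` bounds the new potential below by a linear term minus a quadratic one.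
In expectation the linear term gains `2ηΔ ∑ (1 - t i)` from the eigengap, and the variance condition
makes the quadratic term cost at most half of that (`expected_ratio_ge`). Hence `x = 1 - ratio`
contracts in mean by the factor `1 - ηΔ/2` as long as `x < 1/2` and there is no success. A stopping
argument (`IsRun.hitting_bound`) bounds the failure probability by `2 𝔼[x(Y₀)]`, the cost of ever
reaching `x ≥ 1/2`, plus `log(1/(aε)) / (t ηΔ/2)`, the cost of contracting for `t` steps without
falling below `aε`.

Initial potential. Orthogonal invariance replaces `Y₀` by a Gaussian matrix and `U` by a coordinate
projection, so that `ratio = det M / det(M + aH)` with independent Gram matrices `M` of `q` rows and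
`H` of `n - q` rows. Convexity of `1/det` in `H` replaces `aH` by its mean, a multiple of the
identity. It remains to pass from `q` Gaussian rows to the `p` rows in `Z`: the mean of `det M /
det(M + ck)` for `k` rows is nondecreasing in `k ≥ p`, since deleting a random row does not increase
it on average (`sum_shrink_erase_le`). The choice `a = γq/(np²)` serves both the drift and the
initial bound.

Radial phase. Conditionally on the past, each entry of the error is a centred average of `L`
independent variables with second moment at most `σr²`; sum the variances over the `p²` entries and
apply Markov's inequality. -/

theorem PosSemidef.transpose_mul_mul {k m : Type*} [Fintype k] [Fintype m]
    {V : Matrix m m ℝ} (hV : V.PosSemidef) (Y : Matrix m k ℝ) : (Yᵀ * V * Y).PosSemidef := by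
  simpa [conjTranspose_eq_transpose_of_trivial] using hV.conjTranspose_mul_mul_same Y

theorem posSemidef_transpose_mul_self {k m : Type*} [Fintype k] [Fintype m]
    (Y : Matrix m k ℝ) : (Yᵀ * Y).PosSemidef := by
  simpa [conjTranspose_eq_transpose_of_trivial] using posSemidef_conjTranspose_mul_self Y

theorem exists_orthogonal_diagonalization {k : Type*} [Fintype k] [DecidableEq k]
    {M : Matrix k k ℝ} (hM : M.IsHermitian) :
    ∃ (V : Matrix k k ℝ) (t : k → ℝ), Vᵀ * V = 1 ∧ V * Vᵀ = 1 ∧ Vᵀ * M * V = diagonal t := by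
  refine ⟨hM.eigenvectorUnitary, hM.eigenvalues, ?_, ?_, ?_⟩
  · have := Unitary.coe_star_mul_self hM.eigenvectorUnitary
    simpa [star_eq_conjTranspose, conjTranspose_eq_transpose_of_trivial] using this
  · have := Unitary.coe_mul_star_self hM.eigenvectorUnitary
    simpa [star_eq_conjTranspose, conjTranspose_eq_transpose_of_trivial] using this
  · have := hM.conjStarAlgAut_star_eigenvectorUnitary
    simpa [Unitary.conjStarAlgAut_apply, star_eq_conjTranspose,
      conjTranspose_eq_transpose_of_trivial] using this

theorem exists_whitening {k : Type*} [Fintype k] [DecidableEq k]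
    {N : Matrix k k ℝ} (hN : N.PosDef) :
    ∃ C : Matrix k k ℝ, IsUnit C.det ∧ Cᵀ * N * C = 1 := by
  obtain ⟨V, t, hV, hV', hd⟩ := exists_orthogonal_diagonalization hN.1
  have hVu : IsUnit V.det := (Matrix.isUnit_iff_isUnit_det V).1 (IsUnit.of_mul_eq_one _ hV')
  have hinj : Function.Injective V.mulVec := mulVec_injective_of_isUnit
    ((Matrix.isUnit_iff_isUnit_det V).2 hVu)
  have hpd : (diagonal t).PosDef := by
    rw [← hd]
    simpa [conjTranspose_eq_transpose_of_trivial] using hN.conjTranspose_mul_mul_same hinj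
  have ht : ∀ i, 0 < t i := by simpa using hpd
  refine ⟨V * diagonal fun i => (Real.sqrt (t i))⁻¹, ?_, ?_⟩
  · rw [det_mul, det_diagonal]
    refine hVu.mul (isUnit_iff_ne_zero.2 (Finset.prod_ne_zero_iff.2 fun i _ => ?_))
    have := Real.sqrt_pos.2 (ht i); positivity
  · rw [transpose_mul, diagonal_transpose]
    calc _ = (diagonal fun i => (Real.sqrt (t i))⁻¹) * (Vᵀ * N * V) *
        (diagonal fun i => (Real.sqrt (t i))⁻¹) := by simp only [Matrix.mul_assoc]
      _ = 1 := by
        rw [hd, diagonal_mul_diagonal, diagonal_mul_diagonal, ← diagonal_one]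
        congr 1; ext i
        have h1 := Real.sqrt_pos.2 (ht i)
        have h2 := Real.mul_self_sqrt (ht i).le
        field_simp
        nlinarith

theorem exists_simultaneous_diagonalization {k : Type*} [Fintype k] [DecidableEq k]
    {N M : Matrix k k ℝ} (hN : N.PosDef) (hM : M.IsHermitian) :
    ∃ (C : Matrix k k ℝ) (t : k → ℝ), IsUnit C.det ∧ Cᵀ * N * C = 1 ∧
      Cᵀ * M * C = diagonal t := by
  obtain ⟨C, hC, hCN⟩ := exists_whitening hN
  have hM' : (Cᵀ * M * C).IsHermitian := by
    simpa [conjTranspose_eq_transpose_of_trivial] using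
      isHermitian_conjTranspose_mul_mul C hM
  obtain ⟨V, t, hV, hV', hd⟩ := exists_orthogonal_diagonalization hM'
  refine ⟨C * V, t, ?_, ?_, ?_⟩
  · rw [det_mul]
    exact hC.mul ((Matrix.isUnit_iff_isUnit_det V).1 (IsUnit.of_mul_eq_one _ hV'))
  · calc _ = Vᵀ * (Cᵀ * N * C) * V := by simp only [Matrix.mul_assoc, transpose_mul]
      _ = 1 := by rw [hCN, Matrix.mul_one, hV]
  · rw [← hd]; simp only [Matrix.mul_assoc, transpose_mul]

theorem exists_eq_vecMulVec_of_rank_le_one {m k : Type*} [Fintype m] [Fintype k]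
    [DecidableEq k] {S : Matrix m k ℝ} (hS : S.rank ≤ 1) :
    ∃ (a : m → ℝ) (b : k → ℝ), S = vecMulVec a b := by
  have h : Module.finrank ℝ (LinearMap.range S.mulVecLin) ≤ 1 := hS
  obtain ⟨⟨v, hv⟩, hspan⟩ := finrank_le_one_iff.1 h
  choose c hc using fun j : k => hspan ⟨S *ᵥ Pi.single j 1, ⟨Pi.single j 1, rfl⟩⟩
  refine ⟨v, c, ?_⟩
  ext i j
  have := congrFun (congrArg Subtype.val (hc j)) i
  simp [vecMulVec_apply] at this ⊢
  rw [← this]; ring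

theorem exists_eq_vecMulVec_of_subsingleton {m k : Type*} [Unique k]
    (S : Matrix m k ℝ) : ∃ (a : m → ℝ) (b : k → ℝ), S = vecMulVec a b :=
  ⟨fun i => S i default, fun _ => 1, by
    ext i j; rw [Subsingleton.elim j default]; simp [vecMulVec_apply]⟩

/-- The determinant of a symmetric rank-two update. -/
theorem det_add_rank_two {k : Type*} [Fintype k] [DecidableEq k] {G : Matrix k k ℝ}
    (hG : IsUnit G.det) (hsymm : Gᵀ = G) (b c : k → ℝ) (α : ℝ) :
    (G + vecMulVec c b + vecMulVec b c + α • vecMulVec b b).det =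
      G.det * ((1 + b ⬝ᵥ (G⁻¹ *ᵥ c)) ^ 2 +
        (b ⬝ᵥ (G⁻¹ *ᵥ b)) * (α - c ⬝ᵥ (G⁻¹ *ᵥ c))) := by
  have hinv : (G⁻¹)ᵀ = G⁻¹ := by rw [transpose_nonsing_inv, hsymm]
  have hsw : c ⬝ᵥ (G⁻¹ *ᵥ b) = b ⬝ᵥ (G⁻¹ *ᵥ c) := by
    rw [dotProduct_mulVec, ← mulVec_transpose, hinv, dotProduct_comm]
  -- The update is `(c + αb)bᵀ + bcᵀ`, of rank two, so the matrix determinant lemma leaves a `2 × 2`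
  -- determinant.
  let P : Matrix k (Fin 2) ℝ := of fun i j => ![c i + α * b i, b i] j
  let Q : Matrix (Fin 2) k ℝ := of ![b, c]
  have h1 : G + vecMulVec c b + vecMulVec b c + α • vecMulVec b b = G + P * Q := by
    ext i j
    simp [P, Q, Matrix.mul_apply, Fin.sum_univ_two, vecMulVec_apply]
    ring
  have hQP : ∀ i j, (Q * G⁻¹ * P) i j = (![b, c] i) ⬝ᵥ (G⁻¹ *ᵥ (fun l => P l j)) := by
    intro i j
    rw [Matrix.mul_assoc]
    rfl
  have hP0 : (fun l => P l 0) = c + α • b := by ext l; simp [P]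
  have hP1 : (fun l => P l 1) = b := by ext l; simp [P]
  rw [h1, det_add_mul _ _ hG, det_fin_two]
  simp only [Matrix.add_apply, hQP, hP0, hP1, mulVec_add, mulVec_smul, dotProduct_add, dotProduct_smul,
    smul_eq_mul]
  simp [hsw]
  left
  ring

end

section

/-! ### The potential function -/

/-- The matrix `a • 1 + (1 - a) • U`, written so that it visibly interpolates between `U` and `1`. -/
def blend {n : ℕ} (U : Matrix (Fin n) (Fin n) ℝ) (a : ℝ) : Matrix (Fin n) (Fin n) ℝ :=
  U + a • (1 - U)

/-- The potential `det (Yᵀ U Y) / det (Yᵀ W Y)` with `W = blend U a`. -/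
def ratio {n p : ℕ} (U : Matrix (Fin n) (Fin n) ℝ) (a : ℝ) (Y : Matrix (Fin n) (Fin p) ℝ) : ℝ :=
  (Yᵀ * U * Y).det / (Yᵀ * blend U a * Y).det

/-- The trace of `1 - (Yᵀ W Y)⁻¹ (Yᵀ U Y)` with `W = blend U a`. -/
def defect {n p : ℕ} (U : Matrix (Fin n) (Fin n) ℝ) (a : ℝ) (Y : Matrix (Fin n) (Fin p) ℝ) : ℝ :=
  p - ((Yᵀ * blend U a * Y)⁻¹ * (Yᵀ * U * Y)).trace

variable {n p : ℕ} {U : Matrix (Fin n) (Fin n) ℝ} {a : ℝ}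

/-- A symmetric idempotent matrix. -/
structure IsProj (U : Matrix (Fin n) (Fin n) ℝ) : Prop where
  symm : Uᵀ = U
  idem : U * U = U

theorem IsProj.posSemidef (hU : IsProj U) : U.PosSemidef := by
  have := posSemidef_transpose_mul_self U
  rwa [hU.symm, hU.idem] at this

theorem IsProj.one_sub (hU : IsProj U) : IsProj (1 - U) where
  symm := by rw [transpose_sub, transpose_one, hU.symm]
  idem := by
    rw [Matrix.sub_mul, Matrix.one_mul, Matrix.mul_sub, Matrix.mul_one, hU.idem]; simp

theorem IsProj.blend_posSemidef (hU : IsProj U) (ha : 0 ≤ a) : (blend U a).PosSemidef :=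
  hU.posSemidef.add (hU.one_sub.posSemidef.smul ha)

theorem gram_mul_right (V : Matrix (Fin n) (Fin n) ℝ) (Y : Matrix (Fin n) (Fin p) ℝ)
    (C : Matrix (Fin p) (Fin p) ℝ) : (Y * C)ᵀ * V * (Y * C) = Cᵀ * (Yᵀ * V * Y) * C := by
  simp only [Matrix.mul_assoc, transpose_mul]

theorem ratio_mul_right (Y : Matrix (Fin n) (Fin p) ℝ) {C : Matrix (Fin p) (Fin p) ℝ}
    (hC : IsUnit C.det) : ratio U a (Y * C) = ratio U a Y := by
  have := hC.ne_zero
  simp only [ratio, gram_mul_right, det_mul, det_transpose]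
  rw [mul_div_mul_right _ _ this, mul_div_mul_left _ _ this]

theorem defect_mul_right (Y : Matrix (Fin n) (Fin p) ℝ) {C : Matrix (Fin p) (Fin p) ℝ}
    (hC : IsUnit C.det) : defect U a (Y * C) = defect U a Y := by
  have hC' : IsUnit Cᵀ.det := by rwa [det_transpose]
  simp only [defect, gram_mul_right]
  congr 1
  rw [Matrix.mul_inv_rev, Matrix.mul_inv_rev, Matrix.mul_assoc, Matrix.mul_assoc, ← Matrix.mul_assoc Cᵀ⁻¹,
    ← Matrix.mul_assoc Cᵀ⁻¹, nonsing_inv_mul _ hC', Matrix.one_mul, ← Matrix.mul_assoc,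
    trace_mul_comm, ← Matrix.mul_assoc, mul_nonsing_inv_cancel_right _ _ hC, trace_mul_comm]

/-- Both Gram matrices are diagonalized by one congruence. The bound `t i ≤ 1` holds because `1 -
diagonal t` is the Gram form of `a(1 - U)`, which is positive semidefinite. -/
theorem exists_normal_form (hU : IsProj U) (ha : 0 < a) {Y : Matrix (Fin n) (Fin p) ℝ}
    (hY : (Yᵀ * blend U a * Y).det ≠ 0) :
    ∃ (C : Matrix (Fin p) (Fin p) ℝ) (t : Fin p → ℝ), IsUnit C.det ∧
      (Y * C)ᵀ * blend U a * (Y * C) = 1 ∧ (Y * C)ᵀ * U * (Y * C) = diagonal t ∧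
      ∀ i, 0 ≤ t i ∧ t i ≤ 1 := by
  have hN : (Yᵀ * blend U a * Y).PosSemidef :=
    PosSemidef.transpose_mul_mul (hU.blend_posSemidef ha.le) Y
  obtain ⟨C, t, hC, h1, h2⟩ := exists_simultaneous_diagonalization
    (hN.posDef_iff_det_ne_zero.2 hY) (PosSemidef.transpose_mul_mul hU.posSemidef Y).1
  rw [← gram_mul_right] at h1 h2
  refine ⟨C, t, hC, h1, h2, fun i => ⟨?_, ?_⟩⟩
  · have := PosSemidef.transpose_mul_mul hU.posSemidef (Y * C)
    rw [h2, posSemidef_diagonal_iff] at this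
    exact this i
  · have := (PosSemidef.transpose_mul_mul (hU.one_sub.posSemidef.smul ha.le) (Y * C)).diag_nonneg
      (i := i)
    have h3 : (Y * C)ᵀ * (a • (1 - U)) * (Y * C) = 1 - diagonal t := by
      rw [← h1, ← h2, ← Matrix.sub_mul, ← Matrix.mul_sub, blend, add_sub_cancel_left]
    rw [h3] at this
    simpa using this

theorem det_ne_zero_of_blend (hU : IsProj U) (ha : 0 < a) {Y : Matrix (Fin n) (Fin p) ℝ}
    (h : (Yᵀ * U * Y).det ≠ 0) : (Yᵀ * blend U a * Y).det ≠ 0 := by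
  have h1 := PosSemidef.transpose_mul_mul hU.posSemidef Y
  have h2 := PosSemidef.transpose_mul_mul (hU.one_sub.posSemidef.smul ha.le) Y
  have h3 := (h1.posDef_iff_det_ne_zero.2 h).add_posSemidef h2
  rw [← Matrix.add_mul, ← Matrix.mul_add] at h3
  exact h3.det_pos.ne'

theorem ratio_eq_prod {Y : Matrix (Fin n) (Fin p) ℝ} {t : Fin p → ℝ}
    (h1 : Yᵀ * blend U a * Y = 1) (h2 : Yᵀ * U * Y = diagonal t) : ratio U a Y = ∏ i, t i := by
  rw [ratio, h1, h2, det_one, det_diagonal, div_one]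

theorem defect_eq_sum {Y : Matrix (Fin n) (Fin p) ℝ} {t : Fin p → ℝ}
    (h1 : Yᵀ * blend U a * Y = 1) (h2 : Yᵀ * U * Y = diagonal t) :
    defect U a Y = ∑ i, (1 - t i) := by
  rw [defect, h1, h2, inv_one, Matrix.one_mul, trace_diagonal]
  simp

theorem ratio_nonneg (hU : IsProj U) (ha : 0 < a) (Y : Matrix (Fin n) (Fin p) ℝ) :
    0 ≤ ratio U a Y :=
  div_nonneg (PosSemidef.transpose_mul_mul hU.posSemidef Y).det_nonneg
    (PosSemidef.transpose_mul_mul (hU.blend_posSemidef ha.le) Y).det_nonneg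

theorem ratio_le_one (hU : IsProj U) (ha : 0 < a) (Y : Matrix (Fin n) (Fin p) ℝ) :
    ratio U a Y ≤ 1 := by
  by_cases h : (Yᵀ * blend U a * Y).det = 0
  · rw [ratio, h, div_zero]; exact zero_le_one
  · obtain ⟨C, t, hC, h1, h2, ht⟩ := exists_normal_form hU ha h
    rw [← ratio_mul_right Y hC, ratio_eq_prod h1 h2]
    exact Finset.prod_le_one (fun i _ => (ht i).1) fun i _ => (ht i).2

theorem one_sub_prod_le_sum {ι : Type*} (s : Finset ι) {t : ι → ℝ}
    (ht : ∀ i, 0 ≤ t i ∧ t i ≤ 1) : 1 - ∏ i ∈ s, t i ≤ ∑ i ∈ s, (1 - t i) := by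
  classical
  induction s using Finset.induction_on with
  | empty => simp
  | insert i s hi ih =>
    rw [Finset.prod_insert hi, Finset.sum_insert hi]
    have h1 : 0 ≤ ∏ j ∈ s, t j := Finset.prod_nonneg fun j _ => (ht j).1
    have h2 : ∏ j ∈ s, t j ≤ 1 := Finset.prod_le_one (fun j _ => (ht j).1) fun j _ => (ht j).2
    nlinarith [ht i]

theorem sqNorm_eq_dotProduct (v : Fin n → ℝ) : sqNorm v = v ⬝ᵥ v := by
  simp [sqNorm, dotProduct, sq]

theorem dotProduct_gram_mulVec (V : Matrix (Fin n) (Fin n) ℝ) (Y : Matrix (Fin n) (Fin p) ℝ)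
    (z : Fin p → ℝ) : z ⬝ᵥ ((Yᵀ * V * Y) *ᵥ z) = (Y *ᵥ z) ⬝ᵥ (V *ᵥ (Y *ᵥ z)) := by
  rw [← mulVec_mulVec, ← mulVec_mulVec, dotProduct_mulVec, vecMul_transpose]

theorem IsProj.sqNorm_mulVec (hU : IsProj U) (v : Fin n → ℝ) :
    sqNorm (U *ᵥ v) = v ⬝ᵥ (U *ᵥ v) := by
  have h : (U *ᵥ v) ⬝ᵥ (U *ᵥ v) = v ⬝ᵥ ((Uᵀ * U) *ᵥ v) := by
    rw [← mulVec_mulVec, dotProduct_mulVec v, vecMul_transpose]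
  rw [sqNorm_eq_dotProduct, h, hU.symm, hU.idem]

/-- If the iterate is unsuccessful, then its potential is bounded away from one. -/
theorem bounds_of_not_success (hU : IsProj U) (ha : 0 < a) (ha1 : a ≤ 1) {ε : ℝ} (hε : 0 < ε)
    {Y : Matrix (Fin n) (Fin p) ℝ} (hY : (Yᵀ * U * Y).det ≠ 0)
    (hs : ¬ Success U ε Y) : a * ε ≤ defect U a Y ∧ a * ε ≤ 1 - ratio U a Y := by
  have hM : (Yᵀ * U * Y).PosDef :=
    (PosSemidef.transpose_mul_mul hU.posSemidef Y).posDef_iff_det_ne_zero.2 hY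
  obtain ⟨C, t, hC, h1, h2, ht⟩ := exists_normal_form hU ha (det_ne_zero_of_blend hU ha hY)
  rw [← ratio_mul_right Y hC, ← defect_mul_right Y hC, ratio_eq_prod h1 h2, defect_eq_sum h1 h2]
  simp only [Success, not_forall, not_and_or, exists_prop] at hs
  obtain ⟨z, hz, hz'⟩ := hs
  have hYz : Y *ᵥ z ≠ 0 := by
    intro h
    have := hM.dotProduct_mulVec_pos hz
    rw [star_trivial, dotProduct_gram_mulVec, h] at this
    simp at this
  replace hz' := hz'.resolve_left (not_not.2 hYz)
  have hpos : 0 < sqNorm (Y *ᵥ z) := by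
    rw [sqNorm_eq_dotProduct]
    exact (dotProduct_self_star_pos_iff (v := Y *ᵥ z)).2 hYz
  rw [not_le, div_lt_iff₀ hpos] at hz'
  set w := C⁻¹ *ᵥ z with hw
  have hzw : Y *ᵥ z = (Y * C) *ᵥ w := by
    rw [hw, ← mulVec_mulVec, mulVec_mulVec _ C, mul_nonsing_inv _ hC, one_mulVec]
  have eU : sqNorm (U *ᵥ (Y *ᵥ z)) = ∑ i, t i * w i ^ 2 := by
    rw [hU.sqNorm_mulVec, hzw, ← dotProduct_gram_mulVec, h2]
    simp only [dotProduct, mulVec_diagonal]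
    exact Finset.sum_congr rfl fun i _ => by ring
  have eW : sqNorm (Y *ᵥ z) * a = ∑ i, (a * t i + (1 - t i)) * w i ^ 2 := by
    have e1 : ∑ i, w i ^ 2 = (Y *ᵥ z) ⬝ᵥ (blend U a *ᵥ (Y *ᵥ z)) := by
      rw [hzw, ← dotProduct_gram_mulVec, h1, one_mulVec]
      simp [dotProduct, sq]
    have e2 : (Y *ᵥ z) ⬝ᵥ (blend U a *ᵥ (Y *ᵥ z)) =
        sqNorm (U *ᵥ (Y *ᵥ z)) + a * (sqNorm (Y *ᵥ z) - sqNorm (U *ᵥ (Y *ᵥ z))) := by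
      rw [hU.sqNorm_mulVec, sqNorm_eq_dotProduct (Y *ᵥ z), blend, add_mulVec, smul_mulVec,
        sub_mulVec, one_mulVec, dotProduct_add, dotProduct_smul, dotProduct_sub, smul_eq_mul]
    have e3 : ∑ i, (a * t i + (1 - t i)) * w i ^ 2 =
        ∑ i, w i ^ 2 - (1 - a) * ∑ i, t i * w i ^ 2 := by
      rw [Finset.mul_sum, ← Finset.sum_sub_distrib]
      exact Finset.sum_congr rfl fun i _ => by ring
    rw [e3, e1, e2, eU]; ring
  -- In the coordinates `w`, both sides of the failed inequality are weighted sums of the `w i ^ 2`,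
  -- so it already fails for a single coefficient.
  obtain ⟨i, hi⟩ : ∃ i, a * t i < (1 - ε) * (a * t i + (1 - t i)) := by
    by_contra! hcon
    have : ∑ i, (1 - ε) * ((a * t i + (1 - t i)) * w i ^ 2) ≤ ∑ i, a * (t i * w i ^ 2) :=
      Finset.sum_le_sum fun i _ => by nlinarith [hcon i, sq_nonneg (w i)]
    rw [← Finset.mul_sum, ← Finset.mul_sum, ← eW, ← eU] at this
    nlinarith
  -- Here `hi` says `aε t i < (1 - ε)(1 - t i)`; add `aε(1 - t i)` to both sides and use `a ≤ 1`.
  have hti : a * ε ≤ 1 - t i := by nlinarith [ht i, mul_nonneg hε.le (sub_nonneg.2 (ht i).2)]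
  refine ⟨hti.trans (Finset.single_le_sum (f := fun i => 1 - t i)
    (fun j _ => sub_nonneg.2 (ht j).2) (Finset.mem_univ i)), hti.trans (sub_le_sub_left ?_ _)⟩
  rw [← Finset.mul_prod_erase _ _ (Finset.mem_univ i)]
  exact mul_le_of_le_one_right (ht i).1
    (Finset.prod_le_one (fun j _ => (ht j).1) fun j _ => (ht j).2)

/-! ### One step of the iteration -/

theorem gram_add_vecMulVec {V : Matrix (Fin n) (Fin n) ℝ} (hV : Vᵀ = V)
    (Y : Matrix (Fin n) (Fin p) ℝ) (x : Fin n → ℝ) (b : Fin p → ℝ) :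
    (Y + vecMulVec x b)ᵀ * V * (Y + vecMulVec x b) =
      Yᵀ * V * Y + vecMulVec (Yᵀ *ᵥ (V *ᵥ x)) b + vecMulVec b (Yᵀ *ᵥ (V *ᵥ x)) +
        (x ⬝ᵥ (V *ᵥ x)) • vecMulVec b b := by
  have h : vecMul (vecMul x V) Y = Yᵀ *ᵥ (V *ᵥ x) := by
    rw [← mulVec_transpose, ← mulVec_transpose, hV]
  rw [transpose_add, Matrix.add_mul, Matrix.add_mul, Matrix.mul_add, Matrix.mul_add,
    transpose_vecMulVec, vecMulVec_mul, vecMulVec_mul, vecMulVec_mul_vecMulVec, h,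
    mul_vecMulVec, ← mulVec_mulVec, ← dotProduct_mulVec]
  simp only [vecMulVec_smul, add_assoc]

/-- Write `s` for the sum over `i` on the left. The rank-two determinant formula gives at least `τ(1
+ s)²` for the numerator, after dropping a nonnegative Schur complement, and at most `v` for the
denominator. The claim is the linearization `(1 + s)²/v ≥ 2(1 + s) - v`. -/
theorem ratio_add_vecMulVec_ge (hU : IsProj U) (ha : 0 < a) {Y : Matrix (Fin n) (Fin p) ℝ}
    {t : Fin p → ℝ} (h1 : Yᵀ * blend U a * Y = 1) (h2 : Yᵀ * U * Y = diagonal t)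
    (ht : ∀ i, 0 < t i) (x : Fin n → ℝ) (b : Fin p → ℝ) {K : Matrix (Fin n) (Fin p) ℝ}
    (hK : K = vecMulVec x b) :
    ratio U a Y * (1 + 2 * ∑ i, (t i)⁻¹ * (Yᵀ * U * K) i i - 2 * (Yᵀ * blend U a * K).trace -
      (Kᵀ * blend U a * K).trace) ≤ ratio U a (Y + K) := by
  subst hK
  have hW := hU.blend_posSemidef ha.le
  have hWs : (blend U a)ᵀ = blend U a := by
    simpa [conjTranspose_eq_transpose_of_trivial] using hW.1.eq
  set c := Yᵀ *ᵥ (U *ᵥ x) with hc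
  set d := Yᵀ *ᵥ (blend U a *ᵥ x) with hd
  have es : ∑ i, (t i)⁻¹ * (Yᵀ * U * vecMulVec x b) i i = ∑ i, b i * ((t i)⁻¹ * c i) := by
    refine Finset.sum_congr rfl fun i _ => ?_
    rw [mul_vecMulVec, ← mulVec_mulVec, vecMulVec_apply]; ring
  have et : (Yᵀ * blend U a * vecMulVec x b).trace = b ⬝ᵥ d := by
    rw [mul_vecMulVec, ← mulVec_mulVec, trace_vecMulVec, dotProduct_comm]
  have eq : ((vecMulVec x b)ᵀ * blend U a * vecMulVec x b).trace =
      (b ⬝ᵥ b) * (x ⬝ᵥ (blend U a *ᵥ x)) := by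
    rw [transpose_vecMulVec, Matrix.mul_assoc, mul_vecMulVec, vecMulVec_mul_vecMulVec,
      trace_vecMulVec, dotProduct_smul, smul_eq_mul, mul_comm]
  have hdetU : IsUnit (Yᵀ * U * Y).det := by
    rw [h2, det_diagonal]
    exact isUnit_iff_ne_zero.2 (Finset.prod_ne_zero_iff.2 fun i _ => (ht i).ne')
  have hinv : (Yᵀ * U * Y)⁻¹ = diagonal fun i => (t i)⁻¹ := by
    apply inv_eq_left_inv
    rw [h2, diagonal_mul_diagonal, ← diagonal_one]
    congr 1; ext i; exact inv_mul_cancel₀ (ht i).ne'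
  have hdU := det_add_rank_two hdetU (by rw [h2, diagonal_transpose]) b c (x ⬝ᵥ (U *ᵥ x))
  rw [← gram_add_vecMulVec hU.symm, hinv] at hdU
  have hdW := det_add_rank_two (G := Yᵀ * blend U a * Y) (by rw [h1, det_one]; exact isUnit_one)
    (by rw [h1, transpose_one]) b d (x ⬝ᵥ (blend U a *ᵥ x))
  rw [← gram_add_vecMulVec hWs, h1, inv_one, det_one, one_mul, one_mulVec, one_mulVec] at hdW
  have hs : b ⬝ᵥ ((diagonal fun i => (t i)⁻¹) *ᵥ c) = ∑ i, b i * ((t i)⁻¹ * c i) := by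
    simp [dotProduct, mulVec_diagonal]
  have hβ : 0 ≤ b ⬝ᵥ ((diagonal fun i => (t i)⁻¹) *ᵥ b) := by
    simp only [dotProduct, mulVec_diagonal]
    refine Finset.sum_nonneg fun i _ => ?_
    have := ht i
    have h3 : 0 ≤ (t i)⁻¹ * (b i * b i) := mul_nonneg (by positivity) (mul_self_nonneg _)
    linarith
  -- The difference of the two sides is the squared `U`-seminorm of the residual of `x` after
  -- projection onto the columns of `Y`.
  have hκ : c ⬝ᵥ ((diagonal fun i => (t i)⁻¹) *ᵥ c) ≤ x ⬝ᵥ (U *ᵥ x) := by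
    set w := (diagonal fun i => (t i)⁻¹) *ᵥ c with hw
    have h3 := hU.posSemidef.dotProduct_mulVec_nonneg (x - Y *ᵥ w)
    have h4 : (Y *ᵥ w) ⬝ᵥ (U *ᵥ x) = c ⬝ᵥ w := by
      rw [hc, dotProduct_comm c, dotProduct_mulVec w, vecMul_transpose]
    have h5 : x ⬝ᵥ (U *ᵥ (Y *ᵥ w)) = c ⬝ᵥ w := by
      rw [← h4, dotProduct_mulVec, ← mulVec_transpose, hU.symm, dotProduct_comm]
    have h6 : (Y *ᵥ w) ⬝ᵥ (U *ᵥ (Y *ᵥ w)) = c ⬝ᵥ w := by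
      rw [← dotProduct_gram_mulVec, h2, dotProduct_comm]
      congr 1
      ext i
      rw [mulVec_diagonal, hw, mulVec_diagonal, mul_inv_cancel_left₀ (ht i).ne']
    rw [star_trivial, mulVec_sub, dotProduct_sub, sub_dotProduct, sub_dotProduct, h4, h5, h6] at h3
    linarith
  have hCS : (b ⬝ᵥ d) ^ 2 ≤ (b ⬝ᵥ b) * (d ⬝ᵥ d) := by
    have := Finset.sum_mul_sq_le_sq_mul_sq Finset.univ b d
    simpa [dotProduct, sq] using this
  rw [es, et, eq]
  rw [hs] at hdU
  set s := ∑ i, b i * ((t i)⁻¹ * c i)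
  have hdU' : (Yᵀ * U * Y).det * (1 + s) ^ 2 ≤
      ((Y + vecMulVec x b)ᵀ * U * (Y + vecMulVec x b)).det := by
    rw [hdU]
    refine mul_le_mul_of_nonneg_left ?_ (PosSemidef.transpose_mul_mul hU.posSemidef Y).det_nonneg
    nlinarith
  have hτ : ratio U a Y = (Yᵀ * U * Y).det := by rw [ratio, h1, det_one, div_one]
  have hτ0 : 0 < ratio U a Y := lt_of_le_of_ne (ratio_nonneg hU ha Y)
    (by rw [hτ]; exact hdetU.ne_zero.symm)
  rw [← hτ] at hdU'
  have hN0 := (PosSemidef.transpose_mul_mul hW (Y + vecMulVec x b)).det_nonneg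
  set τ := ratio U a Y
  set v := 1 + 2 * (b ⬝ᵥ d) + (b ⬝ᵥ b) * (x ⬝ᵥ (blend U a *ᵥ x)) with hv
  -- In `hdW` the terms `(b ⬝ᵥ d)²` and `-(b ⬝ᵥ b)(d ⬝ᵥ d)` have nonpositive sum, by Cauchy–Schwarz.
  have hNv : ((Y + vecMulVec x b)ᵀ * blend U a * (Y + vecMulVec x b)).det ≤ v := by
    rw [hdW]; nlinarith
  have hgoal : 1 + 2 * s - 2 * (b ⬝ᵥ d) - (b ⬝ᵥ b) * (x ⬝ᵥ (blend U a *ᵥ x)) =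
      2 * (1 + s) - v := by rw [hv]; ring
  rw [hgoal]
  -- If the new denominator vanishes, the new ratio is `0` by convention. The new numerator vanishes
  -- too, which forces `1 + s = 0`, and the lower bound becomes `-τv ≤ 0`.
  by_cases hN : ((Y + vecMulVec x b)ᵀ * blend U a * (Y + vecMulVec x b)).det = 0
  · have hM : ((Y + vecMulVec x b)ᵀ * U * (Y + vecMulVec x b)).det = 0 := by
      by_contra h
      exact det_ne_zero_of_blend hU ha h hN
    rw [hM] at hdU'
    have : (1 + s) ^ 2 ≤ 0 := by
      by_contra! h
      have := mul_pos hτ0 h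
      linarith
    have h0 : 1 + s = 0 := pow_eq_zero_iff two_ne_zero |>.1 (le_antisymm this (sq_nonneg _))
    rw [ratio, hM, zero_div, h0]
    have : 0 ≤ v := hN0.trans hNv
    nlinarith
  · have hNpos := lt_of_le_of_ne hN0 (Ne.symm hN)
    rw [ratio, le_div_iff₀ hNpos]
    refine le_trans ?_ hdU'
    rw [mul_assoc]
    refine mul_le_mul_of_nonneg_left ?_ hτ0.le
    by_cases h : 0 ≤ 2 * (1 + s) - v
    · nlinarith [mul_le_mul_of_nonneg_left hNv h, sq_nonneg (1 + s - v)]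
    · push Not at h
      nlinarith [mul_nonneg hN0 (sub_nonneg.2 h.le), sq_nonneg (1 + s)]

end

section

/-! ### Measurability of matrix operations -/

instance matrixBorelSpace (m n : ℕ) : BorelSpace (Matrix (Fin m) (Fin n) ℝ) :=
  inferInstanceAs (BorelSpace (Fin m → Fin n → ℝ))

instance matrixSecondCountable (m n : ℕ) :
    SecondCountableTopology (Matrix (Fin m) (Fin n) ℝ) :=
  inferInstanceAs (SecondCountableTopology (Fin m → Fin n → ℝ))

theorem measurable_entry {m n : ℕ} (i : Fin m) (j : Fin n) :
    Measurable fun M : Matrix (Fin m) (Fin n) ℝ => M i j :=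
  (measurable_pi_apply j).comp (measurable_pi_apply (X := fun _ : Fin m => Fin n → ℝ) i)

theorem measurable_inv {k : ℕ} :
    Measurable fun M : Matrix (Fin k) (Fin k) ℝ => M⁻¹ := by
  have h : (fun M : Matrix (Fin k) (Fin k) ℝ => M⁻¹) = fun M => (M.det)⁻¹ • M.adjugate := by
    ext M; rw [inv_def, Ring.inverse_eq_inv']
  rw [h]
  refine measurable_pi_iff.2 fun i => measurable_pi_iff.2 fun j => ?_
  have h1 : Measurable fun M : Matrix (Fin k) (Fin k) ℝ => M.det :=
    (continuous_id.matrix_det).measurable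
  have h2 : Measurable fun M : Matrix (Fin k) (Fin k) ℝ => M.adjugate i j :=
    (continuous_id.matrix_adjugate.matrix_elem i j).measurable
  exact h1.inv.mul h2

variable {n p q : ℕ} {U A : Matrix (Fin n) (Fin n) ℝ} {a : ℝ}

theorem continuous_gram (V : Matrix (Fin n) (Fin n) ℝ) :
    Continuous fun Y : Matrix (Fin n) (Fin p) ℝ => Yᵀ * V * Y :=
  (continuous_id.matrix_transpose.matrix_mul continuous_const).matrix_mul continuous_id

theorem measurable_det_gram (V : Matrix (Fin n) (Fin n) ℝ) :
    Measurable fun Y : Matrix (Fin n) (Fin p) ℝ => (Yᵀ * V * Y).det :=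
  (continuous_gram V).matrix_det.measurable

theorem measurable_ratio : Measurable (ratio (p := p) U a) := by
  have h1 := measurable_det_gram (p := p) U
  have h2 := measurable_det_gram (p := p) (blend U a)
  exact h1.div h2

theorem measurable_trace_mul {α : Type*} [MeasurableSpace α] {k l : ℕ}
    {f : α → Matrix (Fin k) (Fin l) ℝ} {g : α → Matrix (Fin l) (Fin k) ℝ}
    (hf : Measurable f) (hg : Measurable g) : Measurable fun x => (f x * g x).trace := by
  simp only [trace, diag, Matrix.mul_apply]
  exact Finset.measurable_sum _ fun i _ => Finset.measurable_sum _ fun j _ =>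
    ((measurable_entry i j).comp hf).mul ((measurable_entry j i).comp hg)

theorem measurable_defect : Measurable (defect (p := p) U a) := by
  have h1 : Measurable fun Y : Matrix (Fin n) (Fin p) ℝ => (Yᵀ * blend U a * Y)⁻¹ :=
    measurable_inv.comp (continuous_gram _).measurable
  have h2 : Measurable fun Y : Matrix (Fin n) (Fin p) ℝ => Yᵀ * U * Y :=
    (continuous_gram U).measurable
  have h3 := measurable_trace_mul h1 h2
  unfold defect
  exact measurable_const.sub h3

theorem measurable_step (η : ℝ) :
    Measurable fun x : Matrix (Fin n) (Fin p) ℝ × Matrix (Fin n) (Fin n) ℝ =>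
      x.1 + η • (x.2 * x.1) :=
  (continuous_fst.add ((continuous_snd.matrix_mul continuous_fst).const_smul η)).measurable

theorem integrable_ratio_comp {α : Type*} [MeasurableSpace α] {ν : Measure α}
    [IsFiniteMeasure ν] (hU : IsProj U) (ha : 0 < a) {f : α → Matrix (Fin n) (Fin p) ℝ}
    (hf : Measurable f) : Integrable (fun x => ratio U a (f x)) ν :=
  Integrable.of_bound (measurable_ratio.comp hf).aestronglyMeasurable 1
    (.of_forall fun x => by
      rw [Real.norm_of_nonneg (ratio_nonneg hU ha _)]; exact ratio_le_one hU ha _)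

/-! ### The eigenbasis -/

theorem eq_conj_of_eigen {lam : Fin n → ℝ} {u : Fin n → Fin n → ℝ}
    (h : IsEigendecomposition A lam u) :
    (of u) * (of u)ᵀ = 1 ∧ (of u)ᵀ * of u = 1 ∧ A = (of u)ᵀ * diagonal lam * of u := by
  have h1 : (of u) * (of u)ᵀ = 1 := by
    ext i j
    rw [Matrix.one_apply, ← h.orthonormal i j]
    simp [Matrix.mul_apply, dotProduct]
  have h2 := mul_eq_one_comm.1 h1
  refine ⟨h1, h2, ?_⟩
  have h3 : A * (of u)ᵀ = (of u)ᵀ * diagonal lam := by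
    ext i j
    have := congrFun (h.eigen j) i
    simp only [mulVec, dotProduct, Pi.smul_apply, smul_eq_mul] at this
    rw [mul_diagonal, transpose_apply, of_apply, mul_comm, ← this]
    simp [Matrix.mul_apply]
  rw [← h3, Matrix.mul_assoc, h2, Matrix.mul_one]

theorem topProj_eq_conj (u : Fin n → Fin n → ℝ) (q : ℕ) :
    topProj u q = (of u)ᵀ * diagonal (fun i : Fin n => if (i : ℕ) < q then (1 : ℝ) else 0) * of u := by
  ext i j
  rw [topProj, Matrix.sum_apply, Matrix.mul_apply]
  simp only [mul_diagonal, transpose_apply, of_apply]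
  refine Finset.sum_congr rfl fun k _ => ?_
  split_ifs <;> simp [vecMulVec_apply]

theorem isProj_conj {O : Matrix (Fin n) (Fin n) ℝ} (hO : O * Oᵀ = 1) (q : ℕ) :
    IsProj (Oᵀ * diagonal (fun i : Fin n => if (i : ℕ) < q then (1 : ℝ) else 0) * O) where
  symm := by simp [Matrix.mul_assoc, transpose_mul]
  idem := by
    calc _ = Oᵀ * (diagonal (fun i : Fin n => if (i : ℕ) < q then (1 : ℝ) else 0) * (O * Oᵀ) *
          diagonal (fun i : Fin n => if (i : ℕ) < q then (1 : ℝ) else 0)) * O := by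
          simp only [Matrix.mul_assoc]
      _ = _ := by
        rw [hO, Matrix.mul_one, diagonal_mul_diagonal]
        congr 3; ext i; split_ifs <;> simp

theorem sum_ite_lt (hqn : q ≤ n) : ∑ i : Fin n, (if (i : ℕ) < q then (1 : ℝ) else 0) = q := by
  rw [Finset.sum_boole, ← Fintype.card_subtype]
  congr 1
  simpa using Fintype.card_fin_lt_of_le hqn

variable {lam : Fin n → ℝ} {u : Fin n → Fin n → ℝ}

theorem dotProduct_conj_mulVec (O : Matrix (Fin n) (Fin n) ℝ) (d : Fin n → ℝ) (y : Fin n → ℝ) :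
    y ⬝ᵥ ((Oᵀ * diagonal d * O) *ᵥ y) = ∑ i, d i * (O *ᵥ y) i ^ 2 := by
  rw [dotProduct_gram_mulVec]
  simp only [dotProduct, mulVec_diagonal]
  exact Finset.sum_congr rfl fun i _ => by ring

theorem conj_mul_conj {O : Matrix (Fin n) (Fin n) ℝ} (hO : O * Oᵀ = 1) (d e : Fin n → ℝ) :
    (Oᵀ * diagonal d * O) * (Oᵀ * diagonal e * O) = Oᵀ * diagonal (fun i => d i * e i) * O := by
  calc _ = Oᵀ * (diagonal d * (O * Oᵀ) * diagonal e) * O := by simp only [Matrix.mul_assoc]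
    _ = _ := by rw [hO, Matrix.mul_one, diagonal_mul_diagonal]

theorem one_sub_topProj (h : IsEigendecomposition A lam u) (q : ℕ) : 1 - topProj u q =
    (of u)ᵀ * diagonal (fun i : Fin n => if (i : ℕ) < q then (0 : ℝ) else 1) * of u := by
  obtain ⟨-, h2, -⟩ := eq_conj_of_eigen h
  rw [topProj_eq_conj, sub_eq_iff_eq_add, ← Matrix.add_mul, ← Matrix.mul_add, diagonal_add]
  have : (fun i : Fin n => (if (i : ℕ) < q then (0 : ℝ) else 1) +
      if (i : ℕ) < q then (1 : ℝ) else 0) = fun _ => 1 := by ext i; split_ifs <;> simp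
  rw [this, diagonal_one, Matrix.mul_one, h2]

theorem isProj_topProj (h : IsEigendecomposition A lam u) (q : ℕ) : IsProj (topProj u q) := by
  rw [topProj_eq_conj]; exact isProj_conj (eq_conj_of_eigen h).1 q

theorem commute_topProj (h : IsEigendecomposition A lam u) (q : ℕ) : Commute (topProj u q) A := by
  obtain ⟨h1, -, h3⟩ := eq_conj_of_eigen h
  rw [Commute, SemiconjBy, topProj_eq_conj, h3, conj_mul_conj h1, conj_mul_conj h1]
  simp only [mul_comm]

theorem trace_topProj (h : IsEigendecomposition A lam u) (hqn : q ≤ n) :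
    (topProj u q).trace = q := by
  rw [topProj_eq_conj, trace_mul_comm, ← Matrix.mul_assoc, (eq_conj_of_eigen h).1, Matrix.one_mul,
    trace_diagonal, sum_ite_lt hqn]

theorem topProj_rayleigh_ge (h : IsEigendecomposition A lam u) (hq : 1 ≤ q) (hqn : q < n)
    (y : Fin n → ℝ) : lam ⟨q - 1, lt_of_le_of_lt (Nat.sub_le q 1) hqn⟩ *
      (y ⬝ᵥ (topProj u q *ᵥ y)) ≤ y ⬝ᵥ ((topProj u q * A) *ᵥ y) := by
  obtain ⟨h1, -, h3⟩ := eq_conj_of_eigen h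
  rw [topProj_eq_conj, h3, conj_mul_conj h1, dotProduct_conj_mulVec, dotProduct_conj_mulVec,
    Finset.mul_sum]
  refine Finset.sum_le_sum fun i _ => ?_
  split_ifs with hi
  · have : lam ⟨q - 1, lt_of_le_of_lt (Nat.sub_le q 1) hqn⟩ ≤ lam i :=
      h.antitone (Fin.le_def.2 (by simp; omega))
    rw [one_mul, one_mul]
    exact mul_le_mul_of_nonneg_right this (sq_nonneg _)
  · simp

theorem topProj_compl_rayleigh_le (h : IsEigendecomposition A lam u) (hqn : q < n)
    (y : Fin n → ℝ) : y ⬝ᵥ (((1 - topProj u q) * A) *ᵥ y) ≤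
      lam ⟨q, hqn⟩ * (y ⬝ᵥ ((1 - topProj u q) *ᵥ y)) := by
  obtain ⟨h1, -, h3⟩ := eq_conj_of_eigen h
  rw [one_sub_topProj h, h3, conj_mul_conj h1, dotProduct_conj_mulVec, dotProduct_conj_mulVec,
    Finset.mul_sum]
  refine Finset.sum_le_sum fun i _ => ?_
  split_ifs with hi
  · simp
  · have : lam i ≤ lam ⟨q, hqn⟩ := h.antitone (Fin.le_def.2 (by simpa using hi))
    rw [one_mul, one_mul]
    exact mul_le_mul_of_nonneg_right this (sq_nonneg _)

/-! ### Expected one-step improvement -/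

variable {𝒜 : Measure (Matrix (Fin n) (Fin n) ℝ)}

theorem HasMean.integral_mul_mul (hA : HasMean 𝒜 A) {k l : Type*} (P : Matrix k (Fin n) ℝ)
    (Q : Matrix (Fin n) l ℝ) (i : k) (j : l) :
    Integrable (fun M : Matrix (Fin n) (Fin n) ℝ => (P * M * Q) i j) 𝒜 ∧
      ∫ M, (P * M * Q) i j ∂𝒜 = (P * A * Q) i j := by
  simp only [Matrix.mul_apply, Finset.sum_mul]
  have hI : ∀ x y, Integrable (fun M : Matrix (Fin n) (Fin n) ℝ => P i y * M y x * Q x j) 𝒜 :=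
    fun x y => ((hA y x).1.const_mul _).mul_const _
  refine ⟨integrable_finsetSum _ fun x _ => integrable_finsetSum _ fun y _ => hI x y, ?_⟩
  rw [integral_finsetSum _ fun x _ => integrable_finsetSum _ fun y _ => hI x y]
  refine Finset.sum_congr rfl fun x _ => ?_
  rw [integral_finsetSum _ fun y _ => hI x y]
  refine Finset.sum_congr rfl fun y _ => ?_
  rw [integral_mul_const, integral_const_mul, (hA y x).2]

theorem gram_apply_self {V : Matrix (Fin n) (Fin n) ℝ} (Y : Matrix (Fin n) (Fin p) ℝ)
    (i : Fin p) : (Yᵀ * V * Y) i i = Y.col i ⬝ᵥ (V *ᵥ Y.col i) := by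
  rw [Matrix.mul_assoc]; rfl

theorem RankCondition.exists_vecMulVec (h : RankCondition 𝒜 p) (Y : Matrix (Fin n) (Fin p) ℝ) :
    ∀ᵐ M ∂𝒜, ∃ (x : Fin n → ℝ) (b : Fin p → ℝ), M * Y = vecMulVec x b := by
  rcases h with rfl | h
  · exact .of_forall fun M => exists_eq_vecMulVec_of_subsingleton _
  · filter_upwards [h] with M hM
    exact exists_eq_vecMulVec_of_rank_le_one ((rank_mul_le_left _ _).trans hM)

/-- Integrating the one-step bound gives `1 + 2η(linear) - η²(quadratic)`. The linear part is at
least `Δδ` with `δ = ∑ (1 - t i)`, and `hstep` is what bounds the quadratic part by `ηΔδ`, so one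
`ηΔδ` survives. -/
theorem expected_ratio_ge_of_normal [IsProbabilityMeasure 𝒜] {σa σr ε η : ℝ}
    (hA : HasMean 𝒜 A) (h : IsEigendecomposition A lam u) (hq : 1 ≤ q) (hqn : q < n)
    (hvar : VarianceCondition 𝒜 A σa σr) (hrank : RankCondition 𝒜 p) (hη : 0 < η)
    (ha : 0 < a) (hε : 0 < ε)
    (hstep : η * σa ^ 2 * (q + a * (n - q)) * (p + ε) ≤ eigengap lam q hqn * (a * ε))
    {Y : Matrix (Fin n) (Fin p) ℝ} {t : Fin p → ℝ}
    (h1 : Yᵀ * blend (topProj u q) a * Y = 1) (h2 : Yᵀ * topProj u q * Y = diagonal t)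
    (ht : ∀ i, 0 < t i ∧ t i ≤ 1) (hd : a * ε ≤ ∑ i, (1 - t i)) :
    ratio (topProj u q) a Y * (1 + η * eigengap lam q hqn * ∑ i, (1 - t i)) ≤
      ∫ M, ratio (topProj u q) a (Y + η • (M * Y)) ∂𝒜 := by
  set U := topProj u q with hUdef
  have hU : IsProj U := isProj_topProj h q
  set W := blend U a with hWdef
  have hW : W.PosSemidef := hU.blend_posSemidef ha.le
  have hWA : Commute W A :=
    (commute_topProj h q).add_left (((Commute.one_left A).sub_left (commute_topProj h q)).smul_left a)
  have hcol : ∀ (i : Fin p) (M : Matrix (Fin n) (Fin n) ℝ),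
      ((η • (M * Y))ᵀ * W * (η • (M * Y))) i i =
        η ^ 2 * (Y.col i ⬝ᵥ ((Mᵀ * W * M) *ᵥ Y.col i)) := by
    intro i M
    rw [← gram_apply_self]
    simp only [transpose_smul, Matrix.smul_mul, Matrix.mul_smul, Matrix.smul_apply, smul_eq_mul, transpose_mul,
      Matrix.mul_assoc]
    ring
  set f : Matrix (Fin n) (Fin n) ℝ → ℝ := fun M =>
    1 + 2 * ∑ i, (t i)⁻¹ * (Yᵀ * U * (η • (M * Y))) i i - 2 * (Yᵀ * W * (η • (M * Y))).trace -
      ((η • (M * Y))ᵀ * W * (η • (M * Y))).trace with hf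
  have hfe : f = fun M => 1 + 2 * ∑ i, (t i)⁻¹ * (η * (Yᵀ * U * M * Y) i i) -
      2 * ∑ i, η * (Yᵀ * W * M * Y) i i -
        ∑ i, η ^ 2 * (Y.col i ⬝ᵥ ((Mᵀ * W * M) *ᵥ Y.col i)) := by
    ext M
    simp only [hf, trace, diag, hcol]
    simp only [Matrix.mul_smul, Matrix.smul_apply, smul_eq_mul, Matrix.mul_assoc]
  have i1 : ∀ i, Integrable (fun M => (t i)⁻¹ * (η * (Yᵀ * U * M * Y) i i)) 𝒜 := fun i =>
    ((hA.integral_mul_mul _ _ i i).1.const_mul _).const_mul _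
  have i2 : ∀ i, Integrable (fun M => η * (Yᵀ * W * M * Y) i i) 𝒜 := fun i =>
    (hA.integral_mul_mul _ _ i i).1.const_mul _
  have i3 : ∀ i, Integrable (fun M => η ^ 2 * (Y.col i ⬝ᵥ ((Mᵀ * W * M) *ᵥ Y.col i))) 𝒜 :=
    fun i => (hvar.angular _ W hW hWA).1.const_mul _
  have I1 := (integrable_finsetSum Finset.univ fun i _ => i1 i).const_mul 2
  have I2 := (integrable_finsetSum Finset.univ fun i _ => i2 i).const_mul 2
  have I3 := integrable_finsetSum Finset.univ fun i _ => i3 i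
  have I12 : Integrable (fun M => 1 + 2 * ∑ i, (t i)⁻¹ * (η * (Yᵀ * U * M * Y) i i)) 𝒜 :=
    (integrable_const 1).add I1
  have I123 : Integrable (fun M => 1 + 2 * ∑ i, (t i)⁻¹ * (η * (Yᵀ * U * M * Y) i i) -
      2 * ∑ i, η * (Yᵀ * W * M * Y) i i) 𝒜 := I12.sub I2
  have hfi : Integrable f 𝒜 := by
    rw [hfe]; exact I123.sub I3
  have hfint : ∫ M, f M ∂𝒜 = 1 + 2 * ∑ i, (t i)⁻¹ * (η * (Yᵀ * U * A * Y) i i) -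
      2 * ∑ i, η * (Yᵀ * W * A * Y) i i -
        ∑ i, η ^ 2 * ∫ M, Y.col i ⬝ᵥ ((Mᵀ * W * M) *ᵥ Y.col i) ∂𝒜 := by
    rw [hfe]
    beta_reduce
    rw [integral_sub I123 I3, integral_sub I12 I2, integral_add (integrable_const _) I1,
      integral_const_mul, integral_const_mul, integral_finsetSum _ fun i _ => i1 i,
      integral_finsetSum _ fun i _ => i2 i, integral_finsetSum _ fun i _ => i3 i]
    simp only [integral_const_mul, (hA.integral_mul_mul _ _ _ _).2]
    simp
  have hmono : ∫ M, ratio U a Y * f M ∂𝒜 ≤ ∫ M, ratio U a (Y + η • (M * Y)) ∂𝒜 := by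
    refine integral_mono_ae (hfi.const_mul _) (integrable_ratio_comp hU ha
      ((measurable_step η).comp (measurable_const.prodMk measurable_id))) ?_
    filter_upwards [hrank.exists_vecMulVec Y] with M ⟨x, b, hM⟩
    exact ratio_add_vecMulVec_ge hU ha h1 h2 (fun i => (ht i).1) (η • x) b
      (by rw [hM, smul_vecMulVec])
  rw [integral_const_mul] at hmono
  refine le_trans (mul_le_mul_of_nonneg_left ?_ (ratio_nonneg hU ha Y)) hmono
  rw [hfint]
  set δ := ∑ i, (1 - t i) with hδ
  set Δ := eigengap lam q hqn with hΔ
  have hWd : W = U + a • (1 - U) := rfl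
  have eQ : ∀ i, a * (Y.col i ⬝ᵥ ((1 - U) *ᵥ Y.col i)) = 1 - t i := by
    intro i
    have e1 : (Yᵀ * W * Y) i i = 1 := by rw [h1, one_apply_eq]
    have e2 : (Yᵀ * U * Y) i i = t i := by rw [h2, diagonal_apply_eq]
    rw [gram_apply_self, hWd, add_mulVec, smul_mulVec, dotProduct_add, dotProduct_smul,
      smul_eq_mul, ← gram_apply_self, e2] at e1
    linarith
  have eM : ∀ i, Y.col i ⬝ᵥ (U *ᵥ Y.col i) = t i := fun i => by
    rw [← gram_apply_self, h2, diagonal_apply_eq]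
  -- Split `W = U + a(1 - U)`. The `U`-part contributes `((t i)⁻¹ - 1)` times a Rayleigh form that
  -- is at least `λ_q t i`; the complementary part is at most `λ_{q+1}(1 - t i)`. No sign of the
  -- eigenvalues is needed.
  have hlin : ∀ i, Δ * (1 - t i) ≤ (t i)⁻¹ * (Yᵀ * U * A * Y) i i - (Yᵀ * W * A * Y) i i := by
    intro i
    have e1 := topProj_rayleigh_ge h hq hqn (Y.col i)
    have e2 := topProj_compl_rayleigh_le h hqn (Y.col i)
    rw [← hUdef, eM i] at e1
    rw [← hUdef] at e2
    have e3 : (Yᵀ * W * A * Y) i i = Y.col i ⬝ᵥ ((U * A) *ᵥ Y.col i) +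
        a * (Y.col i ⬝ᵥ (((1 - U) * A) *ᵥ Y.col i)) := by
      rw [Matrix.mul_assoc _ W, gram_apply_self, hWd, Matrix.add_mul, Matrix.smul_mul, add_mulVec,
        smul_mulVec, dotProduct_add, dotProduct_smul, smul_eq_mul]
    rw [e3, Matrix.mul_assoc _ U, gram_apply_self]
    set X := Y.col i ⬝ᵥ ((U * A) *ᵥ Y.col i)
    have e4 := mul_le_mul_of_nonneg_left e2 ha.le
    rw [mul_left_comm, eQ i] at e4
    have e5 : 0 ≤ (t i)⁻¹ - 1 := sub_nonneg.2 (one_le_inv_iff₀.2 (ht i))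
    have e6 := mul_le_mul_of_nonneg_left e1 e5
    have e7 : ((t i)⁻¹ - 1) * (lam ⟨q - 1, lt_of_le_of_lt (Nat.sub_le q 1) hqn⟩ * t i) =
        lam ⟨q - 1, lt_of_le_of_lt (Nat.sub_le q 1) hqn⟩ * (1 - t i) := by
      have := (ht i).1; field_simp
    rw [e7] at e6
    rw [hΔ, eigengap]
    linarith
  have hlinsum : Δ * δ ≤ ∑ i, (t i)⁻¹ * (Yᵀ * U * A * Y) i i - ∑ i, (Yᵀ * W * A * Y) i i := by
    rw [hδ, Finset.mul_sum, ← Finset.sum_sub_distrib]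
    exact Finset.sum_le_sum fun i _ => hlin i
  have htr : W.trace = q + a * (n - q) := by
    rw [hWd, trace_add, trace_smul, trace_sub, trace_one, hUdef, trace_topProj h hqn.le]
    simp
  have hsq : ∀ i, a * sqNorm (Y.col i) = a * t i + (1 - t i) := by
    intro i
    have := eQ i
    rw [sub_mulVec, one_mulVec, dotProduct_sub, eM i, ← sqNorm_eq_dotProduct] at this
    linarith
  -- The norms sum to `a ∑ ‖y i‖² ≤ ap + δ`, and `aε ≤ δ` absorbs `aεp` into `δp`. This produces the
  -- factor `p + ε` in the step size.
  have hsqsum : a * ε * ∑ i, sqNorm (Y.col i) ≤ δ * (p + ε) := by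
    have e1 : a * ∑ i, sqNorm (Y.col i) = ∑ i, (a * t i + (1 - t i)) := by
      rw [Finset.mul_sum]; exact Finset.sum_congr rfl fun i _ => hsq i
    have e2 : ∑ i, (a * t i + (1 - t i)) ≤ a * p + δ := by
      rw [Finset.sum_add_distrib, ← Finset.mul_sum]
      have : ∑ i, t i ≤ (p : ℝ) := by
        simpa using Finset.sum_le_sum fun i (_ : i ∈ Finset.univ) => (ht i).2
      have := mul_le_mul_of_nonneg_left this ha.le
      linarith
    have hp0 : (0 : ℝ) ≤ p := Nat.cast_nonneg p
    nlinarith [mul_le_mul_of_nonneg_right hd hp0]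
  have hquad : ∑ i, η ^ 2 * ∫ M, Y.col i ⬝ᵥ ((Mᵀ * W * M) *ᵥ Y.col i) ∂𝒜 ≤ η * Δ * δ := by
    have e1 : ∑ i, η ^ 2 * ∫ M, Y.col i ⬝ᵥ ((Mᵀ * W * M) *ᵥ Y.col i) ∂𝒜 ≤
        η ^ 2 * (σa ^ 2 * (q + a * (n - q)) * ∑ i, sqNorm (Y.col i)) := by
      rw [← Finset.mul_sum]
      refine mul_le_mul_of_nonneg_left ?_ (sq_nonneg η)
      rw [Finset.mul_sum]
      refine Finset.sum_le_sum fun i _ => ?_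
      rw [← htr]; exact (hvar.angular _ W hW hWA).2
    have haε : 0 < a * ε := mul_pos ha hε
    have e2 : 0 ≤ σa ^ 2 * (q + a * (n - q)) := by
      have : (q : ℝ) ≤ n := by exact_mod_cast hqn.le
      have : 0 ≤ a * (n - q : ℝ) := mul_nonneg ha.le (by linarith)
      positivity
    have hδ0 : 0 ≤ δ := Finset.sum_nonneg fun i _ => sub_nonneg.2 (ht i).2
    refine e1.trans (le_of_mul_le_mul_left ?_ haε)
    calc a * ε * (η ^ 2 * (σa ^ 2 * (q + a * (n - q)) * ∑ i, sqNorm (Y.col i)))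
        = η ^ 2 * (σa ^ 2 * (q + a * (n - q))) * (a * ε * ∑ i, sqNorm (Y.col i)) := by ring
      _ ≤ η ^ 2 * (σa ^ 2 * (q + a * (n - q))) * (δ * (p + ε)) :=
        mul_le_mul_of_nonneg_left hsqsum (mul_nonneg (sq_nonneg η) e2)
      _ = η * δ * (η * σa ^ 2 * (q + a * (n - q)) * (p + ε)) := by ring
      _ ≤ η * δ * (Δ * (a * ε)) := mul_le_mul_of_nonneg_left hstep (mul_nonneg hη.le hδ0)
      _ = a * ε * (η * Δ * δ) := by ring
  have e8 : ∑ i, (t i)⁻¹ * (η * (Yᵀ * U * A * Y) i i) =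
      η * ∑ i, (t i)⁻¹ * (Yᵀ * U * A * Y) i i := by
    rw [Finset.mul_sum]; exact Finset.sum_congr rfl fun i _ => by ring
  rw [e8, ← Finset.mul_sum]
  nlinarith [mul_le_mul_of_nonneg_left hlinsum hη.le]

/-- Samples act on the left, so the update commutes with the right factor `C` that brings `Y` to
normal form. The drift is then stated in the potential itself through `1 - ∏ t i ≤ ∑ (1 - t i)`. -/
theorem expected_ratio_ge [IsProbabilityMeasure 𝒜] {σa σr ε η : ℝ}
    (hA : HasMean 𝒜 A) (h : IsEigendecomposition A lam u) (hq : 1 ≤ q) (hqn : q < n)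
    (hvar : VarianceCondition 𝒜 A σa σr) (hrank : RankCondition 𝒜 p) (hη : 0 < η)
    (ha : 0 < a) (hε : 0 < ε) (hΔ : 0 ≤ eigengap lam q hqn)
    (hstep : η * σa ^ 2 * (q + a * (n - q)) * (p + ε) ≤ eigengap lam q hqn * (a * ε))
    {Y : Matrix (Fin n) (Fin p) ℝ} (hY : ratio (topProj u q) a Y ≠ 0)
    (hd : a * ε ≤ defect (topProj u q) a Y) :
    ratio (topProj u q) a Y *
        (1 + η * eigengap lam q hqn * (1 - ratio (topProj u q) a Y)) ≤
      ∫ M, ratio (topProj u q) a (Y + η • (M * Y)) ∂𝒜 := by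
  have hU : IsProj (topProj u q) := isProj_topProj h q
  have hN : (Yᵀ * blend (topProj u q) a * Y).det ≠ 0 := fun h0 => hY (by
    rw [ratio, h0, div_zero])
  obtain ⟨C, t, hC, h1, h2, ht⟩ := exists_normal_form hU ha hN
  have hprod := ratio_mul_right (U := topProj u q) (a := a) Y hC
  rw [ratio_eq_prod h1 h2] at hprod
  have ht' : ∀ i, 0 < t i ∧ t i ≤ 1 := fun i => ⟨lt_of_le_of_ne (ht i).1 fun h0 => hY (by
    rw [← hprod]; exact Finset.prod_eq_zero (Finset.mem_univ i) h0.symm), (ht i).2⟩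
  rw [← defect_mul_right Y hC, defect_eq_sum h1 h2] at hd
  have key := expected_ratio_ge_of_normal hA h hq hqn hvar hrank hη ha hε hstep h1 h2 ht' hd
  have hstepC : ∀ M : Matrix (Fin n) (Fin n) ℝ,
      ratio (topProj u q) a (Y * C + η • (M * (Y * C))) =
        ratio (topProj u q) a (Y + η • (M * Y)) := by
    intro M
    rw [← ratio_mul_right (Y + η • (M * Y)) hC, Matrix.add_mul, Matrix.smul_mul, Matrix.mul_assoc]
  simp only [hstepC, ratio_mul_right Y hC] at key
  refine le_trans (mul_le_mul_of_nonneg_left ?_ (ratio_nonneg hU ha Y)) key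
  have h5 : 1 - ratio (topProj u q) a Y ≤ ∑ i, (1 - t i) := by
    rw [← hprod]; exact one_sub_prod_le_sum _ ht
  nlinarith [mul_le_mul_of_nonneg_left h5 (mul_nonneg hη.le hΔ)]

end

section

/-! ### Independence of the past and the fresh samples -/

variable {Ω : Type*} [MeasurableSpace Ω] {μ : Measure Ω} {n p : ℕ}

/-- The triple law factors as `X ⊗ (Z ⊗ V)`; reassociating the product gives `(X ⊗ Z) ⊗ V`. -/
theorem IndepFun.prodMk_left {α β γ : Type*} [MeasurableSpace α] [MeasurableSpace β]
    [MeasurableSpace γ] [IsProbabilityMeasure μ] {X : Ω → α} {Z : Ω → β} {V : Ω → γ}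
    (hX : Measurable X) (hZ : Measurable Z) (hV : Measurable V)
    (h1 : IndepFun X (fun ω => (Z ω, V ω)) μ) (h2 : IndepFun Z V μ) :
    IndepFun (fun ω => (X ω, Z ω)) V μ := by
  have h3 : IndepFun X Z μ := h1.comp measurable_id measurable_fst
  have := Measure.isProbabilityMeasure_map (μ := μ) hX.aemeasurable
  have := Measure.isProbabilityMeasure_map (μ := μ) hZ.aemeasurable
  have := Measure.isProbabilityMeasure_map (μ := μ) hV.aemeasurable
  have e1 := (indepFun_iff_map_prod_eq_prod_map_map hX.aemeasurable
    (hZ.prodMk hV).aemeasurable).1 h1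
  have e2 := (indepFun_iff_map_prod_eq_prod_map_map hZ.aemeasurable hV.aemeasurable).1 h2
  have e3 := (indepFun_iff_map_prod_eq_prod_map_map hX.aemeasurable hZ.aemeasurable).1 h3
  rw [indepFun_iff_map_prod_eq_prod_map_map (hX.prodMk hZ).aemeasurable hV.aemeasurable, e3]
  have e4 := congrArg (Measure.map MeasurableEquiv.prodAssoc.symm) e1
  rw [Measure.map_map MeasurableEquiv.prodAssoc.symm.measurable (hX.prodMk (hZ.prodMk hV)),
    e2] at e4
  rw [show (fun ω => ((X ω, Z ω), V ω)) =
    MeasurableEquiv.prodAssoc.symm ∘ fun ω => (X ω, (Z ω, V ω)) from rfl, e4]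
  exact (measurePreserving_prodAssoc _ _ _).symm.map_eq

variable {𝒜 : Measure (Matrix (Fin n) (Fin n) ℝ)} {Y₀ : Ω → Matrix (Fin n) (Fin p) ℝ}
  {S : ℕ → Ω → Matrix (Fin n) (Fin n) ℝ} {η : ℝ}

theorem measurable_iter (hY : Measurable Y₀) (hS : ∀ k, Measurable (S k)) (k : ℕ) :
    Measurable (iter η Y₀ S k) := by
  induction k with
  | zero => exact hY
  | succ k ih => exact (measurable_step η).comp (ih.prodMk (hS k))

theorem iter_congr {Ω Ω' : Type*} {Y₀ : Ω → Matrix (Fin n) (Fin p) ℝ}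
    {S : ℕ → Ω → Matrix (Fin n) (Fin n) ℝ} {Y₀' : Ω' → Matrix (Fin n) (Fin p) ℝ}
    {S' : ℕ → Ω' → Matrix (Fin n) (Fin n) ℝ} {ω : Ω} {ω' : Ω'} (h0 : Y₀ ω = Y₀' ω') {k : ℕ}
    (hS : ∀ j < k, S j ω = S' j ω') : iter η Y₀ S k ω = iter η Y₀' S' k ω' := by
  induction k with
  | zero => exact h0
  | succ k ih =>
    rw [iter, iter, ih fun j hj => hS j (hj.trans k.lt_succ_self), hS k k.lt_succ_self]

/-- The randomness revealed before the `k`-th sample is drawn. -/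
def history (Y₀ : Ω → Matrix (Fin n) (Fin p) ℝ) (S : ℕ → Ω → Matrix (Fin n) (Fin n) ℝ) (k : ℕ)
    (ω : Ω) : Matrix (Fin n) (Fin p) ℝ × (Finset.range k → Matrix (Fin n) (Fin n) ℝ) :=
  (Y₀ ω, fun i => S i ω)

/-- The iterates as functions of the history. -/
def replay (η : ℝ) (k j : ℕ) :
    Matrix (Fin n) (Fin p) ℝ × (Finset.range k → Matrix (Fin n) (Fin n) ℝ) →
      Matrix (Fin n) (Fin p) ℝ :=
  -- Samples with index outside the history are set to `0`. The default is harmless because the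
  -- first `j ≤ k` steps only read samples with index below `k`.
  iter η Prod.fst (fun i x => if h : i ∈ Finset.range k then x.2 ⟨i, h⟩ else 0) j

theorem measurable_replay (k j : ℕ) : Measurable (replay (n := n) (p := p) η k j) := by
  refine measurable_iter measurable_fst (fun i => ?_) j
  by_cases h : i ∈ Finset.range k
  · simp only [h, dif_pos]
    exact (measurable_pi_apply (⟨i, h⟩ : Finset.range k)).comp measurable_snd
  · simp only [h, dif_neg, not_false_eq_true]
    exact measurable_const

theorem replay_history {Ω : Type*} {Y₀ : Ω → Matrix (Fin n) (Fin p) ℝ}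
    {S : ℕ → Ω → Matrix (Fin n) (Fin n) ℝ} {k j : ℕ} (hj : j ≤ k) (ω : Ω) :
    replay η k j (history Y₀ S k ω) = iter η Y₀ S j ω := by
  unfold replay
  refine iter_congr ?_ fun i hi => ?_
  · rfl
  rw [dif_pos (Finset.mem_range.2 (hi.trans_le hj))]; rfl

theorem IsRun.measurable_history (hrun : IsRun μ 𝒜 Y₀ S) (k : ℕ) :
    Measurable (history Y₀ S k) :=
  hrun.measurable_init.prodMk (measurable_pi_iff.2 fun i => hrun.measurable_sample i)

theorem IsRun.indepFun_history [IsProbabilityMeasure μ] (hrun : IsRun μ 𝒜 Y₀ S) (k : ℕ)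
    (T : Finset ℕ) (hT : Disjoint (Finset.range k) T) :
    IndepFun (history Y₀ S k) (fun ω (i : T) => S i ω) μ := by
  have h1 : IndepFun Y₀ (fun ω => ((fun i : Finset.range k => S i ω), fun i : T => S i ω)) μ :=
    hrun.indep_init.comp measurable_id
      (ψ := fun s : ℕ → Matrix (Fin n) (Fin n) ℝ =>
        ((fun i : Finset.range k => s i), fun i : T => s i))
      ((measurable_pi_iff.2 fun i => measurable_pi_apply _).prodMk
        (measurable_pi_iff.2 fun i => measurable_pi_apply _))
  exact IndepFun.prodMk_left hrun.measurable_init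
    (measurable_pi_iff.2 fun i => hrun.measurable_sample i)
    (measurable_pi_iff.2 fun i => hrun.measurable_sample i) h1
    (hrun.indep_samples.indepFun_finset _ _ hT hrun.measurable_sample)

theorem IsRun.map_history_sample [IsProbabilityMeasure μ] (hrun : IsRun μ 𝒜 Y₀ S) (k : ℕ) :
    μ.map (fun ω => (history Y₀ S k ω, S k ω)) = (μ.map (history Y₀ S k)).prod 𝒜 := by
  have h1 : IndepFun (history Y₀ S k) (S k) μ :=
    (hrun.indepFun_history k {k} (by simp)).comp measurable_id
      (measurable_pi_apply (⟨k, Finset.mem_singleton_self k⟩ : ({k} : Finset ℕ)))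
  rw [(indepFun_iff_map_prod_eq_prod_map_map (hrun.measurable_history k).aemeasurable
    (hrun.measurable_sample k).aemeasurable).1 h1, hrun.law_sample k]

/-- Integration over a fresh sample, on an event that depends only on the past. -/
theorem IsRun.setIntegral_iter_succ [IsProbabilityMeasure μ] [IsProbabilityMeasure 𝒜]
    (hrun : IsRun μ 𝒜 Y₀ S) (k : ℕ) {x : Matrix (Fin n) (Fin p) ℝ → ℝ} (hx : Measurable x)
    (hx01 : ∀ Y, 0 ≤ x Y ∧ x Y ≤ 1)
    {B : Set (Matrix (Fin n) (Fin p) ℝ × (Finset.range k → Matrix (Fin n) (Fin n) ℝ))}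
    (hB : MeasurableSet B) :
    ∫ ω in history Y₀ S k ⁻¹' B, x (iter η Y₀ S (k + 1) ω) ∂μ =
      ∫ ω in history Y₀ S k ⁻¹' B,
        (∫ M, x (iter η Y₀ S k ω + η • (M * iter η Y₀ S k ω)) ∂𝒜) ∂μ := by
  have hH := hrun.measurable_history k
  have := Measure.isProbabilityMeasure_map (μ := μ) hH.aemeasurable
  -- The event enters as an indicator factor, so both sides become integrals of one bounded function
  -- under the product law of history and fresh sample, and Fubini applies.
  set F : (Matrix (Fin n) (Fin p) ℝ × (Finset.range k → Matrix (Fin n) (Fin n) ℝ)) ×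
      Matrix (Fin n) (Fin n) ℝ → ℝ := fun z =>
    B.indicator (fun _ => (1 : ℝ)) z.1 * x (replay η k k z.1 + η • (z.2 * replay η k k z.1)) with hF
  have hm : Measurable F := ((measurable_const.indicator hB).comp measurable_fst).mul
    (hx.comp ((measurable_step η).comp
      (((measurable_replay k k).comp measurable_fst).prodMk measurable_snd)))
  have hb : ∀ z, ‖F z‖ ≤ 1 := fun z => by
    rw [hF, Real.norm_eq_abs, abs_mul, abs_of_nonneg (hx01 _).1]
    refine mul_le_one₀ ?_ (hx01 _).1 (hx01 _).2
    by_cases hz : z.1 ∈ B <;> simp [hz]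
  have hint : Integrable F ((μ.map (history Y₀ S k)).prod 𝒜) :=
    Integrable.of_bound hm.aestronglyMeasurable 1 (.of_forall hb)
  have e1 : ∫ ω, F (history Y₀ S k ω, S k ω) ∂μ =
      ∫ ω, ∫ M, F (history Y₀ S k ω, M) ∂𝒜 ∂μ := by
    rw [← integral_map (hH.prodMk (hrun.measurable_sample k)).aemeasurable
      hm.aestronglyMeasurable, hrun.map_history_sample k, integral_prod _ hint,
      integral_map hH.aemeasurable]
    exact (hm.stronglyMeasurable.integral_prod_right').aestronglyMeasurable
  rw [← integral_indicator (hH hB), ← integral_indicator (hH hB)]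
  have e2 : ∀ ω, F (history Y₀ S k ω, S k ω) =
      (history Y₀ S k ⁻¹' B).indicator (fun ω => x (iter η Y₀ S (k + 1) ω)) ω := by
    intro ω
    simp only [hF, replay_history le_rfl]
    by_cases hω : history Y₀ S k ω ∈ B
    · rw [Set.indicator_of_mem hω, Set.indicator_of_mem (Set.mem_preimage.2 hω), one_mul]; rfl
    · rw [Set.indicator_of_notMem hω, Set.indicator_of_notMem (by simpa using hω), zero_mul]
  have e3 : ∀ ω, ∫ M, F (history Y₀ S k ω, M) ∂𝒜 =
      (history Y₀ S k ⁻¹' B).indicator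
        (fun ω => ∫ M, x (iter η Y₀ S k ω + η • (M * iter η Y₀ S k ω)) ∂𝒜) ω := by
    intro ω
    simp only [hF, replay_history le_rfl]
    by_cases hω : history Y₀ S k ω ∈ B
    · rw [Set.indicator_of_mem (Set.mem_preimage.2 hω)]
      simp only [Set.indicator_of_mem hω, one_mul]
    · rw [Set.indicator_of_notMem (show ω ∉ history Y₀ S k ⁻¹' B by simpa using hω)]
      simp only [Set.indicator_of_notMem hω, zero_mul, integral_zero]
  simp only [e2, e3] at e1
  exact e1

/-! ### The hitting-time bound -/

/-- With `L = log(1/c)`, the claim is trivial for `ht ≤ L`, since its right side is then at least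
`1`. Beyond that point, `(1 - h)^(t - 1) ≤ exp(h - ht)` decays faster than `L/(ht)`. -/
theorem tail_bound {c h P m : ℝ} {t : ℕ} (ht : 1 ≤ t) (hc : 0 < c) (hc2 : c < 1 / 2) (hh : 0 < h)
    (hh4 : h ≤ 1 / 4) (hm : 0 ≤ m) (hP1 : P ≤ 1)
    (hP : P ≤ m + (1 - h) ^ (t - 1) / (2 * c)) : P ≤ m + Real.log (1 / c) / (h * t) := by
  have ht0 : (1 : ℝ) ≤ t := by exact_mod_cast ht
  have hht : 0 < h * t := by positivity
  set L := Real.log (1 / c) with hL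
  have hLexp : Real.exp L = 1 / c := Real.exp_log (by positivity)
  -- The final comparison needs `exp(h)/2 < L`. It holds because `c < 1/2` gives `L ≥ log 2 > 0.69`,
  -- while `h ≤ 1/4` gives `exp(h)/2 ≤ 0.6425`. The factor `exp(h)` is the price of the exponent `t
  -- - 1`.
  have hL2 : 0.69 ≤ L := by
    have h1 : Real.log 2 ≤ L := Real.log_le_log (by norm_num) (by
      rw [le_div_iff₀ hc]; linarith)
    have := Real.log_two_gt_d9
    linarith
  rcases le_or_gt (h * t) L with hle | hlt
  · have : 1 ≤ L / (h * t) := (one_le_div hht).2 hle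
    linarith
  · refine hP.trans (add_le_add_right ?_ m)
    have e1 : (1 - h) ^ (t - 1) ≤ Real.exp (h - h * t) := by
      have : 1 - h ≤ Real.exp (-h) := by have := Real.add_one_le_exp (-h); linarith
      calc (1 - h) ^ (t - 1) ≤ Real.exp (-h) ^ (t - 1) := pow_le_pow_left₀ (by linarith) this _
        _ = Real.exp (h - h * t) := by
          rw [← Real.exp_nat_mul, Nat.cast_sub ht]; congr 1; push_cast; ring
    have e2 : Real.exp h ≤ 1.285 := by
      have h4 : Real.exp (1 / 4) ^ 4 = Real.exp 1 := by rw [← Real.exp_nat_mul]; norm_num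
      have h5 := Real.exp_one_lt_d9
      refine (Real.exp_le_exp.2 hh4).trans ?_
      by_contra! hcon
      have := pow_lt_pow_left₀ hcon (by norm_num) (n := 4) (by norm_num)
      rw [h4] at this
      norm_num at this
      linarith
    have e3 : Real.exp (h - h * t) / (2 * c) =
        Real.exp h / 2 / Real.exp (h * t - L) := by
      rw [Real.exp_sub, Real.exp_sub, hLexp]; field_simp
    have e4 : 1 + (h * t - L) ≤ Real.exp (h * t - L) := by
      have := Real.add_one_le_exp (h * t - L); linarith
    calc (1 - h) ^ (t - 1) / (2 * c) ≤ Real.exp (h - h * t) / (2 * c) := by gcongr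
      _ = Real.exp h / 2 / Real.exp (h * t - L) := e3
      _ ≤ L / (h * t) := by
        rw [div_le_div_iff₀ (Real.exp_pos _) hht]
        have h6 : L * (1 + (h * t - L)) ≤ L * Real.exp (h * t - L) :=
          mul_le_mul_of_nonneg_left e4 (by linarith)
        have h7 : Real.exp h / 2 * (h * t) ≤ 0.6425 * (h * t) :=
          mul_le_mul_of_nonneg_right (by linarith) hht.le
        nlinarith

/-- A nonnegative potential that contracts in expectation while it lies in `[c, 1/2)`. -/
theorem IsRun.hitting_bound [IsProbabilityMeasure μ] [IsProbabilityMeasure 𝒜]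
    (hrun : IsRun μ 𝒜 Y₀ S) {x : Matrix (Fin n) (Fin p) ℝ → ℝ} (hx : Measurable x)
    (hx01 : ∀ Y, 0 ≤ x Y ∧ x Y ≤ 1) {G : Set (Matrix (Fin n) (Fin p) ℝ)} (hG : MeasurableSet G)
    {c h : ℝ} (hc : 0 < c) (hc1 : c ≤ 1) (hh : 0 < h) (hh4 : h ≤ 1 / 4)
    (hGx : ∀ Y ∈ G, c ≤ x Y ∧ x Y < 1 / 2)
    (hdrift : ∀ Y ∈ G, ∫ M, x (Y + η • (M * Y)) ∂𝒜 ≤ (1 - h) * x Y) {t : ℕ} (ht : 1 ≤ t) :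
    μ.real {ω | ∀ k < t, iter η Y₀ S k ω ∈ G ∨ 1 / 2 ≤ x (iter η Y₀ S k ω)} ≤
      2 * ∫ ω, x (Y₀ ω) ∂μ + Real.log (1 / c) / (h * t) := by
  have hYm : ∀ k, Measurable (iter η Y₀ S k) := fun k =>
    measurable_iter hrun.measurable_init hrun.measurable_sample k
  set X : ℕ → Ω → ℝ := fun k ω => x (iter η Y₀ S k ω) with hX
  have hXm : ∀ k, Measurable (X k) := fun k => hx.comp (hYm k)
  have hXi : ∀ k (ν : Measure Ω) [IsFiniteMeasure ν], Integrable (X k) ν := fun k ν _ =>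
    Integrable.of_bound (hXm k).aestronglyMeasurable 1 (.of_forall fun ω => by
      rw [Real.norm_of_nonneg (hx01 _).1]; exact (hx01 _).2)
  set E : ℕ → Set Ω := fun k => {ω | ∀ j ≤ k, iter η Y₀ S j ω ∈ G} with hE
  have hEm : ∀ k, MeasurableSet (E k) := fun k => by
    have : E k = ⋂ j ∈ Finset.range (k + 1), iter η Y₀ S j ⁻¹' G := by
      ext ω; simp [hE]
    rw [this]
    exact Finset.measurableSet_biInter _ fun j _ => hYm j hG
  have hEsucc : ∀ k, E (k + 1) = E k ∩ iter η Y₀ S (k + 1) ⁻¹' G := fun k => by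
    ext ω
    simp only [hE, Set.mem_inter_iff, Set.mem_ofPred_eq, Set.mem_preimage]
    constructor
    · exact fun hω => ⟨fun j hj => hω j (hj.trans k.le_succ), hω _ le_rfl⟩
    · rintro ⟨h1, h2⟩ j hj
      rcases Nat.le_succ_iff.1 hj with hj | rfl
      exacts [h1 j hj, h2]
  -- The event `E k` is determined by the history, so the drift can be integrated over the fresh
  -- sample on it.
  have hstep : ∀ k, ∫ ω in E k, X (k + 1) ω ∂μ ≤ (1 - h) * ∫ ω in E k, X k ω ∂μ := by
    intro k
    set B : Set (Matrix (Fin n) (Fin p) ℝ × (Finset.range k → Matrix (Fin n) (Fin n) ℝ)) :=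
      ⋂ j ∈ Finset.range (k + 1), replay η k j ⁻¹' G with hB
    have hBm : MeasurableSet B :=
      Finset.measurableSet_biInter _ fun j _ => measurable_replay k j hG
    have hEB : E k = history Y₀ S k ⁻¹' B := by
      ext ω
      simp only [hE, hB, Set.mem_ofPred_eq, Set.mem_preimage, Set.mem_iInter, Finset.mem_range,
        Nat.lt_succ_iff]
      exact forall_congr' fun j => forall_congr' fun hj => by rw [replay_history hj]
    have key := hrun.setIntegral_iter_succ (η := η) k hx hx01 hBm
    rw [← hEB] at key
    rw [← integral_const_mul]
    refine (le_of_eq key).trans (setIntegral_mono_on ?_ ((hXi k _).const_mul _) (hEm k)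
      fun ω hω => hdrift _ (hω k le_rfl))
    refine Integrable.of_bound (C := 1) (Measurable.aestronglyMeasurable ?_) (.of_forall fun ω => ?_)
    · have h1 : Measurable fun z : Matrix (Fin n) (Fin p) ℝ × Matrix (Fin n) (Fin n) ℝ =>
          x (z.1 + η • (z.2 * z.1)) := hx.comp (measurable_step η)
      exact (h1.stronglyMeasurable.integral_prod_right' (ν := 𝒜)).measurable.comp (hYm k)
    · rw [Real.norm_of_nonneg (integral_nonneg fun M => (hx01 _).1)]
      calc _ ≤ ∫ _M : Matrix (Fin n) (Fin n) ℝ, (1 : ℝ) ∂𝒜 :=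
            integral_mono_of_nonneg (.of_forall fun M => (hx01 _).1) (integrable_const _)
              (.of_forall fun M => (hx01 _).2)
        _ = 1 := by simp
  have hnn : ∀ k, 0 ≤ ∫ ω in E k, X k ω ∂μ := fun k => integral_nonneg fun ω => (hx01 _).1
  have hsub : ∀ k, ∫ ω in E (k + 1), X (k + 1) ω ∂μ ≤ ∫ ω in E k, X (k + 1) ω ∂μ := fun k =>
    setIntegral_mono_set (hXi _ _) (.of_forall fun ω => (hx01 _).1)
      (by rw [hEsucc]; exact (Set.inter_subset_left).eventuallyLE)
  -- The constant `1/2` is the upper bound for the potential on `G` at time zero.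
  have hgeom : ∀ k, ∫ ω in E k, X k ω ∂μ ≤ (1 - h) ^ k / 2 := by
    intro k
    induction k with
    | zero =>
      calc ∫ ω in E 0, X 0 ω ∂μ ≤ ∫ _ω in E 0, (1 / 2 : ℝ) ∂μ :=
            setIntegral_mono_on (hXi _ _) (integrable_const _) (hEm 0)
              fun ω hω => (hGx _ (hω 0 le_rfl)).2.le
        _ = μ.real (E 0) * (1 / 2) := by simp
        _ ≤ 1 * (1 / 2) := by gcongr; exact measureReal_le_one
        _ = _ := by norm_num
    | succ k ih =>
      refine (hsub k).trans ((hstep k).trans ?_)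
      rw [pow_succ]
      nlinarith
  have hlow : ∀ k, c * μ.real (E k) ≤ ∫ ω in E k, X k ω ∂μ := fun k =>
    calc c * μ.real (E k) = ∫ _ω in E k, c ∂μ := by simp [mul_comm]
      _ ≤ _ := setIntegral_mono_on (integrable_const _) (hXi _ _) (hEm k)
        fun ω hω => (hGx _ (hω k le_rfl)).1
  -- This is optional stopping by induction: `T` collects the paths that go from `G` to `x ≥ 1/2` by
  -- time `k`, including those starting there. Each carries potential at least `1/2` when it enters
  -- `T`, and the mass remaining in `E k` does not grow in expectation.
  have hdip : ∀ k, ∃ T : Set Ω,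
      {ω | ∀ j ≤ k, iter η Y₀ S j ω ∈ G ∨ 1 / 2 ≤ x (iter η Y₀ S j ω)} ⊆ E k ∪ T ∧
      μ.real T / 2 + ∫ ω in E k, X k ω ∂μ ≤ ∫ ω, X 0 ω ∂μ := by
    have hsplit : ∀ (k : ℕ) (F : Set Ω), MeasurableSet F →
        μ.real (F ∩ {ω | 1 / 2 ≤ X k ω}) / 2 + ∫ ω in F ∩ iter η Y₀ S k ⁻¹' G, X k ω ∂μ ≤
          ∫ ω in F, X k ω ∂μ := by
      intro k F hF
      have hm1 : MeasurableSet (F ∩ {ω | 1 / 2 ≤ X k ω}) :=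
        hF.inter (measurableSet_le measurable_const (hXm k))
      have hm2 : MeasurableSet (F ∩ iter η Y₀ S k ⁻¹' G) := hF.inter (hYm k hG)
      have hdisj : Disjoint (F ∩ {ω | 1 / 2 ≤ X k ω}) (F ∩ iter η Y₀ S k ⁻¹' G) :=
        Set.disjoint_left.2 fun ω h1 h2 => absurd h1.2 (not_le.2 (hGx _ h2.2).2)
      have e1 : μ.real (F ∩ {ω | 1 / 2 ≤ X k ω}) / 2 ≤
          ∫ ω in F ∩ {ω | 1 / 2 ≤ X k ω}, X k ω ∂μ :=
        calc _ = ∫ _ω in F ∩ {ω | 1 / 2 ≤ X k ω}, (1 / 2 : ℝ) ∂μ := by simp; ring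
          _ ≤ _ := setIntegral_mono_on (integrable_const _) (hXi _ _) hm1 fun ω hω => hω.2
      have e2 := setIntegral_union (μ := μ) (f := X k) hdisj hm2 (hXi k _) (hXi k _)
      have e3 : ∫ ω in (F ∩ {ω | 1 / 2 ≤ X k ω}) ∪ (F ∩ iter η Y₀ S k ⁻¹' G), X k ω ∂μ ≤
          ∫ ω in F, X k ω ∂μ :=
        setIntegral_mono_set (hXi _ _) (.of_forall fun ω => (hx01 _).1)
          (Set.union_subset Set.inter_subset_left Set.inter_subset_left).eventuallyLE
      linarith
    intro k
    induction k with
    | zero =>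
      refine ⟨{ω | 1 / 2 ≤ X 0 ω}, fun ω hω => ?_, ?_⟩
      · rcases hω 0 le_rfl with h1 | h1
        · left; intro j hj; rw [Nat.le_zero.1 hj]; exact h1
        · right; exact h1
      · have := hsplit 0 Set.univ MeasurableSet.univ
        have hE0 : E 0 = Set.univ ∩ iter η Y₀ S 0 ⁻¹' G := by
          ext ω; simp [hE]
        rw [← hE0, Set.univ_inter, setIntegral_univ] at this
        exact this
    | succ k ih =>
      obtain ⟨T, hT1, hT2⟩ := ih
      refine ⟨T ∪ (E k ∩ {ω | 1 / 2 ≤ X (k + 1) ω}), fun ω hω => ?_, ?_⟩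
      · rcases hT1 (fun j hj => hω j (hj.trans k.le_succ)) with h1 | h1
        · rcases hω (k + 1) le_rfl with h2 | h2
          · left; rw [hEsucc]; exact ⟨h1, h2⟩
          · right; right; exact ⟨h1, h2⟩
        · right; left; exact h1
      · have e1 := hsplit (k + 1) (E k) (hEm k)
        rw [← hEsucc] at e1
        have e2 := measureReal_union_le (μ := μ) T (E k ∩ {ω | 1 / 2 ≤ X (k + 1) ω})
        have e3 := hstep k
        nlinarith [hnn k]
  obtain ⟨T, hT1, hT2⟩ := hdip (t - 1)
  have hFset : {ω | ∀ k < t, iter η Y₀ S k ω ∈ G ∨ 1 / 2 ≤ x (iter η Y₀ S k ω)} ⊆ E (t - 1) ∪ T :=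
    fun ω hω => hT1 fun j hj => hω j (by omega)
  set P := μ.real {ω | ∀ k < t, iter η Y₀ S k ω ∈ G ∨ 1 / 2 ≤ x (iter η Y₀ S k ω)} with hPdef
  have hP : P ≤ μ.real (E (t - 1)) + μ.real T :=
    (measureReal_mono hFset).trans (measureReal_union_le _ _)
  have hX0 : ∫ ω, X 0 ω ∂μ = ∫ ω, x (Y₀ ω) ∂μ := rfl
  have hm0 : 0 ≤ ∫ ω, x (Y₀ ω) ∂μ := integral_nonneg fun ω => (hx01 _).1
  rw [hX0] at hT2
  have hnn' := hnn (t - 1)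
  -- For `c ≥ 1/2` the set `G` is empty, so only the paths in `T` remain.
  rcases lt_or_ge c (1 / 2) with hc2 | hc2
  · refine tail_bound ht hc hc2 hh hh4 (by linarith) measureReal_le_one ?_
    have e1 : μ.real (E (t - 1)) ≤ (1 - h) ^ (t - 1) / (2 * c) := by
      rw [le_div_iff₀ (by linarith)]
      nlinarith [hlow (t - 1), hgeom (t - 1)]
    linarith
  · have hE0 : E (t - 1) = ∅ := by
      ext ω
      simp only [Set.mem_empty_iff_false, iff_false]
      intro hω
      have := hGx _ (hω _ le_rfl)
      linarith
    rw [hE0, measureReal_empty] at hP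
    have hL : 0 ≤ Real.log (1 / c) / (h * t) :=
      div_nonneg (Real.log_nonneg ((one_le_div hc).2 hc1)) (by positivity)
    linarith

end

section

/-! ### The radial phase -/

variable {n p : ℕ}

theorem cfc_sqrt_mul_self {N : Matrix (Fin p) (Fin p) ℝ} (hN : N.PosSemidef) :
    cfc Real.sqrt N * cfc Real.sqrt N = N := by
  have hc : ContinuousOn Real.sqrt (spectrum ℝ N) := Real.continuous_sqrt.continuousOn
  rw [← cfc_mul Real.sqrt Real.sqrt N hc hc]
  have hspec := (posSemidef_iff_isHermitian_and_spectrum_nonneg.1 hN).2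
  have h1 : (spectrum ℝ N).EqOn (fun x => Real.sqrt x * Real.sqrt x) id := fun x hx =>
    Real.mul_self_sqrt (hspec hx)
  rw [cfc_congr h1]
  exact cfc_id ℝ N hN.1

theorem transpose_cfc_sqrt (N : Matrix (Fin p) (Fin p) ℝ) :
    (cfc Real.sqrt N)ᵀ = cfc Real.sqrt N := by
  have h : IsSelfAdjoint (cfc Real.sqrt N) := cfc_predicate _ _
  rw [IsSelfAdjoint, star_eq_conjTranspose, conjTranspose_eq_transpose_of_trivial] at h
  exact h

/-- In the singular case the matrix inverse is `0`, so the square root `C` is symmetric with `C * C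
= 0`, hence zero. -/
theorem orthonormalize_spec (Y : Matrix (Fin n) (Fin p) ℝ) :
    orthonormalize Y = 0 ∨ (orthonormalize Y)ᵀ * orthonormalize Y = 1 := by
  have hG := posSemidef_transpose_mul_self Y
  have hsq := cfc_sqrt_mul_self hG.inv
  have ht := transpose_cfc_sqrt (Yᵀ * Y)⁻¹
  rw [orthonormalize]
  set C := cfc Real.sqrt (Yᵀ * Y)⁻¹
  by_cases hdet : IsUnit (Yᵀ * Y).det
  · right
    have h1 : C * (C * (Yᵀ * Y)) = 1 := by
      rw [← Matrix.mul_assoc, hsq, nonsing_inv_mul _ hdet]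
    calc (Y * C)ᵀ * (Y * C) = (C * (Yᵀ * Y)) * C := by
          rw [transpose_mul, ht]; simp only [Matrix.mul_assoc]
      _ = 1 := mul_eq_one_comm.1 h1
  · left
    rw [nonsing_inv_apply_not_isUnit _ hdet] at hsq
    have h1 : Cᴴ * C = 0 := by rw [conjTranspose_eq_transpose_of_trivial, ht, hsq]
    rw [conjTranspose_mul_self_eq_zero.1 h1, Matrix.mul_zero]

/-- The squared Frobenius norm of `Ŷᵀ E Ŷ`, as a rational function of `Y` and `E`. -/
def radialError (Y : Matrix (Fin n) (Fin p) ℝ) (E : Matrix (Fin n) (Fin n) ℝ) : ℝ :=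
  (((Yᵀ * Y)⁻¹ * (Yᵀ * E * Y)) * ((Yᵀ * Y)⁻¹ * (Yᵀ * Eᵀ * Y))).trace

theorem frobSq_eq_trace {m k : ℕ} (M : Matrix (Fin m) (Fin k) ℝ) : frobSq M = (M * Mᵀ).trace := by
  simp [frobSq, trace, Matrix.mul_apply, sq]

/-- After cyclic permutation under the trace, the square root occurs only as `C * C = (YᵀY)⁻¹`. The
error thus becomes visibly measurable in `Y` and `E`, with no need for measurability of the
functional calculus. -/
theorem frobSq_orthonormalize (Y : Matrix (Fin n) (Fin p) ℝ) (E : Matrix (Fin n) (Fin n) ℝ) :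
    frobSq ((orthonormalize Y)ᵀ * E * orthonormalize Y) = radialError Y E := by
  have hsq := cfc_sqrt_mul_self (posSemidef_transpose_mul_self Y).inv
  have ht := transpose_cfc_sqrt (Yᵀ * Y)⁻¹
  rw [frobSq_eq_trace, orthonormalize, radialError]
  set C := cfc Real.sqrt (Yᵀ * Y)⁻¹
  rw [← hsq]
  calc _ = (C * ((Yᵀ * E * Y) * (C * C) * (Yᵀ * Eᵀ * Y) * C)).trace := by
        simp only [transpose_mul, ht, transpose_transpose, Matrix.mul_assoc]
    _ = (((Yᵀ * E * Y) * (C * C) * (Yᵀ * Eᵀ * Y) * C) * C).trace := trace_mul_comm _ _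
    _ = (((Yᵀ * E * Y) * (C * C) * (Yᵀ * Eᵀ * Y)) * (C * C)).trace := by
        simp only [Matrix.mul_assoc]
    _ = ((C * C) * ((Yᵀ * E * Y) * (C * C) * (Yᵀ * Eᵀ * Y))).trace := trace_mul_comm _ _
    _ = _ := by simp only [Matrix.mul_assoc]

theorem measurable_radialError : Measurable
    fun x : Matrix (Fin n) (Fin p) ℝ × Matrix (Fin n) (Fin n) ℝ => radialError x.1 x.2 := by
  have h0 : Measurable fun x : Matrix (Fin n) (Fin p) ℝ × Matrix (Fin n) (Fin n) ℝ =>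
      (x.1ᵀ * x.1)⁻¹ := measurable_inv.comp
    (continuous_fst.matrix_transpose.matrix_mul continuous_fst).measurable
  have hmul : ∀ f g : Matrix (Fin n) (Fin p) ℝ × Matrix (Fin n) (Fin n) ℝ →
      Matrix (Fin p) (Fin p) ℝ, Measurable f → Measurable g → Measurable fun x => f x * g x := by
    intro f g hf hg
    have : Measurable fun z : Matrix (Fin p) (Fin p) ℝ × Matrix (Fin p) (Fin p) ℝ => z.1 * z.2 :=
      (continuous_fst.matrix_mul continuous_snd).measurable
    exact this.comp (hf.prodMk hg)
  have h1 : Measurable fun x : Matrix (Fin n) (Fin p) ℝ × Matrix (Fin n) (Fin n) ℝ =>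
      x.1ᵀ * x.2 * x.1 :=
    ((continuous_fst.matrix_transpose.matrix_mul continuous_snd).matrix_mul
      continuous_fst).measurable
  have h2 : Measurable fun x : Matrix (Fin n) (Fin p) ℝ × Matrix (Fin n) (Fin n) ℝ =>
      x.1ᵀ * x.2ᵀ * x.1 :=
    ((continuous_fst.matrix_transpose.matrix_mul continuous_snd.matrix_transpose).matrix_mul
      continuous_fst).measurable
  exact measurable_trace_mul (hmul _ _ h0 h1) (hmul _ _ h0 h2)

variable {𝒜 : Measure (Matrix (Fin n) (Fin n) ℝ)} {A : Matrix (Fin n) (Fin n) ℝ} {σa σr : ℝ}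

theorem measurable_mul_mul_apply {k l : ℕ} (P : Matrix (Fin k) (Fin n) ℝ)
    (Q : Matrix (Fin n) (Fin l) ℝ) (i : Fin k) (j : Fin l) :
    Measurable fun M : Matrix (Fin n) (Fin n) ℝ => (P * M * Q) i j :=
  ((continuous_const.matrix_mul continuous_id).matrix_mul
    continuous_const).matrix_elem i j |>.measurable

theorem VarianceCondition.memLp (hvar : VarianceCondition 𝒜 A σa σr) (y : Fin n → ℝ) :
    MemLp (fun M : Matrix (Fin n) (Fin n) ℝ => y ⬝ᵥ (M *ᵥ y)) 2 𝒜 := by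
  have hm : Measurable fun M : Matrix (Fin n) (Fin n) ℝ => y ⬝ᵥ (M *ᵥ y) :=
    (continuous_const.dotProduct (continuous_id.matrix_mulVec continuous_const)).measurable
  exact (memLp_two_iff_integrable_sq hm.aestronglyMeasurable).2 (hvar.radial y).1

/-- The radial condition controls quadratic forms, hence diagonal entries. Off-diagonal entries
follow by polarization, which requires symmetric samples; for `p = 1` there are none. -/
theorem VarianceCondition.entry_bound (hvar : VarianceCondition 𝒜 A σa σr)
    (hsym : p = 1 ∨ ∀ᵐ M ∂𝒜, M.IsSymm) {Y : Matrix (Fin n) (Fin p) ℝ} (hY : Yᵀ * Y = 1)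
    (i j : Fin p) : MemLp (fun M => (Yᵀ * M * Y) i j) 2 𝒜 ∧
      ∫ M, ((Yᵀ * M * Y) i j) ^ 2 ∂𝒜 ≤ σr ^ 2 := by
  have hdot : ∀ k l, Y.col k ⬝ᵥ Y.col l = if k = l then 1 else 0 := fun k l => by
    rw [← Matrix.one_apply, ← hY]; rfl
  by_cases hij : i = j
  · subst hij
    simp only [gram_apply_self]
    refine ⟨hvar.memLp _, (hvar.radial _).2.trans ?_⟩
    rw [sqNorm_eq_dotProduct, hdot]; simp
  · have hsym' : ∀ᵐ M ∂𝒜, M.IsSymm := hsym.resolve_left fun hp => hij (by subst hp; exact Subsingleton.elim _ _)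
    set v := Y.col i + Y.col j with hv
    set w := Y.col i - Y.col j with hw
    -- Both `v` and `w` have squared norm `2`. With `(α - β)² ≤ 2(α² + β²)`, the second moment is at
    -- most `(1/8)(4σr² + 4σr²) = σr²`.
    have hae : (fun M => (Yᵀ * M * Y) i j) =ᵐ[𝒜]
        fun M => (1 / 4 : ℝ) * (v ⬝ᵥ (M *ᵥ v) - w ⬝ᵥ (M *ᵥ w)) := by
      filter_upwards [hsym'] with M hM
      have e1 : (Yᵀ * M * Y) i j = Y.col i ⬝ᵥ (M *ᵥ Y.col j) := by
        rw [Matrix.mul_assoc]; rfl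
      have e2 : Y.col j ⬝ᵥ (M *ᵥ Y.col i) = Y.col i ⬝ᵥ (M *ᵥ Y.col j) := by
        rw [dotProduct_mulVec, ← mulVec_transpose, hM.eq, dotProduct_comm]
      rw [e1, hv, hw]
      simp only [mulVec_add, mulVec_sub, dotProduct_add, dotProduct_sub, add_dotProduct,
        sub_dotProduct, e2]
      ring
    have hv2 : sqNorm v = 2 := by
      rw [sqNorm_eq_dotProduct, hv]
      simp only [dotProduct_add, add_dotProduct, hdot, if_neg hij, if_neg (Ne.symm hij), if_true]
      norm_num
    have hw2 : sqNorm w = 2 := by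
      rw [sqNorm_eq_dotProduct, hw]
      simp only [dotProduct_sub, sub_dotProduct, hdot, if_neg hij, if_neg (Ne.symm hij), if_true]
      norm_num
    have Hv := hvar.radial v
    have Hw := hvar.radial w
    rw [hv2] at Hv
    rw [hw2] at Hw
    refine ⟨(memLp_congr_ae hae).2 (((hvar.memLp v).sub (hvar.memLp w)).const_mul _), ?_⟩
    have hae2 : (fun M => ((Yᵀ * M * Y) i j) ^ 2) =ᵐ[𝒜]
        fun M => ((1 / 4 : ℝ) * (v ⬝ᵥ (M *ᵥ v) - w ⬝ᵥ (M *ᵥ w))) ^ 2 := by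
      filter_upwards [hae] with M hM
      rw [hM]
    rw [integral_congr_ae hae2]
    calc ∫ M, ((1 / 4 : ℝ) * (v ⬝ᵥ (M *ᵥ v) - w ⬝ᵥ (M *ᵥ w))) ^ 2 ∂𝒜
        ≤ ∫ M, (1 / 8 : ℝ) * ((v ⬝ᵥ (M *ᵥ v)) ^ 2 + (w ⬝ᵥ (M *ᵥ w)) ^ 2) ∂𝒜 := by
          refine integral_mono_of_nonneg (.of_forall fun M => sq_nonneg _)
            ((Hv.1.add Hw.1).const_mul _) (.of_forall fun M => ?_)
          nlinarith [sq_nonneg (v ⬝ᵥ (M *ᵥ v) + w ⬝ᵥ (M *ᵥ w))]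
      _ = (1 / 8 : ℝ) * (∫ M, (v ⬝ᵥ (M *ᵥ v)) ^ 2 ∂𝒜 + ∫ M, (w ⬝ᵥ (M *ᵥ w)) ^ 2 ∂𝒜) := by
          rw [integral_const_mul, integral_add Hv.1 Hw.1]
      _ ≤ σr ^ 2 := by linarith [Hv.2, Hw.2]

variable {Ω : Type*} [MeasurableSpace Ω] {μ : Measure Ω} {Y₀ : Ω → Matrix (Fin n) (Fin p) ℝ}
  {S : ℕ → Ω → Matrix (Fin n) (Fin n) ℝ} {η : ℝ}

/-- The deviation of a sample mean from the mean. -/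
def sampleError (A : Matrix (Fin n) (Fin n) ℝ) (S : ℕ → Ω → Matrix (Fin n) (Fin n) ℝ) (K L : ℕ)
    (ω : Ω) : Matrix (Fin n) (Fin n) ℝ :=
  (L : ℝ)⁻¹ • ∑ l ∈ Finset.range L, S (K + l) ω - A

theorem IsRun.entry_variance [IsProbabilityMeasure μ] [IsProbabilityMeasure 𝒜]
    (hrun : IsRun μ 𝒜 Y₀ S) (hA : HasMean 𝒜 A)
    (hvar : VarianceCondition 𝒜 A σa σr) (hsym : p = 1 ∨ ∀ᵐ M ∂𝒜, M.IsSymm)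
    {Y : Matrix (Fin n) (Fin p) ℝ} (hY : Yᵀ * Y = 1) (K : ℕ) {L : ℕ} (hL : 1 ≤ L) (i j : Fin p) :
    Integrable (fun ω => ((Yᵀ * sampleError A S K L ω * Y) i j) ^ 2) μ ∧
      ∫ ω, ((Yᵀ * sampleError A S K L ω * Y) i j) ^ 2 ∂μ ≤ σr ^ 2 / L := by
  set f : Matrix (Fin n) (Fin n) ℝ → ℝ := fun M => (Yᵀ * M * Y) i j with hf
  have hfm : Measurable f := measurable_mul_mul_apply _ _ i j
  obtain ⟨hf2, hfb⟩ := hvar.entry_bound hsym hY i j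
  have hfA := (hA.integral_mul_mul Yᵀ Y i j).2
  set X : ℕ → Ω → ℝ := fun l ω => f (S (K + l) ω) with hX
  have hX2 : ∀ l, MemLp (X l) 2 μ := fun l => by
    have := hf2
    rw [← hrun.law_sample (K + l)] at this
    exact this.comp_of_map (hrun.measurable_sample _).aemeasurable
  have hXmean : ∀ l, ∫ ω, X l ω ∂μ = f A := fun l => by
    rw [← hrun.law_sample (K + l),
      integral_map (hrun.measurable_sample _).aemeasurable hfm.aestronglyMeasurable] at hfA
    exact hfA
  have hXvar : ∀ l, Var[X l; μ] ≤ σr ^ 2 := fun l => by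
    refine (variance_le_expectation_sq (hX2 l).1).trans ?_
    refine le_trans (le_of_eq ?_) hfb
    rw [← hrun.law_sample (K + l),
      integral_map (hrun.measurable_sample _).aemeasurable (hfm.pow_const 2).aestronglyMeasurable]
    rfl
  have hind : Set.Pairwise (↑(Finset.range L)) fun l m => IndepFun (X l) (X m) μ := by
    intro l _ m _ hlm
    exact (hrun.indep_samples.indepFun (by simpa using hlm : K + l ≠ K + m)).comp hfm hfm
  have hsum := IndepFun.variance_sum (fun l _ => hX2 l) hind
  have hL0 : (0 : ℝ) < L := by exact_mod_cast hL
  set T : Ω → ℝ := fun ω => (L : ℝ)⁻¹ * (∑ l ∈ Finset.range L, X l) ω with hT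
  have hT2 : MemLp T 2 μ := (memLp_finsetSum' _ fun l _ => hX2 l).const_mul _
  have hTmean : ∫ ω, T ω ∂μ = f A := by
    rw [hT, integral_const_mul]
    simp only [Finset.sum_apply]
    rw [integral_finsetSum _ fun l _ => (hX2 l).integrable one_le_two]
    simp only [hXmean, Finset.sum_const, Finset.card_range, nsmul_eq_mul]
    field_simp
  have hTvar : Var[T; μ] ≤ σr ^ 2 / L := by
    rw [hT, variance_const_mul, hsum]
    calc (L : ℝ)⁻¹ ^ 2 * ∑ l ∈ Finset.range L, Var[X l; μ]
        ≤ (L : ℝ)⁻¹ ^ 2 * ∑ l ∈ Finset.range L, σr ^ 2 := by gcongr with l; exact hXvar l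
      _ = σr ^ 2 / L := by
        rw [Finset.sum_const, Finset.card_range, nsmul_eq_mul]; field_simp
  have hdev : ∀ ω, (Yᵀ * sampleError A S K L ω * Y) i j = T ω - ∫ ω, T ω ∂μ := by
    intro ω
    rw [hTmean, sampleError, Matrix.mul_sub, Matrix.sub_mul, Matrix.sub_apply, hT, hf]
    congr 1
    have e1 : Yᵀ * (∑ l ∈ Finset.range L, S (K + l) ω) * Y =
        ∑ l ∈ Finset.range L, Yᵀ * S (K + l) ω * Y := by rw [Matrix.mul_sum, Matrix.sum_mul]
    rw [Matrix.mul_smul, Matrix.smul_mul, Matrix.smul_apply, smul_eq_mul, e1, Matrix.sum_apply]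
    change _ = (L : ℝ)⁻¹ * (∑ l ∈ Finset.range L, X l) ω
    rw [Finset.sum_apply]
  simp only [hdev]
  constructor
  · exact (hT2.sub (memLp_const _)).integrable_sq
  · rw [← variance_eq_integral hT2.1.aemeasurable]; exact hTvar

theorem IsRun.lintegral_radialError_le [IsProbabilityMeasure μ] [IsProbabilityMeasure 𝒜]
    (hrun : IsRun μ 𝒜 Y₀ S) (hA : HasMean 𝒜 A)
    (hvar : VarianceCondition 𝒜 A σa σr) (hsym : p = 1 ∨ ∀ᵐ M ∂𝒜, M.IsSymm)
    (Y : Matrix (Fin n) (Fin p) ℝ) (K : ℕ) {L : ℕ} (hL : 1 ≤ L) :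
    ∫⁻ ω, ENNReal.ofReal (radialError Y (sampleError A S K L ω)) ∂μ ≤
      ENNReal.ofReal (p ^ 2 * σr ^ 2 / L) := by
  simp only [← frobSq_orthonormalize]
  rcases orthonormalize_spec Y with h0 | h1
  · simp [h0, frobSq]
  · have h2 := fun i j => hrun.entry_variance hA hvar hsym h1 K hL i j
    have hint : Integrable (fun ω => frobSq ((orthonormalize Y)ᵀ * sampleError A S K L ω *
        orthonormalize Y)) μ :=
      integrable_finsetSum _ fun i _ => integrable_finsetSum _ fun j _ => (h2 i j).1
    rw [← ofReal_integral_eq_lintegral_ofReal hint (.of_forall fun ω =>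
      Finset.sum_nonneg fun i _ => Finset.sum_nonneg fun j _ => sq_nonneg _)]
    refine ENNReal.ofReal_le_ofReal ?_
    simp only [frobSq]
    rw [integral_finsetSum _ fun i _ => integrable_finsetSum _ fun j _ => (h2 i j).1]
    calc _ ≤ ∑ i : Fin p, ∑ j : Fin p, σr ^ 2 / L := Finset.sum_le_sum fun i _ => by
          rw [integral_finsetSum _ fun j _ => (h2 i j).1]
          exact Finset.sum_le_sum fun j _ => (h2 i j).2
      _ = _ := by simp; ring

theorem IsRun.measurable_sampleError (hrun : IsRun μ 𝒜 Y₀ S) (K L : ℕ) :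
    Measurable (sampleError A S K L) := by
  refine measurable_pi_iff.2 fun i => measurable_pi_iff.2 fun j => ?_
  have : (fun ω => sampleError A S K L ω i j) =
      fun ω => (L : ℝ)⁻¹ * ∑ l ∈ Finset.range L, S (K + l) ω i j - A i j := by
    ext ω; simp [sampleError, Matrix.sum_apply]
  refine Eq.mpr (congrArg Measurable this) ?_
  exact ((Finset.measurable_sum _ fun l _ =>
    (measurable_entry i j).comp (hrun.measurable_sample _)).const_mul _).sub_const _

theorem IsRun.indepFun_sampleError [IsProbabilityMeasure μ] (hrun : IsRun μ 𝒜 Y₀ S) (K L : ℕ) :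
    IndepFun (history Y₀ S K) (sampleError A S K L) μ := by
  set e : (Finset.Ico K (K + L) → Matrix (Fin n) (Fin n) ℝ) → Matrix (Fin n) (Fin n) ℝ :=
    fun v => (L : ℝ)⁻¹ • ∑ i, v i - A with he
  have hem : Measurable e := by
    refine measurable_pi_iff.2 fun i => measurable_pi_iff.2 fun j => ?_
    have : (fun v => e v i j) = fun v => (L : ℝ)⁻¹ * ∑ l, v l i j - A i j := by
      ext v; simp [he, Matrix.sum_apply]
    refine Eq.mpr (congrArg Measurable this) ?_
    exact ((Finset.measurable_sum _ fun l _ =>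
      (measurable_entry i j).comp (measurable_pi_apply l)).const_mul _).sub_const _
  have h1 := (hrun.indepFun_history K (Finset.Ico K (K + L)) (by
    rw [Finset.disjoint_left]; intro i hi hi'; simp at hi hi'; omega)).comp measurable_id hem
  have h2 : e ∘ (fun ω (i : Finset.Ico K (K + L)) => S i ω) = sampleError A S K L := by
    ext1 ω
    simp only [Function.comp, he, sampleError]
    rw [Finset.sum_coe_sort (Finset.Ico K (K + L)) (fun i => S i ω),
      Finset.sum_Ico_eq_sum_range]
    simp
  rwa [h2] at h1

/-- The sample error is independent of the history, which determines `Ŷ`. Fubini therefore reduces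
the second moment to a fixed `Y`, and Markov's inequality finishes. Working with `lintegral` avoids
proving joint integrability. -/
theorem IsRun.radial_bound [IsProbabilityMeasure μ] [IsProbabilityMeasure 𝒜]
    (hrun : IsRun μ 𝒜 Y₀ S) (hA : HasMean 𝒜 A)
    (hvar : VarianceCondition 𝒜 A σa σr) (hsym : p = 1 ∨ ∀ᵐ M ∂𝒜, M.IsSymm)
    (K : ℕ) {L : ℕ} (hL : 1 ≤ L) {ψ : ℝ} (hψ : 0 < ψ) :
    μ.real {ω | ψ ≤ frobSq (radialMean η Y₀ S K L ω -
        (angularOutput η Y₀ S K ω)ᵀ * A * angularOutput η Y₀ S K ω)} ≤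
      p ^ 2 * σr ^ 2 / (L * ψ) := by
  have herr : ∀ ω, frobSq (radialMean η Y₀ S K L ω -
      (angularOutput η Y₀ S K ω)ᵀ * A * angularOutput η Y₀ S K ω) =
      radialError (replay η K K (history Y₀ S K ω)) (sampleError A S K L ω) := by
    intro ω
    rw [replay_history le_rfl, ← frobSq_orthonormalize, radialMean, sampleError, angularOutput,
      Matrix.mul_sub, Matrix.sub_mul, Matrix.mul_smul, Matrix.smul_mul, Matrix.mul_sum,
      Matrix.sum_mul]
  simp only [herr]
  have hH := hrun.measurable_history K
  have hE : Measurable (sampleError A S K L) := hrun.measurable_sampleError K L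
  have hind : IndepFun (history Y₀ S K) (sampleError A S K L) μ := hrun.indepFun_sampleError K L
  set g : (Matrix (Fin n) (Fin p) ℝ × (Finset.range K → Matrix (Fin n) (Fin n) ℝ)) ×
      Matrix (Fin n) (Fin n) ℝ → ENNReal :=
    fun z => ENNReal.ofReal (radialError (replay η K K z.1) z.2) with hg
  have hr : Measurable fun z : (Matrix (Fin n) (Fin p) ℝ × (Finset.range K →
      Matrix (Fin n) (Fin n) ℝ)) × Matrix (Fin n) (Fin n) ℝ => (replay η K K z.1, z.2) :=
    ((measurable_replay K K).comp measurable_fst).prodMk measurable_snd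
  have hgm : Measurable g := (measurable_radialError.comp hr).ennreal_ofReal
  have hlin : ∫⁻ ω, g (history Y₀ S K ω, sampleError A S K L ω) ∂μ ≤
      ENNReal.ofReal (p ^ 2 * σr ^ 2 / L) := by
    have := Measure.isProbabilityMeasure_map (μ := μ) hH.aemeasurable
    have := Measure.isProbabilityMeasure_map (μ := μ) hE.aemeasurable
    rw [← lintegral_map hgm (hH.prodMk hE), (indepFun_iff_map_prod_eq_prod_map_map
      hH.aemeasurable hE.aemeasurable).1 hind, lintegral_prod _ hgm.aemeasurable]
    calc _ ≤ ∫⁻ _x, ENNReal.ofReal (p ^ 2 * σr ^ 2 / L) ∂(μ.map (history Y₀ S K)) := by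
          refine lintegral_mono fun x => ?_
          have hgx : Measurable fun y => g (x, y) := hgm.comp measurable_prodMk_left
          rw [lintegral_map hgx hE]
          change ∫⁻ ω, ENNReal.ofReal (radialError (replay η K K x) (sampleError A S K L ω)) ∂μ ≤ _
          exact hrun.lintegral_radialError_le hA hvar hsym _ K hL
      _ = _ := by simp
  have hgc : AEMeasurable (fun ω => g (history Y₀ S K ω, sampleError A S K L ω)) μ :=
    (hgm.comp (hH.prodMk hE)).aemeasurable
  have hmarkov := meas_ge_le_lintegral_div (μ := μ)
    hgc (ε := ENNReal.ofReal ψ) (by simpa using hψ) (by simp)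
  have hsub : {ω | ψ ≤ radialError (replay η K K (history Y₀ S K ω)) (sampleError A S K L ω)} ⊆
      {ω | ENNReal.ofReal ψ ≤ g (history Y₀ S K ω, sampleError A S K L ω)} := fun ω hω =>
    ENNReal.ofReal_le_ofReal hω
  have hfin := (measure_mono hsub).trans (hmarkov.trans (ENNReal.div_le_div_right hlin _))
  rw [← ENNReal.ofReal_div_of_pos hψ] at hfin
  rw [Measure.real]
  refine (ENNReal.toReal_le_of_le_ofReal (by positivity) hfin).trans (le_of_eq ?_)
  rw [div_div]

end

section

/-! ### Gaussian matrices -/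

/-- The law of an `n × p` array of independent standard normal variables. -/
def gaussRows (n p : ℕ) : Measure (Fin n → Fin p → ℝ) :=
  Measure.pi fun _ => Measure.pi fun _ => gaussianReal 0 1

instance (n p : ℕ) : IsProbabilityMeasure (gaussRows n p) := by
  unfold gaussRows; infer_instance

theorem measurable_of (n p : ℕ) :
    Measurable (of : (Fin n → Fin p → ℝ) → Matrix (Fin n) (Fin p) ℝ) := measurable_id

theorem charFunDual_gaussianReal (L : StrongDual ℝ ℝ) :
    charFunDual (gaussianReal 0 1) L = Complex.exp (-((L 1) ^ 2 / 2 : ℝ)) := by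
  have h : charFunDual (gaussianReal 0 1) L = charFun (gaussianReal 0 1) (L 1) := by
    rw [charFunDual_apply, charFun_apply_real]
    congr 1; ext x
    have : L x = L 1 * x := by
      conv_lhs => rw [← mul_one x, ← smul_eq_mul, map_smul, smul_eq_mul, mul_comm]
    rw [this]; push_cast; rfl
  rw [h, charFun_gaussianReal]
  congr 1
  push_cast
  ring

theorem charFunDual_gaussRows {n p : ℕ} (L : StrongDual ℝ (Fin n → Fin p → ℝ)) :
    charFunDual (gaussRows n p) L =
      Complex.exp (-((∑ j, ∑ i, L (Pi.single i (Pi.single j 1)) ^ 2) / 2 : ℝ)) := by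
  rw [gaussRows, charFunDual_pi, Finset.sum_comm]
  simp only [charFunDual_pi, charFunDual_gaussianReal]
  simp only [← Complex.exp_sum]
  congr 1
  push_cast
  simp only [Finset.sum_neg_distrib, Finset.sum_div]
  rfl

/-- The law of a Gaussian matrix is invariant under left multiplication by orthogonal matrices. -/
theorem gaussRows_map_mul {n p : ℕ} {Q : Matrix (Fin n) (Fin n) ℝ} (hQ : Q * Qᵀ = 1) :
    (gaussRows n p).map (fun x i j => ∑ k, Q i k * x k j) = gaussRows n p := by
  set T : (Fin n → Fin p → ℝ) →ₗ[ℝ] (Fin n → Fin p → ℝ) :=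
    { toFun := fun x i j => ∑ k, Q i k * x k j
      map_add' := fun x y => by ext i j; simp [mul_add, Finset.sum_add_distrib]
      map_smul' := fun c x => by ext i j; simp [Finset.mul_sum, mul_left_comm] } with hT
  set T' := LinearMap.toContinuousLinearMap T
  have hTfun : (fun x i j => ∑ k, Q i k * x k j : (Fin n → Fin p → ℝ) → (Fin n → Fin p → ℝ)) =
    ⇑T' := rfl
  rw [hTfun]
  have hTm : Measurable T' := T'.continuous.measurable
  have := Measure.isProbabilityMeasure_map (μ := gaussRows n p) hTm.aemeasurable
  refine Measure.ext_of_charFunDual ?_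
  ext L
  rw [charFunDual_map, charFunDual_gaussRows, charFunDual_gaussRows]
  congr 4
  refine Finset.sum_congr rfl fun j _ => ?_
  -- On column `j` the functional `L` is the vector `l`, and composing with the map replaces it by
  -- `Qᵀ *ᵥ l`. The characteristic function only sees its Euclidean norm.
  set l : Fin n → ℝ := fun k => L (Pi.single k (Pi.single j 1)) with hl
  have h1 : ∀ i, (L.comp T') (Pi.single i (Pi.single j 1)) = (Qᵀ *ᵥ l) i := by
    intro i
    have h2 : T' (Pi.single i (Pi.single j 1)) =
        ∑ k, Q k i • (Pi.single k (Pi.single j 1) : Fin n → Fin p → ℝ) := by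
      ext k m
      rw [← hTfun]
      simp only [Finset.sum_apply, Pi.smul_apply, smul_eq_mul]
      rw [Finset.sum_eq_single i, Finset.sum_eq_single k]
      · simp
      · intro b _ hb; simp [hb.symm]
      · simp
      · intro b _ hb; simp [hb]
      · simp
    rw [ContinuousLinearMap.comp_apply, h2, map_sum]
    simp only [map_smul, smul_eq_mul, mulVec, dotProduct, transpose_apply, hl]
  calc ∑ i, (L.comp T') (Pi.single i (Pi.single j 1)) ^ 2 = (Qᵀ *ᵥ l) ⬝ᵥ (Qᵀ *ᵥ l) := by
        simp only [h1, dotProduct, sq]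
    _ = l ⬝ᵥ l := by
        rw [dotProduct_mulVec, ← mulVec_transpose, transpose_transpose, mulVec_mulVec, hQ,
          one_mulVec]
    _ = _ := by simp only [dotProduct, sq, hl]

theorem map_of_gaussRows_mul {n p : ℕ} {Q : Matrix (Fin n) (Fin n) ℝ} (hQ : Q * Qᵀ = 1) :
    ((gaussRows n p).map of).map (fun Y : Matrix (Fin n) (Fin p) ℝ => Q * Y) =
      (gaussRows n p).map of := by
  have hm : Measurable fun Y : Matrix (Fin n) (Fin p) ℝ => Q * Y :=
    (continuous_const.matrix_mul continuous_id).measurable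
  have hm2 : Measurable (fun x i j => ∑ k, Q i k * x k j :
      (Fin n → Fin p → ℝ) → (Fin n → Fin p → ℝ)) := by
    refine measurable_pi_iff.2 fun i => measurable_pi_iff.2 fun j =>
      Finset.measurable_sum _ fun k _ => ?_
    fun_prop
  rw [Measure.map_map hm (measurable_of n p)]
  conv_rhs => rw [← gaussRows_map_mul hQ]
  rw [Measure.map_map (measurable_of n p) hm2]
  rfl

theorem gaussRows_map_comp {m n p : ℕ} {e : Fin m → Fin n} (he : Function.Injective e) :
    (gaussRows n p).map (fun x i => x (e i)) = gaussRows m p := by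
  have h : iIndepFun (fun (i : Fin n) (x : Fin n → Fin p → ℝ) => x i) (gaussRows n p) :=
    iIndepFun_pi (X := fun _ => id) fun _ => aemeasurable_id
  have h2 := (iIndepFun_iff_map_fun_eq_pi_map fun i =>
    (measurable_pi_apply (e i)).aemeasurable).1 (h.precomp he)
  rw [h2, gaussRows]
  congr 1
  ext1 i
  exact (measurePreserving_eval (fun _ : Fin n => Measure.pi fun _ : Fin p => gaussianReal 0 1)
    (e i)).map_eq

theorem pi_absolutelyContinuous {n : ℕ} {α : Type*} [MeasurableSpace α] {μ ν : Measure α}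
    [SigmaFinite μ] [SigmaFinite ν] (h : μ ≪ ν) :
    Measure.pi (fun _ : Fin n => μ) ≪ Measure.pi fun _ : Fin n => ν := by
  induction n with
  | zero => rw [Measure.pi_of_empty, Measure.pi_of_empty]
  | succ n ih =>
    have h1 := (measurePreserving_piFinSuccAbove (fun _ : Fin (n + 1) => μ) 0).symm.map_eq
    have h2 := (measurePreserving_piFinSuccAbove (fun _ : Fin (n + 1) => ν) 0).symm.map_eq
    rw [← h1, ← h2]
    exact (Measure.AbsolutelyContinuous.prod h ih).map (MeasurableEquiv.measurable _)

/-- It suffices to argue for Lebesgue measure. On each line `x + s • 1` the determinant is a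
characteristic polynomial in `s`, with finitely many zeros; Fubini yields one `s` whose slice is
null, and translation invariance removes `s`. -/
theorem ae_det_ne_zero_square (p : ℕ) : ∀ᵐ x ∂gaussRows p p, (of x).det ≠ 0 := by
  have hac : gaussRows p p ≪ (volume : Measure (Fin p → Fin p → ℝ)) :=
    pi_absolutelyContinuous (pi_absolutelyContinuous
      (gaussianReal_absolutelyContinuous 0 one_ne_zero))
  refine hac.ae_le ?_
  have hdm : Measurable fun x : Fin p → Fin p → ℝ => (of x).det :=
    (continuous_id.matrix_det : Continuous fun M : Matrix (Fin p) (Fin p) ℝ => M.det).measurable.comp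
      (measurable_of p p)
  set one : Fin p → Fin p → ℝ := fun i j => if i = j then 1 else 0 with hone
  set Zs : Set (Fin p → Fin p → ℝ) := {x | (of x).det = 0} with hZs
  have hZm : MeasurableSet Zs := hdm (measurableSet_singleton 0)
  have hsm : MeasurableSet {z : ℝ × (Fin p → Fin p → ℝ) | z.2 + z.1 • one ∈ Zs} := by
    have : Measurable fun z : ℝ × (Fin p → Fin p → ℝ) => z.2 + z.1 • one :=
      (continuous_snd.add (continuous_fst.smul continuous_const)).measurable
    exact this hZm
  have hnull : (volume.prod volume) {z : (Fin p → Fin p → ℝ) × ℝ | z.1 + z.2 • one ∈ Zs} = 0 := by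
    have hm' : MeasurableSet {z : (Fin p → Fin p → ℝ) × ℝ | z.1 + z.2 • one ∈ Zs} :=
      measurable_swap hsm
    refine (Measure.measure_prod_null hm').2 (.of_forall fun x => ?_)
    have hfin : {s : ℝ | (-(of x)).charpoly.eval s = 0}.Finite :=
      ((-(of x)).charpoly.rootSet_finite ℝ).subset fun s hs => by
        rw [Polynomial.mem_rootSet]
        exact ⟨(charpoly_monic _).ne_zero, by simpa using hs⟩
    refine measure_mono_null (fun s hs => ?_) (hfin.measure_zero volume)
    simp only [Set.mem_ofPred_eq, Set.mem_preimage, hZs] at hs ⊢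
    rw [eval_charpoly, ← hs]
    congr 1
    ext i j
    by_cases hij : i = j <;> simp [hone, scalar_apply, hij, add_comm]
  have hnull2 : (volume.prod volume) {z : ℝ × (Fin p → Fin p → ℝ) | z.2 + z.1 • one ∈ Zs} = 0 := by
    rw [← Measure.prod_swap, Measure.map_apply measurable_swap hsm]
    exact hnull
  have hae := (Measure.measure_prod_null hsm).1 hnull2
  obtain ⟨s, hs⟩ := hae.exists
  have hs' : volume ((fun x : Fin p → Fin p → ℝ => x + s • one) ⁻¹' Zs) = 0 := hs
  rw [measure_preimage_add_right] at hs'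
  exact measure_eq_zero_iff_ae_notMem.1 hs'

/-- A kernel vector of the Gram matrix is killed by `x` itself, in particular by its first `p` rows,
which form an almost surely invertible square block. -/
theorem ae_gram_det_ne_zero {n p : ℕ} (hpn : p ≤ n) :
    ∀ᵐ x ∂gaussRows n p, ((of x)ᵀ * of x).det ≠ 0 := by
  have h1 := ae_det_ne_zero_square p
  rw [← gaussRows_map_comp (Fin.castLE_injective hpn)] at h1
  have h2 := ae_of_ae_map (measurable_pi_iff.2 fun i => measurable_pi_apply _).aemeasurable h1
  filter_upwards [h2] with x hx
  intro h0
  obtain ⟨v, hv, hv0⟩ := exists_mulVec_eq_zero_iff.2 h0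
  have hx0 : of x *ᵥ v = 0 := by
    rw [← mulVec_mulVec] at hv0
    have h3 : (of x *ᵥ v) ⬝ᵥ (of x *ᵥ v) = 0 := by
      have : v ⬝ᵥ ((of x)ᵀ *ᵥ (of x *ᵥ v)) = (of x *ᵥ v) ⬝ᵥ (of x *ᵥ v) := by
        rw [dotProduct_mulVec, vecMul_transpose]
      rw [← this, hv0, dotProduct_zero]
    exact dotProduct_self_eq_zero.1 h3
  refine hx (exists_mulVec_eq_zero_iff.1 ⟨v, hv, ?_⟩)
  ext i
  exact congrFun hx0 (Fin.castLE hpn i)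

theorem integrable_gaussRows_mul {n p : ℕ} (i : Fin n) (k l : Fin p) :
    Integrable (fun x => x i k * x i l) (gaussRows n p) ∧
      ∫ x, x i k * x i l ∂gaussRows n p = if k = l then 1 else 0 := by
  have hrow := measurePreserving_eval
    (fun _ : Fin n => Measure.pi fun _ : Fin p => gaussianReal 0 1) i
  have hentry : ∀ k, MeasurePreserving (fun x : Fin n → Fin p → ℝ => x i k) (gaussRows n p)
      (gaussianReal 0 1) := fun k =>
    (measurePreserving_eval (fun _ : Fin p => gaussianReal 0 1) k).comp hrow
  have h2 : ∀ k, MemLp (fun x : Fin n → Fin p → ℝ => x i k) 2 (gaussRows n p) := fun k =>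
    (memLp_id_gaussianReal 2).comp_measurePreserving (hentry k)
  refine ⟨(h2 k).integrable_mul (h2 l), ?_⟩
  have hmean : ∀ k, ∫ x, x i k ∂gaussRows n p = 0 := fun k => by
    have := integral_id_gaussianReal (μ := 0) (v := 1)
    rw [← (hentry k).map_eq, integral_map (f := fun x => x)
      (hentry k).measurable.aemeasurable measurable_id.aestronglyMeasurable] at this
    exact this
  by_cases hkl : k = l
  · subst hkl
    rw [if_pos rfl]
    have h3 := variance_id_gaussianReal (μ := 0) (v := 1)
    rw [← (hentry k).map_eq, variance_id_map (hentry k).measurable.aemeasurable,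
      variance_eq_integral (hentry k).measurable.aemeasurable] at h3
    simp only [hmean, sub_zero] at h3
    simpa [sq] using h3
  · rw [if_neg hkl]
    have h4 : IndepFun (fun y : Fin p → ℝ => y k) (fun y => y l)
        (Measure.pi fun _ : Fin p => gaussianReal 0 1) :=
      (iIndepFun_pi (X := fun _ => id) fun _ => aemeasurable_id).indepFun hkl
    have h5 : IndepFun (fun x : Fin n → Fin p → ℝ => x i k) (fun x => x i l) (gaussRows n p) := by
      have h6 := h4
      rw [← hrow.map_eq] at h6
      rw [indepFun_iff_map_prod_eq_prod_map_map (measurable_pi_apply _).aemeasurable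
        (measurable_pi_apply _).aemeasurable] at h6
      rw [Measure.map_map (by fun_prop) (by fun_prop), Measure.map_map (by fun_prop) (by fun_prop),
        Measure.map_map (by fun_prop) (by fun_prop)] at h6
      exact (indepFun_iff_map_prod_eq_prod_map_map (hentry k).measurable.aemeasurable
        (hentry l).measurable.aemeasurable).2 h6
    rw [h5.integral_fun_mul_eq_mul_integral (hentry k).measurable.aestronglyMeasurable
      (hentry l).measurable.aestronglyMeasurable, hmean, zero_mul]

end

section

/-! ### Orthogonally invariant laws -/

variable {n p q : ℕ} {a : ℝ}

theorem exists_orthogonal_extension {k : ℕ} (hk : k ≤ n) {V : Matrix (Fin n) (Fin k) ℝ}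
    (hV : Vᵀ * V = 1) : ∃ O : Matrix (Fin n) (Fin n) ℝ, O * Oᵀ = 1 ∧
      O * (1 : Matrix (Fin n) (Fin n) ℝ).submatrix id (Fin.castLE hk) = V := by
  set v : Fin n → EuclideanSpace ℝ (Fin n) := fun i =>
    if h : (i : ℕ) < k then WithLp.toLp 2 (V.col ⟨i, h⟩) else 0 with hv
  have hort : Orthonormal ℝ (({i : Fin n | (i : ℕ) < k} : Set (Fin n)).domRestrict v) := by
    rw [orthonormal_iff_ite]
    rintro ⟨i, hi⟩ ⟨j, hj⟩
    have hi' : (i : ℕ) < k := hi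
    have hj' : (j : ℕ) < k := hj
    have h1 : inner ℝ (v i) (v j) = (Vᵀ * V) ⟨i, hi'⟩ ⟨j, hj'⟩ := by
      simp only [hv, hi', hj', dif_pos, Matrix.mul_apply, transpose_apply, PiLp.inner_apply]
      exact Finset.sum_congr rfl fun l _ => by simp [mul_comm]
    change inner ℝ (v i) (v j) = _
    rw [h1, hV, one_apply]
    simp [Fin.ext_iff]
  obtain ⟨b, hb⟩ := hort.exists_orthonormalBasis_extension_of_card_eq (by simp)
  refine ⟨of fun i j => b j i, ?_, ?_⟩
  · refine mul_eq_one_comm.1 ?_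
    ext i j
    have := orthonormal_iff_ite.1 b.orthonormal i j
    rw [one_apply, ← this, Matrix.mul_apply, PiLp.inner_apply]
    exact Finset.sum_congr rfl fun l _ => by simp [mul_comm]
  · ext i j
    rw [Matrix.mul_apply, Finset.sum_eq_single (Fin.castLE hk j)]
    · have h2 := hb (Fin.castLE hk j) (by simp)
      simp [h2, hv, one_apply]
    · intro l _ hl; simp [one_apply, hl]
    · simp

theorem exists_orthogonal_mul_eq {k : ℕ} (hk : k ≤ n) {V V' : Matrix (Fin n) (Fin k) ℝ}
    (hV : Vᵀ * V = 1) (hV' : V'ᵀ * V' = 1) :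
    ∃ Q : Matrix (Fin n) (Fin n) ℝ, Q * Qᵀ = 1 ∧ Qᵀ * Q = 1 ∧ Q * V = V' := by
  obtain ⟨O, hO, hOV⟩ := exists_orthogonal_extension hk hV
  obtain ⟨O', hO', hOV'⟩ := exists_orthogonal_extension hk hV'
  have h1 : O' * Oᵀ * (O' * Oᵀ)ᵀ = 1 := by
    calc _ = O' * (Oᵀ * O) * O'ᵀ := by simp only [transpose_mul, transpose_transpose, Matrix.mul_assoc]
      _ = 1 := by rw [mul_eq_one_comm.1 hO, Matrix.mul_one, hO']
  refine ⟨O' * Oᵀ, h1, mul_eq_one_comm.1 h1, ?_⟩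
  rw [← hOV, ← hOV', Matrix.mul_assoc, ← Matrix.mul_assoc Oᵀ, mul_eq_one_comm.1 hO, Matrix.one_mul]

theorem ratio_conj {U Q : Matrix (Fin n) (Fin n) ℝ} (hQ : Q * Qᵀ = 1)
    (Y : Matrix (Fin n) (Fin p) ℝ) : ratio (Q * U * Qᵀ) a Y = ratio U a (Qᵀ * Y) := by
  have h1 : blend (Q * U * Qᵀ) a = Q * blend U a * Qᵀ := by
    rw [blend, blend, Matrix.mul_add, Matrix.add_mul, Matrix.mul_smul, Matrix.smul_mul,
      Matrix.mul_sub, Matrix.sub_mul, Matrix.mul_one, hQ]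
  simp only [ratio, h1]
  simp only [transpose_mul, transpose_transpose, Matrix.mul_assoc]

/-- The orthogonal projection onto the column space of `H` (zero if the columns are dependent). -/
def colProj (H : Matrix (Fin n) (Fin q) ℝ) : Matrix (Fin n) (Fin n) ℝ := H * (Hᵀ * H)⁻¹ * Hᵀ

theorem isProj_colProj (H : Matrix (Fin n) (Fin q) ℝ) : IsProj (colProj H) where
  symm := by
    rw [colProj, transpose_mul, transpose_mul, transpose_nonsing_inv, transpose_mul,
      transpose_transpose, Matrix.mul_assoc]
  idem := by
    by_cases h : IsUnit (Hᵀ * H).det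
    · calc colProj H * colProj H = H * ((Hᵀ * H)⁻¹ * (Hᵀ * H)) * (Hᵀ * H)⁻¹ * Hᵀ := by
            simp only [colProj, Matrix.mul_assoc]
        _ = colProj H := by rw [nonsing_inv_mul _ h, Matrix.mul_one, colProj]
    · simp [colProj, nonsing_inv_apply_not_isUnit _ h]

theorem colProj_mul {Q : Matrix (Fin n) (Fin n) ℝ} (hQ : Qᵀ * Q = 1) (H : Matrix (Fin n) (Fin q) ℝ) :
    colProj (Q * H) = Q * colProj H * Qᵀ := by
  have h : (Q * H)ᵀ * (Q * H) = Hᵀ * H := by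
    rw [transpose_mul, Matrix.mul_assoc, ← Matrix.mul_assoc Qᵀ, hQ, Matrix.one_mul]
  simp only [colProj, h]
  simp only [transpose_mul, Matrix.mul_assoc]

theorem exists_frame_of_det_ne_zero {k : ℕ} {Y : Matrix (Fin n) (Fin k) ℝ}
    (hY : (Yᵀ * Y).det ≠ 0) : ∃ C : Matrix (Fin k) (Fin k) ℝ, IsUnit C.det ∧
      (Y * C)ᵀ * (Y * C) = 1 := by
  obtain ⟨C, hC, h⟩ := exists_whitening
    ((posSemidef_transpose_mul_self Y).posDef_iff_det_ne_zero.2 hY)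
  exact ⟨C, hC, by rw [← h]; simp only [transpose_mul, Matrix.mul_assoc]⟩

theorem colProj_eq_of_frame {H : Matrix (Fin n) (Fin q) ℝ} {C : Matrix (Fin q) (Fin q) ℝ}
    (h : (H * C)ᵀ * (H * C) = 1) : colProj H = (H * C) * (H * C)ᵀ := by
  have h1 : C * Cᵀ * (Hᵀ * H) = 1 := by
    rw [Matrix.mul_assoc]
    refine mul_eq_one_comm.1 ?_
    rw [← h]; simp only [transpose_mul, Matrix.mul_assoc]
  rw [colProj, inv_eq_left_inv h1]
  simp only [transpose_mul, Matrix.mul_assoc]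

theorem measurable_ratio_colProj : Measurable
    fun z : Matrix (Fin n) (Fin q) ℝ × Matrix (Fin n) (Fin p) ℝ => ratio (colProj z.1) a z.2 := by
  have hmul : ∀ {k l m : ℕ} {f : Matrix (Fin n) (Fin q) ℝ × Matrix (Fin n) (Fin p) ℝ →
      Matrix (Fin k) (Fin l) ℝ} {g : Matrix (Fin n) (Fin q) ℝ × Matrix (Fin n) (Fin p) ℝ →
      Matrix (Fin l) (Fin m) ℝ}, Measurable f → Measurable g → Measurable fun z => f z * g z := by
    intro k l m f g hf hg
    have h : Measurable fun w : Matrix (Fin k) (Fin l) ℝ × Matrix (Fin l) (Fin m) ℝ => w.1 * w.2 :=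
      (continuous_fst.matrix_mul continuous_snd).measurable
    exact h.comp (hf.prodMk hg)
  have htr : ∀ {k l : ℕ}, Measurable fun M : Matrix (Fin k) (Fin l) ℝ => Mᵀ := fun {k l} =>
    continuous_id.matrix_transpose.measurable
  have hdet : ∀ {k : ℕ}, Measurable fun M : Matrix (Fin k) (Fin k) ℝ => M.det := fun {k} =>
    continuous_id.matrix_det.measurable
  have h1 : Measurable fun z : Matrix (Fin n) (Fin q) ℝ × Matrix (Fin n) (Fin p) ℝ =>
      colProj z.1 :=
    hmul (hmul measurable_fst (measurable_inv.comp (hmul (htr.comp measurable_fst) measurable_fst)))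
      (htr.comp measurable_fst)
  have hb : Measurable fun U : Matrix (Fin n) (Fin n) ℝ => blend U a :=
    (continuous_id.add ((continuous_const.sub continuous_id).const_smul a)).measurable
  have h2 : Measurable fun z : Matrix (Fin n) (Fin q) ℝ × Matrix (Fin n) (Fin p) ℝ =>
      blend (colProj z.1) a := hb.comp h1
  have hY : Measurable fun z : Matrix (Fin n) (Fin q) ℝ × Matrix (Fin n) (Fin p) ℝ => z.2ᵀ :=
    htr.comp measurable_snd
  have h3 := hdet.comp (hmul (hmul hY h1) measurable_snd)
  have h4 := hdet.comp (hmul (hmul hY h2) measurable_snd)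
  exact h3.div h4

theorem integral_ratio_mul_left {ρ : Measure (Matrix (Fin n) (Fin p) ℝ)}
    (U : Matrix (Fin n) (Fin n) ℝ) {Q : Matrix (Fin n) (Fin n) ℝ}
    (hinv : ρ.map (fun Y => Q * Y) = ρ) :
    ∫ Y, ratio U a (Q * Y) ∂ρ = ∫ Y, ratio U a Y ∂ρ := by
  have hm : Measurable fun Y : Matrix (Fin n) (Fin p) ℝ => Q * Y :=
    (continuous_const.matrix_mul continuous_id).measurable
  conv_rhs => rw [← hinv, integral_map hm.aemeasurable measurable_ratio.aestronglyMeasurable]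

theorem measurable_ratio_colProj_left (E : Matrix (Fin n) (Fin p) ℝ) :
    Measurable fun H : Matrix (Fin n) (Fin q) ℝ => ratio (colProj H) a E := by
  have h : Measurable fun H : Matrix (Fin n) (Fin q) ℝ => (H, E) := measurable_prodMk_right
  have h' := Measurable.comp (measurable_ratio_colProj (n := n) (p := p) (q := q) (a := a)) h
  simpa only [Function.comp_def] using h'

theorem integral_ratio_colProj_mul_left {κ : Measure (Matrix (Fin n) (Fin q) ℝ)}
    (E : Matrix (Fin n) (Fin p) ℝ) {Q : Matrix (Fin n) (Fin n) ℝ}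
    (hinv : κ.map (fun H => Q * H) = κ) :
    ∫ H, ratio (colProj (Q * H)) a E ∂κ = ∫ H, ratio (colProj H) a E ∂κ := by
  have hm : Measurable fun H : Matrix (Fin n) (Fin q) ℝ => Q * H :=
    (continuous_const.matrix_mul continuous_id).measurable
  have h := integral_map (μ := κ) hm.aemeasurable
    (measurable_ratio_colProj_left (a := a) E).aestronglyMeasurable
  rw [hinv] at h
  exact h.symm

/-- The mean potential is the same for all orthogonally invariant laws of full-rank matrices. -/
theorem integral_ratio_of_invariant (hpn : p ≤ n) (hqn : q ≤ n) (ha : 0 < a)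
    {V : Matrix (Fin n) (Fin q) ℝ} (hV : Vᵀ * V = 1)
    {ρ : Measure (Matrix (Fin n) (Fin p) ℝ)} [IsProbabilityMeasure ρ]
    (hinv : ∀ Q : Matrix (Fin n) (Fin n) ℝ, Q * Qᵀ = 1 → ρ.map (fun Y => Q * Y) = ρ)
    (hfull : ∀ᵐ Y ∂ρ, (Yᵀ * Y).det ≠ 0) :
    ∫ Y, ratio (V * Vᵀ) a Y ∂ρ = ∫ H, ratio (colProj H) a
      ((1 : Matrix (Fin n) (Fin n) ℝ).submatrix id (Fin.castLE hpn)) ∂(gaussRows n q).map of := by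
  set κ : Measure (Matrix (Fin n) (Fin q) ℝ) := (gaussRows n q).map of with hκ
  have : IsProbabilityMeasure κ := Measure.isProbabilityMeasure_map (measurable_of n q).aemeasurable
  have hκfull : ∀ᵐ H ∂κ, (Hᵀ * H).det ≠ 0 := by
    have hm : Measurable fun H : Matrix (Fin n) (Fin q) ℝ => (Hᵀ * H).det :=
      (continuous_id.matrix_transpose.matrix_mul continuous_id).matrix_det.measurable
    rw [hκ, ae_map_iff (measurable_of n q).aemeasurable]
    · exact ae_gram_det_ne_zero hqn
    · exact hm (measurableSet_singleton 0).compl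
  have hmeas := measurable_ratio_colProj (n := n) (p := p) (q := q) (a := a)
  have hint : Integrable (fun z : Matrix (Fin n) (Fin q) ℝ × Matrix (Fin n) (Fin p) ℝ =>
      ratio (colProj z.1) a z.2) (κ.prod ρ) :=
    Integrable.of_bound hmeas.aestronglyMeasurable 1 (.of_forall fun z => by
      rw [Real.norm_of_nonneg (ratio_nonneg (isProj_colProj _) ha _)]
      exact ratio_le_one (isProj_colProj _) ha _)
  -- Averaging the potential jointly over a Gaussian `H` and over `Y` replaces any appeal to
  -- uniqueness of Haar measure. For fixed full-rank `H`, a rotation carries `V * Vᵀ` to `colProj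
  -- H`, and invariance of `ρ` makes the inner integral constant.
  have h1 : ∫ H, ∫ Y, ratio (colProj H) a Y ∂ρ ∂κ = ∫ Y, ratio (V * Vᵀ) a Y ∂ρ := by
    have : ∀ᵐ H ∂κ, ∫ Y, ratio (colProj H) a Y ∂ρ = ∫ Y, ratio (V * Vᵀ) a Y ∂ρ := by
      filter_upwards [hκfull] with H hH
      obtain ⟨C, hC, hHC⟩ := exists_frame_of_det_ne_zero hH
      obtain ⟨Q, hQ, hQ', hQV⟩ := exists_orthogonal_mul_eq hqn hV hHC
      have h2 : colProj H = Q * (V * Vᵀ) * Qᵀ := by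
        rw [colProj_eq_of_frame hHC, ← hQV]; simp only [transpose_mul, Matrix.mul_assoc]
      simp only [h2, ratio_conj hQ]
      exact integral_ratio_mul_left _ (hinv Qᵀ (by rwa [transpose_transpose]))
    rw [integral_congr_ae this]; simp
  -- For fixed full-rank `Y` the roles are exchanged: the rotation is moved onto `H`, whose Gaussian
  -- law absorbs it, and the result no longer refers to `ρ`.
  have h3 : ∫ Y, ∫ H, ratio (colProj H) a Y ∂κ ∂ρ = ∫ H, ratio (colProj H) a
      ((1 : Matrix (Fin n) (Fin n) ℝ).submatrix id (Fin.castLE hpn)) ∂κ := by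
    have : ∀ᵐ Y ∂ρ, ∫ H, ratio (colProj H) a Y ∂κ = ∫ H, ratio (colProj H) a
        ((1 : Matrix (Fin n) (Fin n) ℝ).submatrix id (Fin.castLE hpn)) ∂κ := by
      filter_upwards [hfull] with Y hY
      obtain ⟨C, hC, hYC⟩ := exists_frame_of_det_ne_zero hY
      obtain ⟨Q, hQ, hQV⟩ := exists_orthogonal_extension hpn hYC
      have hQ' := mul_eq_one_comm.1 hQ
      have h4 : ∀ H : Matrix (Fin n) (Fin q) ℝ, ratio (colProj H) a Y =
          ratio (colProj (Qᵀ * H)) a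
            ((1 : Matrix (Fin n) (Fin n) ℝ).submatrix id (Fin.castLE hpn)) := fun H => by
        rw [colProj_mul (by rwa [transpose_transpose]), ratio_conj (by rwa [transpose_transpose]),
          transpose_transpose, hQV, ratio_mul_right Y hC]
      simp only [h4]
      exact integral_ratio_colProj_mul_left _
        (map_of_gaussRows_mul (by rwa [transpose_transpose]))
    rw [integral_congr_ae this]; simp
  rw [← h1, ← h3]
  exact integral_integral_swap hint

/-- Both integrals equal the same reference integral, which involves neither the frame nor the law
of `Y`. This allows changing the law and the projection simultaneously. -/
theorem integral_ratio_stiefel_eq_gaussian (hpn : p ≤ n) (hqn : q ≤ n) (ha : 0 < a)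
    {V V' : Matrix (Fin n) (Fin q) ℝ} (hV : Vᵀ * V = 1) (hV' : V'ᵀ * V' = 1)
    {ν : Measure (Matrix (Fin n) (Fin p) ℝ)} (hν : IsUniformStiefel ν) :
    ∫ Y, ratio (V * Vᵀ) a Y ∂ν = ∫ x, ratio (V' * V'ᵀ) a (of x) ∂gaussRows n p := by
  have := hν.prob
  have h1 := integral_ratio_of_invariant hpn hqn ha hV (ρ := ν)
    (fun Q hQ => hν.invariant Q ((mem_orthogonalGroup_iff _ _).2 hQ))
    (by filter_upwards [hν.orthonormal] with Y hY; rw [hY, det_one]; exact one_ne_zero)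
  have hprob : IsProbabilityMeasure
      ((gaussRows n p).map (of : (Fin n → Fin p → ℝ) → Matrix (Fin n) (Fin p) ℝ)) :=
    Measure.isProbabilityMeasure_map (measurable_of n p).aemeasurable
  have h2 := integral_ratio_of_invariant hpn hqn ha hV'
    (ρ := (gaussRows n p).map (of : (Fin n → Fin p → ℝ) → Matrix (Fin n) (Fin p) ℝ))
    (fun Q hQ => map_of_gaussRows_mul hQ) (by
      have hm : Measurable fun H : Matrix (Fin n) (Fin p) ℝ => (Hᵀ * H).det :=
        (continuous_id.matrix_transpose.matrix_mul continuous_id).matrix_det.measurable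
      rw [ae_map_iff (measurable_of n p).aemeasurable]
      · exact ae_gram_det_ne_zero hpn
      · exact hm (measurableSet_singleton 0).compl)
  rw [h1, ← h2, integral_map (measurable_of n p).aemeasurable
    measurable_ratio.aestronglyMeasurable]

end

section

/-! ### A leave-one-out inequality -/

/-- In terms of elementary symmetric polynomials the right side is `1 + e₁ + 2e₂`, so the extra `e₂`
dominates all higher terms when `e₁ ≤ 1`. -/
theorem prod_one_add_le {ι : Type*} (s : Finset ι) {b : ι → ℝ} (hb : ∀ i, 0 ≤ b i)
    (h1 : ∑ i ∈ s, b i ≤ 1) :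
    ∏ i ∈ s, (1 + b i) ≤ 1 + ∑ i ∈ s, b i + (∑ i ∈ s, b i) ^ 2 - ∑ i ∈ s, b i ^ 2 := by
  classical
  induction s using Finset.induction_on with
  | empty => simp
  | insert i s hi ih =>
    rw [Finset.sum_insert hi] at h1
    have h2 : 0 ≤ ∑ j ∈ s, b j := Finset.sum_nonneg fun j _ => hb j
    have h3 : 0 ≤ ∑ j ∈ s, b j ^ 2 := Finset.sum_nonneg fun j _ => sq_nonneg _
    have h4 := ih (by linarith [hb i])
    rw [Finset.prod_insert hi, Finset.sum_insert hi, Finset.sum_insert hi]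
    set e := ∑ j ∈ s, b j
    set P := ∑ j ∈ s, b j ^ 2
    have h5 : 0 ≤ b i * (e * (1 - e) + P) :=
      mul_nonneg (hb i) (by nlinarith [hb i])
    nlinarith [mul_le_mul_of_nonneg_left h4 (by linarith [hb i] : 0 ≤ 1 + b i)]

/-- With `e = ∑ b i`, `P = ∑ b i ^ 2` and `w = e² - P ≥ 0`, the previous bound leaves `(1 + e + w)(e
- w) = e + P - w²`. -/
theorem prod_one_add_mul_le {ι : Type*} (s : Finset ι) {b : ι → ℝ} (hb : ∀ i, 0 ≤ b i)
    (h1 : ∑ i ∈ s, b i ≤ 1) :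
    (∏ i ∈ s, (1 + b i)) * (∑ i ∈ s, b i + ∑ i ∈ s, b i ^ 2 - (∑ i ∈ s, b i) ^ 2) ≤
      ∑ i ∈ s, b i + ∑ i ∈ s, b i ^ 2 := by
  have h2 : 0 ≤ ∑ j ∈ s, b j := Finset.sum_nonneg fun j _ => hb j
  have h3 : 0 ≤ ∑ j ∈ s, b j ^ 2 := Finset.sum_nonneg fun j _ => sq_nonneg _
  have h4 := prod_one_add_le s hb h1
  have h5 : ∑ j ∈ s, b j ^ 2 ≤ (∑ j ∈ s, b j) ^ 2 :=
    Finset.sum_sq_le_sq_sum_of_nonneg fun j _ => hb j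
  have h6 : 0 ≤ ∏ i ∈ s, (1 + b i) := Finset.prod_nonneg fun i _ => by linarith [hb i]
  set e := ∑ j ∈ s, b j
  set P := ∑ j ∈ s, b j ^ 2
  rcases le_total (e + P - e ^ 2) 0 with h | h
  · nlinarith
  · nlinarith [mul_le_mul_of_nonneg_right h4 h]

/-- Each summand equals `1 - d j / (1 - g j)`, with `d j = ∑ k b i r j i` and `g j` the
complementary weighted sum. Cauchy–Schwarz bounds `∑ d/(1 - g)` below by `(∑ d)² / ∑ d(1 - g)`; the
column sums fix the numerator, and the diagonal part of `d j * g j` controls the denominator. -/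
theorem sum_leave_one_out_le {ι : Type*} {p k : ℕ} (hp : 1 ≤ p) (hpk : p ≤ k) {s : Finset ι}
    (hs : s.card = k + 1) {r : ι → Fin p → ℝ} {b : Fin p → ℝ} (hb : ∀ i, 0 < b i)
    (hkb : ∀ i, k * b i < 1) (hr : ∀ j i, 0 ≤ r j i) (hcol : ∀ i, ∑ j ∈ s, r j i = 1)
    (hrow' : ∀ j ∈ s, ∑ i, (1 - k * b i) * r j i < 1) :
    ∑ j ∈ s, (1 - ∑ i, r j i) / (1 - ∑ i, (1 - k * b i) * r j i) ≤
      (k + 1) * (∏ i, (1 + b i))⁻¹ := by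
  have hk0 : (0 : ℝ) < k := by exact_mod_cast (by omega : 0 < k)
  have : Nonempty (Fin p) := ⟨⟨0, hp⟩⟩
  set e := ∑ i, b i with he
  set P := ∑ i, b i ^ 2 with hP
  have he0 : 0 < e := Finset.sum_pos (fun i _ => hb i) Finset.univ_nonempty
  have hP0 : 0 ≤ P := Finset.sum_nonneg fun i _ => sq_nonneg _
  -- This is where `p ≤ k` matters: each `k * b i` is below `1`, so `k * e ≤ p ≤ k`.
  have he1 : e ≤ 1 := by
    have h1 : k * e ≤ p := by
      rw [he, Finset.mul_sum]
      simpa using Finset.sum_le_sum fun i (_ : i ∈ Finset.univ) => (hkb i).le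
    have h2 : (p : ℝ) ≤ k := by exact_mod_cast hpk
    nlinarith
  set g : ι → ℝ := fun j => ∑ i, (1 - k * b i) * r j i with hg
  set d : ι → ℝ := fun j => ∑ i, k * b i * r j i with hd
  have hsum : ∀ j, ∑ i, r j i = d j + g j := fun j => by
    rw [hd, hg, ← Finset.sum_add_distrib]
    exact Finset.sum_congr rfl fun i _ => by ring
  have hd0 : ∀ j, 0 ≤ d j := fun j => Finset.sum_nonneg fun i _ =>
    mul_nonneg (mul_nonneg hk0.le (hb i).le) (hr j i)
  have hS : ∑ j ∈ s, d j = k * e := by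
    rw [hd, Finset.sum_comm, he, Finset.mul_sum]
    refine Finset.sum_congr rfl fun i _ => ?_
    rw [← Finset.mul_sum, hcol, mul_one]
  have hdiag : ∀ j, ∑ i, k * b i * (1 - k * b i) * r j i ^ 2 ≤ d j * g j := fun j => by
    rw [hd, hg, Finset.sum_mul_sum]
    refine Finset.sum_le_sum fun i _ => ?_
    have h1 : ∀ l ∈ Finset.univ, 0 ≤ k * b i * r j i * ((1 - k * b l) * r j l) := fun l _ =>
      mul_nonneg (mul_nonneg (mul_nonneg hk0.le (hb i).le) (hr j i))
        (mul_nonneg (by linarith [hkb l]) (hr j l))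
    refine le_trans (le_of_eq ?_) (Finset.single_le_sum h1 (Finset.mem_univ i))
    ring
  have hsq : ∀ i, 1 ≤ (k + 1) * ∑ j ∈ s, r j i ^ 2 := fun i => by
    have := sq_sum_le_card_mul_sum_sq (s := s) (f := fun j => r j i)
    rw [hcol, hs] at this
    push_cast at this
    linarith
  -- Keep only the diagonal terms of `d j * g j` and use that each column of `r` sums to `1` over `k
  -- + 1` rows, so its sum of squares is at least `1/(k + 1)`.
  have hT : (k + 1) * ∑ j ∈ s, d j * (1 - g j) ≤ k ^ 2 * (e + P) := by
    have h1 : ∑ i, k * b i * (1 - k * b i) ≤ (k + 1) * ∑ j ∈ s, d j * g j := by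
      calc ∑ i, k * b i * (1 - k * b i)
          ≤ ∑ i, k * b i * (1 - k * b i) * ((k + 1) * ∑ j ∈ s, r j i ^ 2) :=
            Finset.sum_le_sum fun i _ => le_mul_of_one_le_right
              (mul_nonneg (mul_nonneg hk0.le (hb i).le) (by linarith [hkb i])) (hsq i)
        _ = (k + 1) * ∑ j ∈ s, ∑ i, k * b i * (1 - k * b i) * r j i ^ 2 := by
            rw [Finset.sum_comm, Finset.mul_sum]
            refine Finset.sum_congr rfl fun i _ => ?_
            rw [← Finset.mul_sum]; ring
        _ ≤ _ := by gcongr with j; exact hdiag j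
    have h2 : ∑ i, k * b i * (1 - k * b i) = k * e - k ^ 2 * P := by
      rw [he, hP, Finset.mul_sum, Finset.mul_sum, ← Finset.sum_sub_distrib]
      exact Finset.sum_congr rfl fun i _ => by ring
    have h3 : ∑ j ∈ s, d j * (1 - g j) = k * e - ∑ j ∈ s, d j * g j := by
      rw [← hS, ← Finset.sum_sub_distrib]
      exact Finset.sum_congr rfl fun i _ => by ring
    rw [h3]
    nlinarith
  have heP : 0 < e + P := by linarith
  -- This is `∑ d` divided by the upper bound for `∑ d(1 - g)` from `hT`: the optimal parameter in
  -- `1/y ≥ 2θ - θ²y`, which gives the Cauchy–Schwarz bound termwise.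
  set θ := (k + 1) * e / (k * (e + P)) with hθ
  have hpt : ∀ j ∈ s, (1 - ∑ i, r j i) / (1 - g j) ≤ 1 - (2 * θ * d j - θ ^ 2 * (d j * (1 - g j))) := by
    intro j hj
    have hgj : 0 < 1 - g j := by linarith [hrow' j hj]
    rw [hsum j, div_le_iff₀ hgj]
    nlinarith [mul_nonneg (hd0 j) (sq_nonneg (1 - θ * (1 - g j)))]
  have hmain : ∑ j ∈ s, (1 - ∑ i, r j i) / (1 - g j) ≤ (k + 1) - (k + 1) * e ^ 2 / (e + P) := by
    refine (Finset.sum_le_sum hpt).trans ?_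
    rw [Finset.sum_sub_distrib, Finset.sum_sub_distrib, ← Finset.mul_sum, ← Finset.mul_sum, hS]
    simp only [Finset.sum_const, hs, nsmul_eq_mul, mul_one]
    push_cast
    have h1 : θ ^ 2 * ∑ j ∈ s, d j * (1 - g j) ≤ θ ^ 2 * (k ^ 2 * (e + P) / (k + 1)) := by
      refine mul_le_mul_of_nonneg_left ?_ (sq_nonneg θ)
      rw [le_div_iff₀ (by positivity)]; linarith
    have h2 : θ ^ 2 * (k ^ 2 * (e + P) / (k + 1)) = (k + 1) * e ^ 2 / (e + P) := by
      rw [hθ]; field_simp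
    have h3 : 2 * θ * (k * e) = 2 * ((k + 1) * e ^ 2 / (e + P)) := by
      rw [hθ]; field_simp
    linarith
  refine hmain.trans ?_
  have hprod := prod_one_add_mul_le Finset.univ (fun i => (hb i).le) he1
  have hprod0 : 0 < ∏ i, (1 + b i) := Finset.prod_pos fun i _ => by linarith [hb i]
  rw [← div_eq_mul_inv, le_div_iff₀ hprod0]
  have h4 : (k + 1 : ℝ) - (k + 1) * e ^ 2 / (e + P) = (k + 1) * ((e + P - e ^ 2) / (e + P)) := by
    field_simp
  rw [h4, mul_assoc]
  refine mul_le_of_le_one_right (by positivity) ?_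
  rw [div_mul_eq_mul_div, div_le_one heP, mul_comm]
  exact hprod

/-! ### Determinants of Gram matrices -/

/-- The shrinkage factor `det M / det (M + c)`. -/
def shrink {p : ℕ} (c : ℝ) (M : Matrix (Fin p) (Fin p) ℝ) : ℝ := M.det / (M + c • 1).det

/-- The Gram matrix of the rows of `x` with index in `s`. -/
def gram {n p : ℕ} (s : Finset (Fin n)) (x : Fin n → Fin p → ℝ) : Matrix (Fin p) (Fin p) ℝ :=
  ∑ i ∈ s, vecMulVec (x i) (x i)

variable {n p : ℕ}

theorem gram_posSemidef (s : Finset (Fin n)) (x : Fin n → Fin p → ℝ) : (gram s x).PosSemidef := by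
  refine posSemidef_sum _ fun i _ => ?_
  simpa using posSemidef_vecMulVec_self_star (x i)

theorem gram_apply (s : Finset (Fin n)) (x : Fin n → Fin p → ℝ) (k l : Fin p) :
    gram s x k l = ∑ i ∈ s, x i k * x i l := by
  simp [gram, Matrix.sum_apply, vecMulVec_apply]

theorem PosSemidef.posDef_add_smul {M : Matrix (Fin p) (Fin p) ℝ} (hM : M.PosSemidef) {c : ℝ}
    (hc : 0 < c) : (M + c • 1).PosDef :=
  PosDef.posSemidef_add hM (PosDef.one.smul hc)

theorem gram_conj (s : Finset (Fin n)) (x : Fin n → Fin p → ℝ) (V : Matrix (Fin p) (Fin p) ℝ) :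
    gram s (fun i => Vᵀ *ᵥ x i) = Vᵀ * gram s x * V := by
  simp only [gram, Matrix.mul_sum, Matrix.sum_mul]
  refine Finset.sum_congr rfl fun i _ => ?_
  rw [mul_vecMulVec, vecMulVec_mul, mulVec_transpose]

theorem shrink_conj {V : Matrix (Fin p) (Fin p) ℝ} (hV : Vᵀ * V = 1) (c : ℝ)
    (M : Matrix (Fin p) (Fin p) ℝ) : shrink c (Vᵀ * M * V) = shrink c M := by
  have hdet : V.det * V.det = 1 := by
    have := congrArg det hV
    rwa [det_mul, det_transpose, det_one] at this
  have h1 : Vᵀ * M * V + c • 1 = Vᵀ * (M + c • 1) * V := by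
    rw [Matrix.mul_add, Matrix.add_mul, Matrix.mul_smul, Matrix.smul_mul, Matrix.mul_one, hV]
  have h2 : ∀ N : Matrix (Fin p) (Fin p) ℝ, (Vᵀ * N * V).det = N.det := fun N => by
    rw [det_mul, det_mul, det_transpose, mul_right_comm, hdet, one_mul]
  rw [shrink, shrink, h1, h2, h2]

theorem shrink_diagonal (c : ℝ) (m : Fin p → ℝ) :
    shrink c (diagonal m) = ∏ i, m i / (m i + c) := by
  have h : diagonal m + c • (1 : Matrix (Fin p) (Fin p) ℝ) = diagonal fun i => m i + c := by
    rw [← diagonal_one, ← diagonal_smul, diagonal_add]; simp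
  rw [shrink, h, det_diagonal, det_diagonal, Finset.prod_div_distrib]

theorem PosSemidef.exists_diagonal {M : Matrix (Fin p) (Fin p) ℝ} (hM : M.PosSemidef) :
    ∃ (V : Matrix (Fin p) (Fin p) ℝ) (m : Fin p → ℝ), Vᵀ * V = 1 ∧ Vᵀ * M * V = diagonal m ∧
      ∀ i, 0 ≤ m i := by
  obtain ⟨V, m, h1, -, h3⟩ := exists_orthogonal_diagonalization hM.1
  refine ⟨V, m, h1, h3, fun i => ?_⟩
  have := PosSemidef.transpose_mul_mul hM V
  rw [h3, posSemidef_diagonal_iff] at this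
  exact this i

theorem shrink_bounds {M : Matrix (Fin p) (Fin p) ℝ} (hM : M.PosSemidef) {c : ℝ} (hc : 0 < c) :
    0 ≤ shrink c M ∧ shrink c M ≤ 1 := by
  obtain ⟨V, m, hV, hd, hm⟩ := PosSemidef.exists_diagonal hM
  rw [← shrink_conj hV, hd, shrink_diagonal]
  have h : ∀ i, 0 ≤ m i / (m i + c) ∧ m i / (m i + c) ≤ 1 := fun i => by
    have := hm i
    exact ⟨by positivity, (div_le_one (by linarith)).2 (by linarith)⟩
  exact ⟨Finset.prod_nonneg fun i _ => (h i).1, Finset.prod_le_one (fun i _ => (h i).1)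
    fun i _ => (h i).2⟩

theorem shrink_anti {M : Matrix (Fin p) (Fin p) ℝ} (hM : M.PosSemidef) {c c' : ℝ} (hc : 0 < c)
    (hcc : c ≤ c') : shrink c' M ≤ shrink c M := by
  obtain ⟨V, m, hV, hd, hm⟩ := PosSemidef.exists_diagonal hM
  rw [← shrink_conj hV, ← shrink_conj hV (c := c), hd, shrink_diagonal, shrink_diagonal]
  refine Finset.prod_le_prod (fun i _ => ?_) fun i _ => ?_
  · have := hm i
    have : 0 < c' := hc.trans_le hcc
    positivity
  · have := hm i
    gcongr

theorem det_diagonal_sub_vecMulVec {m : Fin p → ℝ} (hm : ∀ i, 0 < m i) (y : Fin p → ℝ) :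
    (diagonal m - vecMulVec y y).det = (∏ i, m i) * (1 - ∑ i, y i ^ 2 / m i) := by
  have hu : IsUnit (diagonal m).det := by
    rw [det_diagonal]
    exact isUnit_iff_ne_zero.2 (Finset.prod_ne_zero_iff.2 fun i _ => (hm i).ne')
  have hinv : (diagonal m)⁻¹ = diagonal fun i => (m i)⁻¹ := by
    apply inv_eq_left_inv
    rw [diagonal_mul_diagonal, ← diagonal_one]
    congr 1; ext i; exact inv_mul_cancel₀ (hm i).ne'
  have h1 : diagonal m - vecMulVec y y =
      diagonal m + (replicateCol Unit (-y)) * (replicateRow Unit y) := by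
    rw [← vecMulVec_eq, neg_vecMulVec, sub_eq_add_neg]
  rw [h1, det_add_mul _ _ hu, det_diagonal, det_unique, hinv]
  congr 1
  rw [Matrix.add_apply, one_apply_eq, Matrix.mul_apply]
  simp only [mul_diagonal, replicateRow_apply, replicateCol_apply, Pi.neg_apply]
  rw [sub_eq_add_neg, ← Finset.sum_neg_distrib]
  congr 1
  exact Finset.sum_congr rfl fun i _ => by rw [div_eq_mul_inv]; ring

/-- Removing one row at a time decreases the average shrinkage factor. -/
theorem sum_shrink_erase_le {k : ℕ} (hp : 1 ≤ p) (hpk : p ≤ k) {s : Finset (Fin n)}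
    (hs : s.card = k + 1) (x : Fin n → Fin p → ℝ) {c : ℝ} (hc : 0 < c) :
    ∑ j ∈ s, shrink (c * k) (gram (s.erase j) x) ≤
      (k + 1) * shrink (c * ((k + 1 : ℕ) : ℝ)) (gram s x) := by
  have hk0 : (0 : ℝ) < k := by exact_mod_cast (by omega : 0 < k)
  have hck : 0 < c * k := mul_pos hc hk0
  have hadd : ∀ (z : Fin n → Fin p → ℝ) (j), j ∈ s →
      gram (s.erase j) z = gram s z - vecMulVec (z j) (z j) := fun z j hj => by
    rw [gram, gram, ← Finset.add_sum_erase s _ hj]; simp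
  obtain ⟨V, m, hV, hd, hm⟩ := PosSemidef.exists_diagonal (gram_posSemidef s x)
  set y : Fin n → Fin p → ℝ := fun i => Vᵀ *ᵥ x i with hy
  have hgy : gram s y = diagonal m := by rw [hy, gram_conj, hd]
  have hre : ∀ (t : Finset (Fin n)) (c' : ℝ), shrink c' (gram t x) = shrink c' (gram t y) :=
    fun t c' => by rw [hy, gram_conj, shrink_conj hV]
  simp only [hre, hgy]
  by_cases hpos : ∀ i, 0 < m i
  -- In the eigenbasis of the full Gram matrix, `r j i` is the share of row `j` in the `i`-th
  -- eigenvalue. With this `b`, `m i / (m i + ck) = 1 - k b i`, and `1 + b i` is the factor that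
  -- changes `ck` into `c(k + 1)`.
  · set b : Fin p → ℝ := fun i => c / (m i + c * k) with hb
    set r : Fin n → Fin p → ℝ := fun j i => y j i ^ 2 / m i with hr
    have hb0 : ∀ i, 0 < b i := fun i => div_pos hc (by linarith [hpos i])
    have hden : ∀ i, 0 < m i + c * k := fun i => by linarith [hpos i]
    have hkb' : ∀ i, 1 - k * b i = m i / (m i + c * k) := fun i => by
      have := (hden i).ne'
      simp only [hb]; rw [eq_div_iff this, sub_mul, one_mul, mul_assoc, div_mul_cancel₀ _ this]; ring
    have hkb : ∀ i, k * b i < 1 := fun i => by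
      have h1 : 0 < m i / (m i + c * k) := div_pos (hpos i) (hden i)
      rw [← hkb'] at h1; linarith
    have hcol : ∀ i, ∑ j ∈ s, r j i = 1 := fun i => by
      have h1 := congrFun (congrFun hgy i) i
      rw [gram_apply, diagonal_apply_eq] at h1
      rw [hr, ← Finset.sum_div, div_eq_one_iff_eq (hpos i).ne', ← h1]
      exact Finset.sum_congr rfl fun j _ => sq _
    have hprodm : 0 < ∏ i, m i := Finset.prod_pos fun i _ => hpos i
    have hprodc : 0 < ∏ i, (m i + c * k) := Finset.prod_pos fun i _ => hden i
    have hdet1 : ∀ j ∈ s, (gram (s.erase j) y).det = (∏ i, m i) * (1 - ∑ i, r j i) :=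
      fun j hj => by rw [hadd y j hj, hgy, det_diagonal_sub_vecMulVec hpos]
    have hdet2 : ∀ j ∈ s, (gram (s.erase j) y + (c * k) • 1).det =
        (∏ i, (m i + c * k)) * (1 - ∑ i, (1 - k * b i) * r j i) := fun j hj => by
      have h1 : gram (s.erase j) y + (c * k) • (1 : Matrix (Fin p) (Fin p) ℝ) =
          diagonal (fun i => m i + c * k) - vecMulVec (y j) (y j) := by
        rw [hadd y j hj, hgy, sub_add_eq_add_sub, ← diagonal_one, ← diagonal_smul, diagonal_add]
        simp
      rw [h1, det_diagonal_sub_vecMulVec hden]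
      congr 2
      refine Finset.sum_congr rfl fun i _ => ?_
      have := (hden i).ne'
      have := (hpos i).ne'
      rw [hkb', hr]; field_simp
    have hrow' : ∀ j ∈ s, ∑ i, (1 - k * b i) * r j i < 1 := fun j hj => by
      have h1 := (PosSemidef.posDef_add_smul (gram_posSemidef (s.erase j) y) hck).det_pos
      rw [hdet2 j hj] at h1
      linarith [(mul_pos_iff_of_pos_left hprodc).1 h1]
    have key := sum_leave_one_out_le hp hpk hs hb0 hkb
      (fun j i => div_nonneg (sq_nonneg _) (hpos i).le) hcol hrow'
    have hq0 : 0 < (∏ i, m i) / ∏ i, (m i + c * k) := div_pos hprodm hprodc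
    calc ∑ j ∈ s, shrink (c * k) (gram (s.erase j) y)
        = ((∏ i, m i) / ∏ i, (m i + c * k)) *
          ∑ j ∈ s, (1 - ∑ i, r j i) / (1 - ∑ i, (1 - k * b i) * r j i) := by
          rw [Finset.mul_sum]
          refine Finset.sum_congr rfl fun j hj => ?_
          rw [shrink, hdet1 j hj, hdet2 j hj, mul_div_mul_comm]
      _ ≤ ((∏ i, m i) / ∏ i, (m i + c * k)) * ((k + 1) * (∏ i, (1 + b i))⁻¹) :=
          mul_le_mul_of_nonneg_left key hq0.le
      _ = (k + 1) * shrink (c * ((k + 1 : ℕ) : ℝ)) (diagonal m) := by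
          rw [shrink_diagonal, mul_left_comm, ← Finset.prod_div_distrib, ← Finset.prod_inv_distrib,
            ← Finset.prod_mul_distrib]
          congr 1
          refine Finset.prod_congr rfl fun i _ => ?_
          have h1 := (hden i).ne'
          have h2 : 1 + b i = (m i + c * ((k + 1 : ℕ) : ℝ)) / (m i + c * k) := by
            rw [hb]; push_cast; field_simp; ring
          have h3 : m i + c * ((k + 1 : ℕ) : ℝ) ≠ 0 := by
            have := hpos i
            positivity
          rw [h2]; field_simp
  -- If the full Gram matrix is singular, so is each one with a row removed, and the left side
  -- vanishes.
  · push Not at hpos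
    obtain ⟨i₀, hi₀⟩ := hpos
    have hz : ∀ j ∈ s, shrink (c * k) (gram (s.erase j) y) = 0 := fun j hj => by
      have h1 : (gram (s.erase j) y).det = 0 := by
        by_contra h
        have h2 := ((gram_posSemidef (s.erase j) y).posDef_iff_det_ne_zero.2 h)
        have h3 : (vecMulVec (y j) (y j)).PosSemidef := by
          simpa using posSemidef_vecMulVec_self_star (y j)
        have h4 := h2.add_posSemidef h3
        rw [hadd y j hj, sub_add_cancel, hgy, posDef_diagonal_iff] at h4
        exact absurd (h4 i₀) (not_lt.2 hi₀)
      rw [shrink, h1, zero_div]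
    rw [Finset.sum_eq_zero hz]
    exact mul_nonneg (by positivity)
      (shrink_bounds (by rw [← hgy]; exact gram_posSemidef s y) (by positivity)).1

/-- Convexity of the reciprocal determinant at a positive definite matrix. -/
theorem inv_det_ge_tangent {M N : Matrix (Fin p) (Fin p) ℝ} (hM : M.PosDef) (hN : N.PosDef) :
    (M.det)⁻¹ * (1 - (M⁻¹ * (N - M)).trace) ≤ (N.det)⁻¹ := by
  obtain ⟨C, t, hC, h1, h2⟩ := exists_simultaneous_diagonalization hM hN.1
  have hCT : IsUnit Cᵀ.det := by rwa [det_transpose]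
  have hinj : Function.Injective C.mulVec := mulVec_injective_of_isUnit
    ((Matrix.isUnit_iff_isUnit_det C).2 hC)
  have ht : ∀ i, 0 < t i := by
    have h3 : (diagonal t).PosDef := by
      rw [← h2]
      simpa [conjTranspose_eq_transpose_of_trivial] using hN.conjTranspose_mul_mul_same hinj
    simpa using h3
  have hMinv : M⁻¹ = C * Cᵀ := by
    refine inv_eq_left_inv ?_
    rw [Matrix.mul_assoc]
    refine mul_eq_one_comm.1 ?_
    rw [← h1]
  have htr : (M⁻¹ * (N - M)).trace = ∑ i, t i - p := by
    rw [hMinv, Matrix.mul_assoc, trace_mul_comm, Matrix.mul_sub, Matrix.sub_mul, h1, h2, trace_sub,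
      trace_diagonal, trace_one]
    simp
  have hd1 : C.det ^ 2 * M.det = 1 := by
    have := congrArg det h1
    rw [det_mul, det_mul, det_transpose, det_one] at this
    linarith
  have hd2 : C.det ^ 2 * N.det = ∏ i, t i := by
    have := congrArg det h2
    rw [det_mul, det_mul, det_transpose, det_diagonal] at this
    linarith
  have hprod : 0 < ∏ i, t i := Finset.prod_pos fun i _ => ht i
  -- After whitening, the claim is the scalar chain `1/∏ t i ≥ exp(-∑ (t i - 1)) ≥ 1 - ∑ (t i - 1)`.
  have hle : ∏ i, t i ≤ Real.exp (∑ i, t i - p) := by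
    have h4 : Real.exp (∑ i, t i - p) = ∏ i, Real.exp (t i - 1) := by
      rw [← Real.exp_sum, Finset.sum_sub_distrib]; simp
    rw [h4]
    exact Finset.prod_le_prod (fun i _ => (ht i).le) fun i _ => by
      have := Real.add_one_le_exp (t i - 1); linarith
  have hc2 : C.det ^ 2 ≠ 0 := pow_ne_zero _ hC.ne_zero
  have e1 : (M.det)⁻¹ = C.det ^ 2 := inv_eq_of_mul_eq_one_left hd1
  have e2 : (N.det)⁻¹ = C.det ^ 2 * (∏ i, t i)⁻¹ := by
    rw [← hd2, mul_inv, mul_inv_cancel_left₀ hc2]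
  rw [e1, e2, htr]
  refine mul_le_mul_of_nonneg_left ?_ (sq_nonneg _)
  have h5 : Real.exp (-(∑ i, t i - p)) ≤ (∏ i, t i)⁻¹ := by
    rw [Real.exp_neg]; exact inv_anti₀ hprod hle
  have h6 := Real.add_one_le_exp (-(∑ i, t i - (p : ℝ)))
  linarith

/-- For `w` the `l`-th column of the inverse, `c‖w‖² ≤ wᵀ(M + c)w = w l`, which forces `‖w‖ ≤ 1/c`.
The bound supplies integrability of the tangent coefficients. -/
theorem abs_inv_apply_le {M : Matrix (Fin p) (Fin p) ℝ} (hM : M.PosSemidef) {c : ℝ} (hc : 0 < c)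
    (k l : Fin p) : |(M + c • 1)⁻¹ k l| ≤ c⁻¹ := by
  have hN := PosSemidef.posDef_add_smul hM hc
  have hu : IsUnit (M + c • 1).det := isUnit_iff_ne_zero.2 hN.det_pos.ne'
  set w := (M + c • 1)⁻¹ *ᵥ Pi.single l 1 with hw
  have hwk : ∀ i, (M + c • 1)⁻¹ i l = w i := fun i => by rw [hw]; simp
  have h1 : (M + c • 1) *ᵥ w = Pi.single l 1 := by
    rw [hw, mulVec_mulVec, mul_nonsing_inv _ hu, one_mulVec]
  have h2 : w ⬝ᵥ ((M + c • 1) *ᵥ w) = w l := by rw [h1]; simp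
  have h3 : w ⬝ᵥ ((M + c • 1) *ᵥ w) = w ⬝ᵥ (M *ᵥ w) + c * ∑ i, w i ^ 2 := by
    rw [add_mulVec, dotProduct_add, smul_mulVec, one_mulVec, dotProduct_smul, smul_eq_mul]
    simp [dotProduct, sq]
  have h4 : 0 ≤ w ⬝ᵥ (M *ᵥ w) := hM.dotProduct_mulVec_nonneg w
  have h5 : ∀ i, c * w i ^ 2 ≤ w l := fun i => by
    have := Finset.single_le_sum (f := fun i => w i ^ 2) (fun j _ => sq_nonneg _)
      (Finset.mem_univ i)
    nlinarith
  have h6 : c * w l ≤ 1 := by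
    by_contra! h
    have h7 := h5 l
    have h8 : 0 < w l := by
      by_contra! h9
      nlinarith
    nlinarith
  rw [hwk, ← one_div, le_div_iff₀ hc]
  have h8 : (|w k| * c) ^ 2 ≤ 1 := by
    rw [mul_pow, sq_abs]
    nlinarith [h5 k]
  exact le_of_sq_le_sq (by simpa using h8) zero_le_one

end

section

/-! ### The initial potential -/

variable {n p q : ℕ}

theorem measurable_gram (s : Finset (Fin n)) :
    Measurable (gram (p := p) s) := by
  refine measurable_pi_iff.2 fun k => measurable_pi_iff.2 fun l => ?_
  simp only [gram_apply]
  have h : ∀ (i : Fin n) (k : Fin p), Measurable fun x : Fin n → Fin p → ℝ => x i k := fun i k =>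
    (measurable_pi_apply k).comp (measurable_pi_apply i)
  exact Finset.measurable_sum _ fun i _ => (h i k).mul (h i l)

theorem measurable_shrink (c : ℝ) :
    Measurable (shrink c : Matrix (Fin p) (Fin p) ℝ → ℝ) := by
  have h1 : Measurable fun M : Matrix (Fin p) (Fin p) ℝ => M.det :=
    continuous_id.matrix_det.measurable
  have h2 : Measurable fun M : Matrix (Fin p) (Fin p) ℝ => (M + c • 1).det :=
    (continuous_id.add continuous_const).matrix_det.measurable
  exact h1.div h2

theorem integrable_shrink_gram (s : Finset (Fin n)) {c : ℝ} (hc : 0 < c) :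
    Integrable (fun x => shrink c (gram s x)) (gaussRows n p) :=
  Integrable.of_bound ((measurable_shrink c).comp (measurable_gram s)).aestronglyMeasurable 1
    (.of_forall fun x => by
      obtain ⟨h0, h1⟩ := shrink_bounds (gram_posSemidef s x) hc
      rwa [Real.norm_of_nonneg h0])

theorem integral_shrink_gram_eq {k : ℕ} {s : Finset (Fin n)} (hs : s.card = k) (c : ℝ) :
    ∫ x, shrink c (gram s x) ∂gaussRows n p =
      ∫ x, shrink c (gram Finset.univ x) ∂gaussRows k p := by
  have hg : ∀ x : Fin n → Fin p → ℝ,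
      gram s x = gram Finset.univ fun i => x (s.orderEmbOfFin hs i) := fun x => by
    rw [gram, gram]
    conv_lhs => rw [← Finset.map_orderEmbOfFin_univ s hs]
    rw [Finset.sum_map]
    rfl
  have hm : Measurable fun (x : Fin n → Fin p → ℝ) (i : Fin k) => x (s.orderEmbOfFin hs i) :=
    measurable_pi_iff.2 fun i => measurable_pi_apply _
  have hf : Measurable fun x : Fin k → Fin p → ℝ => shrink c (gram Finset.univ x) :=
    (measurable_shrink c).comp (measurable_gram _)
  rw [← gaussRows_map_comp (s.orderEmbOfFin hs).injective, integral_map hm.aemeasurable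
    hf.aestronglyMeasurable]
  simp only [hg]

/-- Gaussian rows are exchangeable, so all deletions of one row have the same mean; averaging the
leave-one-out inequality lowers `k` by one, down to `p`. -/
theorem integral_shrink_gram_ge {k : ℕ} (hp : 1 ≤ p) (hpk : p ≤ k) {c : ℝ} (hc : 0 < c)
    {s : Finset (Fin n)} (hs : s.card = k) :
    ∫ x, shrink (c * p) (gram Finset.univ x) ∂gaussRows p p ≤
      ∫ x, shrink (c * k) (gram s x) ∂gaussRows n p := by
  induction k, hpk using Nat.le_induction generalizing s with
  | base => rw [integral_shrink_gram_eq hs]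
  | succ k hpk ih =>
    have hk0 : (0 : ℝ) < k := by exact_mod_cast (by omega : 0 < k)
    have hint : ∀ j ∈ s, Integrable (fun x => shrink (c * k) (gram (s.erase j) x))
        (gaussRows n p) := fun j _ => integrable_shrink_gram _ (by positivity)
    have h1 := integral_mono (integrable_finsetSum s hint)
      ((integrable_shrink_gram (n := n) (p := p) s
        (c := c * ((k + 1 : ℕ) : ℝ)) (by positivity)).const_mul ((k : ℝ) + 1))
      fun x => sum_shrink_erase_le hp hpk hs x hc
    rw [integral_finsetSum s hint, integral_const_mul] at h1
    have h2 := Finset.card_nsmul_le_sum s _ _ fun j hj =>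
      ih (s := s.erase j) (by rw [Finset.card_erase_of_mem hj, hs]; rfl)
    rw [hs, nsmul_eq_mul] at h2
    push_cast at h2 h1 ⊢
    have h3 := h2.trans h1
    exact le_of_mul_le_mul_left h3 (by positivity)

theorem transpose_mul_diagonal_mul (x : Fin n → Fin p → ℝ) (s : Finset (Fin n)) :
    (of x)ᵀ * diagonal (fun i => if i ∈ s then (1 : ℝ) else 0) * of x = gram s x := by
  ext k l
  rw [Matrix.mul_apply, gram_apply]
  simp [mul_diagonal, ite_mul]

theorem transpose_mul_blend_mul (x : Fin n → Fin p → ℝ) (s : Finset (Fin n)) (a : ℝ) :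
    (of x)ᵀ * blend (diagonal fun i => if i ∈ s then (1 : ℝ) else 0) a * of x =
      gram s x + a • gram sᶜ x := by
  have h : (1 : Matrix (Fin n) (Fin n) ℝ) - diagonal (fun i => if i ∈ s then (1 : ℝ) else 0) =
      diagonal fun i => if i ∈ sᶜ then (1 : ℝ) else 0 := by
    rw [← diagonal_one, diagonal_sub]
    congr 1; ext i; by_cases hi : i ∈ s <;> simp [hi]
  rw [blend, h, Matrix.mul_add, Matrix.add_mul, Matrix.mul_smul, Matrix.smul_mul,
    transpose_mul_diagonal_mul, transpose_mul_diagonal_mul]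

theorem isProj_diagonal (s : Finset (Fin n)) :
    IsProj (diagonal fun i => if i ∈ s then (1 : ℝ) else 0) where
  symm := diagonal_transpose _
  idem := by
    rw [diagonal_mul_diagonal]
    congr 1; ext i; split_ifs <;> simp

theorem indepFun_gram (s : Finset (Fin n)) :
    IndepFun (gram s) (gram sᶜ) (gaussRows n p) := by
  have h : iIndepFun (fun (i : Fin n) (x : Fin n → Fin p → ℝ) => x i) (gaussRows n p) :=
    iIndepFun_pi (X := fun _ => id) fun _ => aemeasurable_id
  have h2 := h.indepFun_finset s sᶜ disjoint_compl_right fun i => measurable_pi_apply i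
  have hm : ∀ t : Finset (Fin n), Measurable fun y : t → Fin p → ℝ =>
      (∑ i, vecMulVec (y i) (y i) : Matrix (Fin p) (Fin p) ℝ) := fun t => by
    refine measurable_pi_iff.2 fun k => measurable_pi_iff.2 fun l => ?_
    simp only [Matrix.sum_apply, vecMulVec_apply]
    have h : ∀ (i : t) (k : Fin p), Measurable fun x : t → Fin p → ℝ => x i k := fun i k =>
      (measurable_pi_apply k).comp (measurable_pi_apply i)
    exact Finset.measurable_sum _ fun i _ => (h i k).mul (h i l)
  have h3 := h2.comp (hm s) (hm sᶜ)
  have hg : ∀ t : Finset (Fin n), (gram (p := p) t) =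
      (fun y : t → Fin p → ℝ => (∑ i, vecMulVec (y i) (y i) : Matrix (Fin p) (Fin p) ℝ)) ∘
        fun (x : Fin n → Fin p → ℝ) (i : t) => x i := fun t => by
    ext1 x
    exact (Finset.sum_coe_sort t fun i => vecMulVec (x i) (x i)).symm
  rw [hg s, hg sᶜ]
  exact h3

theorem integral_gram_apply (s : Finset (Fin n)) (k l : Fin p) :
    Integrable (fun x => gram s x k l) (gaussRows n p) ∧
      ∫ x, gram s x k l ∂gaussRows n p = if k = l then (s.card : ℝ) else 0 := by
  simp only [gram_apply]
  have h : ∀ i ∈ s, Integrable (fun x : Fin n → Fin p → ℝ => x i k * x i l) (gaussRows n p) :=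
    fun i _ => (integrable_gaussRows_mul i k l).1
  refine ⟨integrable_finsetSum s h, ?_⟩
  rw [integral_finsetSum s h, Finset.sum_congr rfl fun i _ => (integrable_gaussRows_mul i k l).2]
  split_ifs <;> simp

/-- Tangent inequality for `1/det` at `M + κ`, evaluated at `M + aH`. The trace is expanded into
entries so that each correction is a function of `M` times a function of `H`. -/
theorem ratio_diagonal_ge {s : Finset (Fin n)} {a κ : ℝ} (ha : 0 < a) (hκ : 0 < κ)
    (x : Fin n → Fin p → ℝ) :
    shrink κ (gram s x) - ∑ k, ∑ l, shrink κ (gram s x) * (gram s x + κ • 1)⁻¹ k l *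
        (a * gram sᶜ x l k - if l = k then κ else 0) ≤
      ratio (diagonal fun i => if i ∈ s then (1 : ℝ) else 0) a (of x) := by
  have hM := gram_posSemidef s x
  rw [ratio, transpose_mul_diagonal_mul, transpose_mul_blend_mul]
  by_cases h0 : (gram s x).det = 0
  · simp [shrink, h0]
  have hN : (gram s x + a • gram sᶜ x).PosDef :=
    (hM.posDef_iff_det_ne_zero.2 h0).add_posSemidef ((gram_posSemidef sᶜ x).smul ha.le)
  have h1 := inv_det_ge_tangent (PosSemidef.posDef_add_smul hM hκ) hN
  have h2 := mul_le_mul_of_nonneg_left h1 hM.det_nonneg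
  rw [← div_eq_mul_inv] at h2
  refine le_trans (le_of_eq ?_) h2
  rw [← mul_assoc, ← div_eq_mul_inv, ← shrink, mul_sub, mul_one, add_sub_add_left_eq_sub]
  congr 1
  rw [trace, Finset.mul_sum]
  refine Finset.sum_congr rfl fun k _ => ?_
  rw [diag_apply, Matrix.mul_apply, Finset.mul_sum]
  refine Finset.sum_congr rfl fun l _ => ?_
  rw [Matrix.sub_apply, Matrix.smul_apply, Matrix.smul_apply, Matrix.one_apply]
  split_ifs <;> simp [mul_assoc]

/-- Jensen's inequality conditionally on `M`: since `H` is independent of `M` with mean `(n - q) •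
1`, the value `κ = a(n - q)` makes every first-order correction integrate to zero. -/
theorem integral_ratio_diagonal_ge {s : Finset (Fin n)} {a κ : ℝ} (ha : 0 < a) (hκ : 0 < κ)
    (hκa : κ = a * (sᶜ).card) :
    ∫ x, shrink κ (gram s x) ∂gaussRows n p ≤
      ∫ x, ratio (diagonal fun i => if i ∈ s then (1 : ℝ) else 0) a (of x) ∂gaussRows n p := by
  set φ : Fin p → Fin p → Matrix (Fin p) (Fin p) ℝ → ℝ := fun k l M =>
    shrink κ M * (M + κ • 1)⁻¹ k l with hφ
  set ψ : Fin p → Fin p → Matrix (Fin p) (Fin p) ℝ → ℝ := fun k l H =>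
    a * H l k - if l = k then κ else 0 with hψ
  have hφm : ∀ k l, Measurable (φ k l) := fun k l => by
    have h1 : Measurable fun M : Matrix (Fin p) (Fin p) ℝ => M + κ • 1 :=
      (continuous_id.add continuous_const).measurable
    have h2 : Measurable fun M : Matrix (Fin p) (Fin p) ℝ => (M + κ • 1)⁻¹ k l :=
      (measurable_entry k l).comp (measurable_inv.comp h1)
    exact (measurable_shrink κ).mul h2
  have hψm : ∀ k l, Measurable (ψ k l) := fun k l =>
    ((measurable_entry l k).const_mul a).sub_const _
  have hφi : ∀ k l, Integrable (fun x => φ k l (gram s x)) (gaussRows n p) := fun k l =>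
    Integrable.of_bound ((hφm k l).comp (measurable_gram s)).aestronglyMeasurable κ⁻¹
      (.of_forall fun x => by
        obtain ⟨h0, h1⟩ := shrink_bounds (gram_posSemidef s x) hκ
        rw [Real.norm_eq_abs, abs_mul, abs_of_nonneg h0]
        calc _ ≤ 1 * κ⁻¹ := mul_le_mul h1 (abs_inv_apply_le (gram_posSemidef s x) hκ k l)
              (abs_nonneg _) zero_le_one
          _ = κ⁻¹ := one_mul _)
  have hψi : ∀ k l, Integrable (fun x => ψ k l (gram sᶜ x)) (gaussRows n p) := fun k l =>
    ((integral_gram_apply sᶜ l k).1.const_mul a).sub (integrable_const _)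
  have hψ0 : ∀ k l, ∫ x, ψ k l (gram sᶜ x) ∂gaussRows n p = 0 := fun k l => by
    rw [hψ, integral_sub ((integral_gram_apply sᶜ l k).1.const_mul a) (integrable_const _),
      integral_const_mul, (integral_gram_apply sᶜ l k).2]
    split_ifs <;> simp [hκa]
  have hind : ∀ k l, IndepFun (fun x => φ k l (gram s x)) (fun x => ψ k l (gram sᶜ x))
      (gaussRows n p) := fun k l => (indepFun_gram s).comp (hφm k l) (hψm k l)
  have hprod : ∀ k l, Integrable (fun x => φ k l (gram s x) * ψ k l (gram sᶜ x))
      (gaussRows n p) := fun k l => (hind k l).integrable_mul (hφi k l) (hψi k l)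
  have hprod0 : ∀ k l, ∫ x, φ k l (gram s x) * ψ k l (gram sᶜ x) ∂gaussRows n p = 0 :=
    fun k l => by
      have := (hind k l).integral_fun_mul_eq_mul_integral (hφi k l).aestronglyMeasurable
        (hψi k l).aestronglyMeasurable
      rw [this, hψ0, mul_zero]
  have hsum : Integrable (fun x => ∑ k, ∑ l, φ k l (gram s x) * ψ k l (gram sᶜ x))
      (gaussRows n p) :=
    integrable_finsetSum _ fun k _ => integrable_finsetSum _ fun l _ => hprod k l
  have h := integral_mono ((integrable_shrink_gram s hκ).sub hsum)
    (integrable_ratio_comp (isProj_diagonal s) ha (measurable_of n p))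
    fun x => ratio_diagonal_ge ha hκ x
  refine le_trans (le_of_eq ?_) h
  have h0 : ∫ x, ∑ k, ∑ l, φ k l (gram s x) * ψ k l (gram sᶜ x) ∂gaussRows n p = 0 := by
    rw [integral_finsetSum _ fun k _ => integrable_finsetSum _ fun l _ => hprod k l]
    refine Finset.sum_eq_zero fun k _ => ?_
    rw [integral_finsetSum _ fun l _ => hprod k l]
    exact Finset.sum_eq_zero fun l _ => hprod0 k l
  have h1 := integral_sub (integrable_shrink_gram (n := n) (p := p) s hκ) hsum
  rw [h0, sub_zero] at h1
  exact h1.symm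

/-- The two integrands agree wherever `R` is invertible, hence almost surely; on singular `R` the
conventions for the inverse differ. -/
theorem integral_gaussianMatrix_eq (p : ℕ) {g : ℝ} :
    ∫ R : Matrix (Fin p) (Fin p) ℝ, (det (1 + g • (Rᵀ * R)⁻¹))⁻¹ ∂gaussianMatrix p =
      ∫ x, shrink g (gram Finset.univ x) ∂gaussRows p p := by
  have hgm : gaussianMatrix p = (gaussRows p p).map of := rfl
  have hm : Measurable fun R : Matrix (Fin p) (Fin p) ℝ => (det (1 + g • (Rᵀ * R)⁻¹))⁻¹ := by
    have h1 : Measurable fun R : Matrix (Fin p) (Fin p) ℝ => (Rᵀ * R)⁻¹ :=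
      measurable_inv.comp (continuous_id.matrix_transpose.matrix_mul continuous_id).measurable
    have h2 : Measurable fun R : Matrix (Fin p) (Fin p) ℝ => (1 + g • R).det :=
      (continuous_const.add (continuous_id.const_smul g)).matrix_det.measurable
    have h3 : Measurable fun R : Matrix (Fin p) (Fin p) ℝ => (1 + g • (Rᵀ * R)⁻¹).det :=
      h2.comp h1
    exact h3.inv
  rw [hgm, integral_map (measurable_of p p).aemeasurable hm.aestronglyMeasurable]
  refine integral_congr_ae ?_
  filter_upwards [ae_det_ne_zero_square p] with x hx
  have hg : (of x)ᵀ * of x = gram Finset.univ x := by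
    have := transpose_mul_diagonal_mul x Finset.univ
    simpa using this
  have hM : IsUnit (gram Finset.univ x).det := by
    rw [← hg, det_mul, det_transpose]
    exact isUnit_iff_ne_zero.2 (mul_ne_zero hx hx)
  have h1 : gram Finset.univ x + g • 1 =
      gram Finset.univ x * (1 + g • (gram Finset.univ x)⁻¹) := by
    rw [Matrix.mul_add, Matrix.mul_one, Matrix.mul_smul, mul_nonsing_inv _ hM]
  rw [hg, shrink, h1, det_mul, div_mul_cancel_left₀ hM.ne_zero]

theorem integral_init_ratio_ge {Ω : Type*} [MeasurableSpace Ω] {μ : Measure Ω}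
    {Y₀ : Ω → Matrix (Fin n) (Fin p) ℝ} (hY₀ : Measurable Y₀) (hν : IsUniformStiefel (μ.map Y₀))
    (hp : 1 ≤ p) (hpq : p ≤ q) (hqn : q < n) {A : Matrix (Fin n) (Fin n) ℝ} {lam : Fin n → ℝ}
    {u : Fin n → Fin n → ℝ} (heig : IsEigendecomposition A lam u) {γ a : ℝ} (ha : 0 < a)
    (haγ : a * n ≤ γ * q / p ^ 2) :
    1 - Z p γ / 2 ≤ ∫ ω, ratio (topProj u q) a (Y₀ ω) ∂μ := by
  have hp0 : (0 : ℝ) < p := by exact_mod_cast hp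
  have hq0 : (0 : ℝ) < q := by exact_mod_cast hp.trans hpq
  have hqn0 : (q : ℝ) < n := by exact_mod_cast hqn
  set s : Finset (Fin n) := Finset.univ.filter fun i => (i : ℕ) < q with hs
  have hmap : s = Finset.univ.map (Fin.castLEEmb hqn.le) := by
    ext i
    simp only [hs, Finset.mem_filter, Finset.mem_univ, true_and, Finset.mem_map]
    exact ⟨fun h => ⟨⟨i, h⟩, rfl⟩, fun ⟨j, hj⟩ => by rw [← hj]; exact j.2⟩
  have hscard : s.card = q := by rw [hmap]; simp
  set V : Matrix (Fin n) (Fin q) ℝ := (of u)ᵀ.submatrix id (Fin.castLE hqn.le) with hV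
  set V' : Matrix (Fin n) (Fin q) ℝ :=
    (1 : Matrix (Fin n) (Fin n) ℝ).submatrix id (Fin.castLE hqn.le) with hV'
  have hVV : Vᵀ * V = 1 := by
    ext i j
    have := heig.orthonormal (Fin.castLE hqn.le i) (Fin.castLE hqn.le j)
    simpa [hV, Matrix.mul_apply, dotProduct, one_apply] using this
  have hVV' : V'ᵀ * V' = 1 := by
    ext i j
    simp [hV', Matrix.mul_apply, one_apply]
  have hsum : ∀ f : Fin n → ℝ, ∑ j : Fin q, f (Fin.castLE hqn.le j) =
      ∑ i : Fin n, if (i : ℕ) < q then f i else 0 := fun f => by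
    rw [← Finset.sum_filter, ← hs, hmap, Finset.sum_map]; rfl
  have hU : topProj u q = V * Vᵀ := by
    ext i j
    rw [topProj, Matrix.sum_apply, Matrix.mul_apply]
    simp only [hV, submatrix_apply, transpose_apply, of_apply, id]
    rw [hsum fun k => u k i * u k j]
    exact Finset.sum_congr rfl fun k _ => by split_ifs <;> simp [vecMulVec_apply]
  have hU' : V' * V'ᵀ = diagonal fun i => if i ∈ s then (1 : ℝ) else 0 := by
    ext i j
    rw [Matrix.mul_apply]
    refine (hsum fun k => (1 : Matrix (Fin n) (Fin n) ℝ) i k *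
      (1 : Matrix (Fin n) (Fin n) ℝ) j k).trans ?_
    by_cases hij : i = j
    · subst hij
      rw [Finset.sum_eq_single i (fun k _ hk => by simp [one_apply, Ne.symm hk]) (by simp)]
      simp [hs]
    · rw [diagonal_apply_ne _ hij]
      refine Finset.sum_eq_zero fun k _ => ?_
      by_cases hk : i = k
      · simp [one_apply, ← hk, Ne.symm hij]
      · simp [one_apply, hk]
  have h1 : ∫ ω, ratio (topProj u q) a (Y₀ ω) ∂μ =
      ∫ Y, ratio (topProj u q) a Y ∂(μ.map Y₀) :=
    (integral_map hY₀.aemeasurable measurable_ratio.aestronglyMeasurable).symm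
  rw [h1, hU, integral_ratio_stiefel_eq_gaussian (hpq.trans hqn.le) hqn.le ha hVV hVV' hν, hU']
  have hsc : ((sᶜ).card : ℝ) = n - q := by
    rw [Finset.card_compl, hscard, Fintype.card_fin, Nat.cast_sub hqn.le]
  have hκ : 0 < a * (sᶜ).card := by rw [hsc]; exact mul_pos ha (by linarith)
  refine le_trans ?_ (integral_ratio_diagonal_ge ha hκ rfl)
  have hγ : 0 < γ := by
    by_contra! h
    have h2 : γ * q / p ^ 2 ≤ 0 := div_nonpos_of_nonpos_of_nonneg
      (mul_nonpos_of_nonpos_of_nonneg h hq0.le) (sq_nonneg _)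
    nlinarith
  have hc : 0 < γ / p ^ 2 := by positivity
  -- The shift `a(n - q)` may be enlarged to `(γ/p²)q`, which is proportional to the number of rows;
  -- at `p` rows it becomes the `γ/p` in `Z`.
  have hκc : a * (sᶜ).card ≤ γ / p ^ 2 * q := by
    rw [hsc, div_mul_eq_mul_div]
    nlinarith
  have h2 := integral_mono (integrable_shrink_gram (n := n) (p := p) s (c := γ / p ^ 2 * q)
    (by positivity)) (integrable_shrink_gram s hκ)
    fun x => shrink_anti (gram_posSemidef s x) hκ hκc
  refine le_trans ?_ h2
  refine le_trans (le_of_eq ?_) (integral_shrink_gram_ge hp hpq hc hscard)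
  rw [Z, integral_gaussianMatrix_eq]
  have h3 : γ / p ^ 2 * p = γ * (p : ℝ)⁻¹ := by field_simp
  rw [h3]; ring

end

section

/-! ### The angular phase -/

variable {n p q : ℕ} {𝒜 : Measure (Matrix (Fin n) (Fin n) ℝ)} {A : Matrix (Fin n) (Fin n) ℝ}
  {lam : Fin n → ℝ} {u : Fin n → Fin n → ℝ} {σa σr : ℝ}

/-- The second-moment bound controls every eigenvalue of the mean. -/
theorem eigenvalue_sq_le [IsProbabilityMeasure 𝒜] (hA : HasMean 𝒜 A)
    (h : IsEigendecomposition A lam u) (hvar : VarianceCondition 𝒜 A σa σr) (i : Fin n) :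
    lam i ^ 2 ≤ σa ^ 2 := by
  have hui : u i ⬝ᵥ u i = 1 := by rw [h.orthonormal]; simp
  have hsym : Aᵀ = A := by
    obtain ⟨-, -, h3⟩ := eq_conj_of_eigen h
    rw [h3]; simp only [transpose_mul, transpose_transpose, diagonal_transpose, Matrix.mul_assoc]
  have hW : (vecMulVec (u i) (u i)).PosSemidef := by
    simpa using posSemidef_vecMulVec_self_star (u i)
  have hWA : Commute (vecMulVec (u i) (u i)) A := by
    rw [Commute, SemiconjBy, mul_vecMulVec, vecMulVec_mul, h.eigen, ← mulVec_transpose, hsym,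
      h.eigen, smul_vecMulVec, vecMulVec_smul]
  obtain ⟨h1, h2⟩ := hvar.angular (u i) _ hW hWA
  have htr : (vecMulVec (u i) (u i)).trace = 1 := by rw [trace_vecMulVec, hui]
  rw [htr, sqNorm_eq_dotProduct, hui, mul_one, mul_one] at h2
  have hsq : ∀ M : Matrix (Fin n) (Fin n) ℝ,
      u i ⬝ᵥ ((Mᵀ * vecMulVec (u i) (u i) * M) *ᵥ u i) = (u i ⬝ᵥ (M *ᵥ u i)) ^ 2 := fun M => by
    rw [dotProduct_gram_mulVec, vecMulVec_mulVec, dotProduct_smul, dotProduct_comm (M *ᵥ u i), sq]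
    simp
  simp only [hsq] at h1 h2
  have hquad : ∀ M : Matrix (Fin n) (Fin n) ℝ,
      (replicateRow Unit (u i) * M * replicateCol Unit (u i)) () () = u i ⬝ᵥ (M *ᵥ u i) :=
    fun M => by rw [Matrix.mul_assoc]; rfl
  obtain ⟨h3, h4⟩ := hA.integral_mul_mul (replicateRow Unit (u i)) (replicateCol Unit (u i)) () ()
  simp only [hquad] at h3 h4
  rw [h.eigen, dotProduct_smul, hui, smul_eq_mul, mul_one] at h4
  -- The variable `uᵀMu` has mean `lam i`, and taking `W = uuᵀ` in the angular condition bounds its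
  -- second moment by `σa²`. Nonnegativity of its variance is the claim.
  have h5 : 0 ≤ ∫ M, (u i ⬝ᵥ (M *ᵥ u i) - lam i) ^ 2 ∂𝒜 := integral_nonneg fun M => sq_nonneg _
  have h6 : ∀ M : Matrix (Fin n) (Fin n) ℝ, (u i ⬝ᵥ (M *ᵥ u i) - lam i) ^ 2 =
      (u i ⬝ᵥ (M *ᵥ u i)) ^ 2 - 2 * lam i * (u i ⬝ᵥ (M *ᵥ u i)) + lam i ^ 2 := fun M => by ring
  simp only [h6] at h5
  have h7 : Integrable (fun M : Matrix (Fin n) (Fin n) ℝ =>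
      (u i ⬝ᵥ (M *ᵥ u i)) ^ 2 - 2 * lam i * (u i ⬝ᵥ (M *ᵥ u i))) 𝒜 := h1.sub (h3.const_mul _)
  rw [integral_add h7 (integrable_const _), integral_sub h1 (h3.const_mul _), integral_const_mul, h4, integral_const] at h5
  simp only [probReal_univ, one_smul] at h5
  nlinarith

theorem eigengap_sq_le [IsProbabilityMeasure 𝒜] (hA : HasMean 𝒜 A)
    (h : IsEigendecomposition A lam u) (hvar : VarianceCondition 𝒜 A σa σr) (hqn : q < n) :
    eigengap lam q hqn ^ 2 ≤ 4 * σa ^ 2 := by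
  have h1 := eigenvalue_sq_le hA h hvar ⟨q - 1, lt_of_le_of_lt (Nat.sub_le q 1) hqn⟩
  have h2 := eigenvalue_sq_le hA h hvar ⟨q, hqn⟩
  rw [eigengap]
  nlinarith [sq_nonneg (lam ⟨q - 1, lt_of_le_of_lt (Nat.sub_le q 1) hqn⟩ + lam ⟨q, hqn⟩)]

/-- The bound on the failure probability, for a potential whose parameters fit the step size. -/
theorem IsRun.failure_bound {Ω : Type*} [MeasurableSpace Ω] {μ : Measure Ω}
    [IsProbabilityMeasure μ] [IsProbabilityMeasure 𝒜] {Y₀ : Ω → Matrix (Fin n) (Fin p) ℝ}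
    {S : ℕ → Ω → Matrix (Fin n) (Fin n) ℝ} (hrun : IsRun μ 𝒜 Y₀ S)
    (hq : 1 ≤ q) (hqn : q < n) (hA : HasMean 𝒜 A)
    (heig : IsEigendecomposition A lam u) {Δ : ℝ} (hΔ : Δ = eigengap lam q hqn) (hΔpos : 0 < Δ)
    {ε : ℝ} (hε : 0 < ε) (hε1 : ε ≤ 1) {η : ℝ} (hη : 0 < η)
    (hvar : VarianceCondition 𝒜 A σa σr) (hrank : RankCondition 𝒜 p)
    {a : ℝ} (ha : 0 < a) (ha1 : a ≤ 1) (hηΔ : η * Δ ≤ 1 / 2)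
    (hstep : η * σa ^ 2 * (q + a * (n - q)) * (p + ε) ≤ Δ * (a * ε)) {t : ℕ} (ht : 1 ≤ t) :
    μ.real (failureEvent (topProj u q) ε η Y₀ S t) ≤
      2 * ∫ ω, (1 - ratio (topProj u q) a (Y₀ ω)) ∂μ +
        Real.log (1 / (a * ε)) / (η * Δ / 2 * t) := by
  rw [hΔ] at hstep
  set U := topProj u q with hUdef
  have hU : IsProj U := isProj_topProj heig q
  set x : Matrix (Fin n) (Fin p) ℝ → ℝ := fun Y => 1 - ratio U a Y with hx
  -- On this set the potential still contracts: the bound `1/2` gives the rate, and the two bounds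
  -- by `aε` are the traces left by an absence of success.
  set G : Set (Matrix (Fin n) (Fin p) ℝ) :=
    {Y | 1 / 2 < ratio U a Y ∧ a * ε ≤ 1 - ratio U a Y ∧ a * ε ≤ defect U a Y} with hG
  have hr : Measurable (ratio (p := p) U a) := measurable_ratio
  have hxm : Measurable x := measurable_const.sub hr
  have hGm : MeasurableSet G :=
    (measurableSet_lt measurable_const hr).inter ((measurableSet_le measurable_const hxm).inter
      (measurableSet_le measurable_const measurable_defect))
  have hdrift : ∀ Y ∈ G, ∫ M, x (Y + η • (M * Y)) ∂𝒜 ≤ (1 - η * Δ / 2) * x Y := by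
    rintro Y ⟨h1, h2, h3⟩
    have h4 := expected_ratio_ge hA heig hq hqn hvar hrank hη ha hε
      (hΔ ▸ hΔpos.le) hstep (Y := Y) (by linarith) h3
    rw [← hΔ] at h4
    have hstepY : Measurable fun M : Matrix (Fin n) (Fin n) ℝ => Y + η • (M * Y) :=
      (continuous_const.add ((continuous_id.matrix_mul continuous_const).const_smul η)).measurable
    have h5 := integral_sub (μ := 𝒜) (integrable_const (1 : ℝ)) (integrable_ratio_comp hU ha hstepY)
    simp only [integral_const, probReal_univ, one_smul] at h5
    rw [hx, h5]
    -- The drift yields `x - ηΔ · ratio · x`; replacing `ratio` by its lower bound `1/2` gives the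
    -- factor `1 - ηΔ/2`.
    have h6 : 0 ≤ η * Δ * (1 - ratio U a Y) * (ratio U a Y - 1 / 2) :=
      mul_nonneg (mul_nonneg (by positivity) (by nlinarith [mul_pos ha hε])) (by linarith)
    nlinarith
  have hsub : failureEvent U ε η Y₀ S t ⊆
      {ω | ∀ k < t, iter η Y₀ S k ω ∈ G ∨ 1 / 2 ≤ x (iter η Y₀ S k ω)} := by
    intro ω hω k hk
    by_cases h : 1 / 2 < ratio U a (iter η Y₀ S k ω)
    · have hdet : ((iter η Y₀ S k ω)ᵀ * U * iter η Y₀ S k ω).det ≠ 0 := fun h0 => by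
        rw [ratio, h0, zero_div] at h
        norm_num at h
      obtain ⟨h1, h2⟩ := bounds_of_not_success hU ha ha1 hε hdet (hω k hk)
      exact Or.inl ⟨h, h2, h1⟩
    · exact Or.inr (by rw [hx]; linarith)
  have hmain := hrun.hitting_bound hxm
    (fun Y => ⟨sub_nonneg.2 (ratio_le_one hU ha Y), sub_le_self _ (ratio_nonneg hU ha Y)⟩) hGm
    (c := a * ε) (h := η * Δ / 2) (by positivity) (mul_le_one₀ ha1 hε.le hε1) (by positivity)
    (by linarith) (fun Y hY => ⟨hY.2.1, by have := hY.1; rw [hx]; linarith⟩) hdrift ht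
  exact (measureReal_mono hsub).trans hmain

theorem IsRun.angular_bound {Ω : Type*} [MeasurableSpace Ω] {μ : Measure Ω}
    [IsProbabilityMeasure μ] [IsProbabilityMeasure 𝒜] {Y₀ : Ω → Matrix (Fin n) (Fin p) ℝ}
    {S : ℕ → Ω → Matrix (Fin n) (Fin n) ℝ} (hrun : IsRun μ 𝒜 Y₀ S)
    (hp : 1 ≤ p) (hpq : p ≤ q) (hqn : q < n) (hA : HasMean 𝒜 A)
    (heig : IsEigendecomposition A lam u) {Δ : ℝ} (hΔ : Δ = eigengap lam q hqn) (hΔpos : 0 < Δ)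
    {ε : ℝ} (hε : 0 < ε) (hε1 : ε ≤ 1) {η : ℝ} (hη : 0 < η)
    (hvar : VarianceCondition 𝒜 A σa σr) (hrank : RankCondition 𝒜 p)
    {γ : ℝ} (hγ : γ = stepParam n p σa Δ ε η) (hstep : γ ≤ 1) {t : ℕ} (ht : 1 ≤ t) :
    μ.real (failureEvent (topProj u q) ε η Y₀ S t) ≤
      Z p γ + 4 * n * σa ^ 2 * p ^ 2 * (p + ε) / (Δ ^ 2 * γ * ε * t) *
        Real.log (n * p ^ 2 / (γ * q * ε)) := by
  have hp1 : (1 : ℝ) ≤ p := by exact_mod_cast hp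
  have hpq' : (p : ℝ) ≤ q := by exact_mod_cast hpq
  have hqn' : (q : ℝ) + 1 ≤ n := by exact_mod_cast hqn
  have ht0 : (0 : ℝ) < t := by exact_mod_cast ht
  have hp0 : (0 : ℝ) < p := by linarith
  have hq0 : (0 : ℝ) < q := by linarith
  have hn0 : (0 : ℝ) < n := by linarith
  have hgap : Δ ^ 2 ≤ 4 * σa ^ 2 := hΔ ▸ eigengap_sq_le hA heig hvar hqn
  have hσ : 0 < σa ^ 2 := by nlinarith [pow_pos hΔpos 2]
  have hσ0 : σa ≠ 0 := fun h0 => by simp [h0] at hσ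
  have hγ0 : 0 < γ := by rw [hγ, stepParam]; positivity
  have hγη : γ * (Δ * ε) = 2 * n * σa ^ 2 * p ^ 2 * (p + ε) * η := by
    rw [hγ, stepParam]; field_simp
  have hp2 : (1 : ℝ) ≤ (p : ℝ) ^ 2 := one_le_pow₀ hp1
  -- The initial bound allows at most `an = γq/p²`, while the drift needs `a` large compared with
  -- `η`. This value attains the former and, thanks to `γ ≤ 1`, also meets the latter.
  set a : ℝ := γ * q / (n * p ^ 2) with ha_def
  have ha : 0 < a := by positivity
  have han : a * n = γ * q / p ^ 2 := by rw [ha_def]; field_simp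
  have hanq : a * n ≤ q := by
    rw [han, div_le_iff₀ (by positivity)]
    nlinarith
  have ha1 : a ≤ 1 := by
    by_contra! h
    nlinarith
  -- This ensures a contraction rate of at most `1/4`. From `γ ≤ 1` one gets `8σa²η ≤ Δ`, and `Δ² ≤
  -- 4σa²` turns it into `2Δ²η ≤ Δ`.
  have hηΔ : η * Δ ≤ 1 / 2 := by
    have h1 : 2 * n * σa ^ 2 * p ^ 2 * (p + ε) * η ≤ Δ * ε := by
      rw [← hγη]; exact mul_le_of_le_one_left (by positivity) hstep
    have h2 : 4 * ε ≤ n * p ^ 2 * (p + ε) := by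
      have h3 : 2 ≤ n * (p : ℝ) ^ 2 := by nlinarith
      nlinarith
    have h3 : 4 * ε * (2 * σa ^ 2 * η) ≤ n * p ^ 2 * (p + ε) * (2 * σa ^ 2 * η) :=
      mul_le_mul_of_nonneg_right h2 (by positivity)
    have h4 : ε * (8 * σa ^ 2 * η) ≤ ε * Δ := by nlinarith
    have h5 := le_of_mul_le_mul_left h4 hε
    have h6 : 2 * Δ ^ 2 * η ≤ Δ := by nlinarith
    nlinarith
  have hstep' : η * σa ^ 2 * (q + a * (n - q)) * (p + ε) ≤ Δ * (a * ε) := by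
    have h1 : Δ * (a * ε) = η * σa ^ 2 * (2 * q) * (p + ε) := by
      have : Δ * (a * ε) = γ * (Δ * ε) * q / (n * p ^ 2) := by rw [ha_def]; ring
      rw [this, hγη]; field_simp
    rw [h1]
    -- The trace of `W` is at most `2q` because `an ≤ q`; the factor `2` in the definition of `γ`
    -- pays for it.
    have h2 : q + a * (n - q) ≤ 2 * (q : ℝ) := by nlinarith
    gcongr
  refine (hrun.failure_bound (hp.trans hpq) hqn hA heig hΔ hΔpos hε hε1 hη hvar hrank ha ha1 hηΔ
    hstep' ht).trans ?_
  have hinit := integral_init_ratio_ge hrun.measurable_init hrun.law_init hp hpq hqn heig ha han.le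
  have hinit' : ∫ ω, (1 - ratio (topProj u q) a (Y₀ ω)) ∂μ =
      1 - ∫ ω, ratio (topProj u q) a (Y₀ ω) ∂μ := by
    have h5 := integral_sub (μ := μ) (integrable_const (1 : ℝ))
      (integrable_ratio_comp (isProj_topProj heig q) ha hrun.measurable_init)
    simp only [integral_const, probReal_univ, one_smul] at h5
    exact h5
  have hlog : 1 / (a * ε) = n * p ^ 2 / (γ * q * ε) := by
    rw [ha_def]; field_simp
  have hcoef : 4 * n * σa ^ 2 * p ^ 2 * (p + ε) / (Δ ^ 2 * γ * ε * t) =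
      (η * Δ / 2 * t)⁻¹ := by
    have h1 : 4 * n * σa ^ 2 * p ^ 2 * (p + ε) = 2 * (γ * (Δ * ε)) / η := by
      rw [hγη]; field_simp; ring
    rw [h1]; field_simp
  rw [hinit', hlog, hcoef, div_eq_inv_mul]
  linarith

end

end Alecton

end

theorem theorem1 {Ω : Type*} [MeasurableSpace Ω] (μ : Measure Ω) [IsProbabilityMeasure μ]
    {n p q : ℕ} (hp : 1 ≤ p) (hpq : p ≤ q) (hqn : q < n)
    (𝒜 : Measure (Matrix (Fin n) (Fin n) ℝ)) [IsProbabilityMeasure 𝒜]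
    (A : Matrix (Fin n) (Fin n) ℝ) (hA : Alecton.HasMean 𝒜 A)
    (lam : Fin n → ℝ) (u : Fin n → Fin n → ℝ) (heig : Alecton.IsEigendecomposition A lam u)
    (Δ : ℝ) (hΔ : Δ = Alecton.eigengap lam q hqn) (hΔpos : 0 < Δ)
    (ε : ℝ) (hε : 0 < ε) (hε1 : ε ≤ 1)
    (η : ℝ) (hη : 0 < η)
    (σa σr : ℝ) (hvar : Alecton.VarianceCondition 𝒜 A σa σr)
    (hrank : Alecton.RankCondition 𝒜 p)
    (γ : ℝ) (hγ : γ = Alecton.stepParam n p σa Δ ε η) (hstep : γ ≤ 1)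
    (Y₀ : Ω → Matrix (Fin n) (Fin p) ℝ) (S : ℕ → Ω → Matrix (Fin n) (Fin n) ℝ)
    (hrun : Alecton.IsRun μ 𝒜 Y₀ S) :
    (∀ t : ℕ, 1 ≤ t →
      μ.real (Alecton.failureEvent (Alecton.topProj u q) ε η Y₀ S t) ≤
        Alecton.Z p γ +
          4 * n * σa ^ 2 * p ^ 2 * (p + ε) / (Δ ^ 2 * γ * ε * t) *
            Real.log (n * p ^ 2 / (γ * q * ε))) ∧
    ((p = 1 ∨ ∀ᵐ M ∂𝒜, M.IsSymm) →
      ∀ K L : ℕ, 1 ≤ L → ∀ ψ : ℝ, 0 < ψ →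
        μ.real {ω | ψ ≤ Alecton.frobSq
            (Alecton.radialMean η Y₀ S K L ω -
              (Alecton.angularOutput η Y₀ S K ω)ᵀ * A * Alecton.angularOutput η Y₀ S K ω)} ≤
          p ^ 2 * σr ^ 2 / (L * ψ)) :=
  ⟨fun _ ht => hrun.angular_bound hp hpq hqn hA heig hΔ hΔpos hε hε1 hη hvar hrank hγ hstep ht,
    fun hsym K _ hL _ hψ => hrun.radial_bound hA hvar hsym K hL hψ⟩
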